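/- Let $F(s)=\sum_{n\ge1}a(n)n^{-s}$ belong to the extended Selberg class $\mathcal S^\sharp$: the Dirichlet series is not identically zero and converges absolutely for $\Re s>1$, $(s-1)^mF(s)$ is entire of finite order for some integer $m\ge0$, and $F(s)\gamma(s)=\omega\,\overline{\gamma(1-\bar s)}\;\overline{F(1-\bar s)}$, where $|\omega|=1$ and $\gamma(s)=Q^s\prod_{j=1}^r\Gamma(\lambda_js+\mu_j)$ with $Q>0$, $r\ge0$, $\lambda_j>0$, $\Re\mu_j\ge0$. Put $$d_F=2\sum_j\lambda_j,\qquad q_F=(2\pi)^{d_F}Q^2\prod_j\lambda_j^{2\lambda_j},\qquad \omega_F=\omega\prod_j\lambda_j^{-2i\,\Im\mu_j},\qquad \xi_F=2\sum_j(\mu_j-\tfrac12),\qquad \theta_F=\frac{\Im\xi_F}{d_F},$$ $$H_F(n)=2\sum_j\frac{B_n(\mu_j)}{\lambda_j^{n-1}}\quad(B_n\text{ the }n\text{-th Bernoulli polynomial}),\qquad \chi_F=\xi_F+H_F(2)+\tfrac23,$$ $$h_F(s)=\frac{\omega}{(2\pi)^r}Q^{1-2s}\prod_{j}\Gamma(\lambda_j(1-s)+\overline{\mu_j})\,\Gamma(1-\lambda_js-\mu_j).$$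 Suppose that $d_F=2$, $q_F=1$, and that $F$ is normalized, i.e. $\theta_F=0$ and the first nonvanishing coefficient $a(n)$ equals $1$. Then there is exactly one sequence $(d_\ell(F))_{\ell\ge0}$ of complex numbers (the structural invariants of $F$) such that, for all integers $M\ge0$ and all $\delta>0$, $$h_F(s)=\frac{\omega_F}{\sqrt{2\pi}}(4\pi)^{2s-1}\Big(\sum_{\ell=0}^{M}d_\ell(F)\,\Gamma(\tfrac32-2s-\ell)+O\Big(\frac{|\Gamma(\frac32-2s-M)|}{|s|}\Big)\Big)$$ as $|s|\to\infty$ with $|\arg s|\ge\delta$, the implied constant depending at most on $F$ (with the data of its functional equation), $M$ and $\delta$. Moreover $$d_1(F)=\chi_F-\tfrac18.$$ -/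

import Mathlib

namespace SelbergClass

open scoped ComplexConjugate

/-- The data of a gamma factor `γ(s) = Q ^ s * ∏ j, Γ(lam j * s + mu j)`,
with `Q > 0`, `r ≥ 0`, `lam j > 0` and `Re (mu j) ≥ 0`. -/
structure GammaFactor where
  r : ℕ
  Q : ℝ
  lam : Fin r → ℝ
  mu : Fin r → ℂ
  Q_pos : 0 < Q
  lam_pos : ∀ j, 0 < lam j
  mu_re_nonneg : ∀ j, 0 ≤ (mu j).re

noncomputable section

namespace GammaFactor

variable (γ : GammaFactor)

/-- The function `γ(s) = Q ^ s * ∏ j, Γ(lam j * s + mu j)`. -/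
def eval (s : ℂ) : ℂ :=
  (γ.Q : ℂ) ^ s * ∏ j, Complex.Gamma (γ.lam j * s + γ.mu j)

/-- `s` is not a pole of any of the Gamma functions in `γ(s)`. -/
def RegularAt (s : ℂ) : Prop :=
  ∀ j, ∀ k : ℕ, (γ.lam j : ℂ) * s + γ.mu j ≠ -(k : ℂ)

/-- The degree `d = 2 ∑ lam j`. -/
def degree : ℝ := 2 * ∑ j, γ.lam j

/-- The conductor `q = (2π) ^ d * Q ^ 2 * ∏ lam j ^ (2 * lam j)`. -/
def conductor : ℝ :=
  (2 * Real.pi) ^ γ.degree * γ.Q ^ 2 * ∏ j, γ.lam j ^ (2 * γ.lam j)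

/-- The invariant `ξ = 2 ∑ (mu j - 1 / 2)`. -/
def xi : ℂ := 2 * ∑ j, (γ.mu j - 1 / 2)

/-- The internal shift `θ`, defined by `ξ = η + i d θ` with `η`, `θ` real. -/
def theta : ℝ := γ.xi.im / γ.degree

/-- The `H`-invariants `H(n) = 2 ∑ B_n(mu j) / lam j ^ (n - 1)`, where `B_n` is the `n`-th
Bernoulli polynomial. The exponent `n - 1` is an integer. -/
def H (n : ℕ) : ℂ :=
  2 * ∑ j, Polynomial.aeval (γ.mu j) (Polynomial.bernoulli n) /
    (γ.lam j : ℂ) ^ ((n : ℤ) - 1)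

/-- The eigenweight `χ = ξ + H(2) + 2 / 3`. -/
def chi : ℂ := γ.xi + γ.H 2 + 2 / 3

/-- The root number `ω_F = ω * ∏ lam j ^ (-2 i Im (mu j))`. -/
def rootNumber (ω : ℂ) : ℂ :=
  ω * ∏ j, (γ.lam j : ℂ) ^ (-2 * Complex.I * ((γ.mu j).im : ℂ))

/-- The `h`-function
`h(s) = ω / (2π) ^ r * Q ^ (1 - 2 s) *
  ∏ Γ(lam j * (1 - s) + conj (mu j)) * Γ(1 - lam j * s - mu j)`. -/
def hFun (ω s : ℂ) : ℂ :=
  ω / (2 * Real.pi : ℂ) ^ γ.r * (γ.Q : ℂ) ^ (1 - 2 * s) *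
    ∏ j, (Complex.Gamma (γ.lam j * (1 - s) + conj (γ.mu j)) *
      Complex.Gamma (1 - γ.lam j * s - γ.mu j))

/-- The points `s*_ℓ = (d + 1) / (2 d) - ℓ / d - i θ`. -/
def sStar (l : ℕ) : ℂ :=
  (γ.degree + 1) / (2 * γ.degree) - l / γ.degree - Complex.I * γ.theta

/-- The factor `ω_F / √(2π) * (q ^ (1 / d) / (2 π d)) ^ (d (1 / 2 - s))` in front of the
expansion of the `h`-function. -/
def prefactor (ω s : ℂ) : ℂ :=
  γ.rootNumber ω / (Real.sqrt (2 * Real.pi) : ℂ) *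
    ((γ.conductor ^ (1 / γ.degree) / (2 * Real.pi * γ.degree) : ℝ) : ℂ) ^
      ((γ.degree : ℂ) * (1 / 2 - s))

/-- `c ℓ` (`ℓ = 0, 1, 2, ...`) are the structural invariants, i.e. the coefficients of the
asymptotic expansion
`h(s) ≈ ω_F / √(2π) * (q ^ (1 / d) / (2 π d)) ^ (d (1 / 2 - s)) * ∑ ℓ, c ℓ * Γ(d (s*_ℓ - s))`:
for every `M`, as `|s| → ∞` outside an arbitrarily small angle around the positive real axis,
the error made by cutting the sum after the term `ℓ = M` is `O(1 / |s|)` times the modulus of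
the `M`-th function of the asymptotic scale. -/
def IsStructuralInvariants (ω : ℂ) (c : ℕ → ℂ) : Prop :=
  ∀ M : ℕ, ∀ δ : ℝ, 0 < δ → ∃ C R : ℝ, ∀ s : ℂ, R ≤ ‖s‖ → δ ≤ |Complex.arg s| →
    ‖γ.hFun ω s - γ.prefactor ω s *
        ∑ l ∈ Finset.range (M + 1), c l * Complex.Gamma (γ.degree * (γ.sStar l - s))‖
      ≤ C * (‖γ.prefactor ω s * Complex.Gamma (γ.degree * (γ.sStar M - s))‖ / ‖s‖)

end GammaFactor

/-- `F` belongs to the extended Selberg class, with Dirichlet coefficients `a n` (`n ≥ 1`) and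
with the functional equation `F(s) γ(s) = ω * conj (γ(conj (1 - s))) * conj (F(conj (1 - s)))`.
As `F` may have a pole at `1`, the value `F 1` carries no information: since `m` is arbitrary,
the field `continuation` holds for one value of `F 1` (with some `m`) iff it holds for all. -/
structure IsExtendedSelberg (F : ℂ → ℂ) (a : ℕ → ℂ) (γ : GammaFactor) (ω : ℂ) : Prop where
  nonzero : ∃ n : ℕ, 1 ≤ n ∧ a n ≠ 0
  summable : ∀ s : ℂ, 1 < s.re → LSeriesSummable a s
  eq_LSeries : ∀ s : ℂ, 1 < s.re → F s = LSeries a s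
  /-- `(s - 1) ^ m * F(s)` is entire of finite order for some `m ≥ 0`. -/
  continuation : ∃ m : ℕ, Differentiable ℂ (fun s : ℂ => (s - 1) ^ m * F s) ∧
    ∃ ρ C : ℝ, ∀ s : ℂ, ‖(s - 1) ^ m * F s‖ ≤ C * Real.exp (‖s‖ ^ ρ)
  norm_omega : ‖ω‖ = 1
  /-- The functional equation, at every point where none of the factors can have a pole. -/
  functional_equation : ∀ s : ℂ, s ≠ 0 → s ≠ 1 → γ.RegularAt s → γ.RegularAt (conj (1 - s)) →
    F s * γ.eval s = ω * conj (γ.eval (conj (1 - s))) * conj (F (conj (1 - s)))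

/-- The normalization condition: the internal shift vanishes and the first nonvanishing
Dirichlet coefficient is `1`. -/
def IsNormalized (a : ℕ → ℂ) (γ : GammaFactor) : Prop :=
  γ.theta = 0 ∧ ∃ n : ℕ, 1 ≤ n ∧ a n = 1 ∧ ∀ k : ℕ, 1 ≤ k → k < n → a k = 0

end

end SelbergClass

namespace SelbergClass

open Filter Topology Asymptotics MeasureTheory
open scoped ComplexConjugate

/-! ### Analytic functions at `0` -/

/-! The expansion itself is Stirling's formula. Put `s = -w`. Each of the `2r` Gamma factors of `h`
is an elementary main term times an asymptotic series in `1 / w`. Degree 2, conductor 1 and `θ = 0`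
say exactly that the main terms combine into the prefactor times the main term of a single `Γ(2w +
3/2)` (`hFun_eq`). The remaining quotient `hQuotient` has an expansion in powers of `1 / w`, and
this is rewritten in the scale `Γ(2w + 3/2 - l) / Γ(2w + 3/2)` (`AsympExp.exists_gammaScale`).
Uniqueness follows by comparing two expansions along the negative real axis. So far only the gamma
data and `ω ≠ 0` matter.

The second term of Stirling's formula for `Γ(w + a)` is `B_2(a) / (2w)`. Collecting these terms
gives `d_1 = conj ξ + (H(2) + conj H(2)) / 2 + 2/3 - 1/8`. Since `θ = 0` makes `ξ` real, the
asserted value amounts to `Im H(2) = 0`. This is the substantial part of the proof, and it is where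
`F` enters.

Step one: the coefficients of `F` are real. Let `f` and `g` be the Fourier series on the upper half
plane with coefficients `a(n)` and `conj a(n)`. Up to a factor `1 + c/s + O(s⁻²)`, the functional
equation is that of the single gamma factor `(2π)^(-s) Γ(s)`. Mellin inversion and a contour shift
therefore give an approximate modular relation between `f(z)` and `κ z⁻¹ g(-1/z)`, up to a term from
the bounded part of the contour and a controlled error (`exists_norm_qSeries_sub_le`). Let `z =
-1/(w - n)` tend to the cusp 0. Reflecting at `z` produces `g(w)`. Reflecting at `1 + z` and then
once more with the dual relation produces `f(w)`. The contour terms are not small, but they are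
asymptotically independent of `w`, so `g - κ' f` is constant on the upper half plane
(`qSeries_sub_eq`). Hence `conj a(n) = κ' a(n)` for all `n ≥ 1`, and a coefficient equal to 1 gives
`κ' = 1`.

Step two: real coefficients give `conj F(conj s) = F(s)`. Using the functional equation at `s` and
at `1 - s` and cancelling `F(s) F(1 - s)` shows that `γ(s) γ(1 - s)` equals `ω²` times the same
expression for the dual factor `conj γ(conj s)` (`inv_eval_dual_eq`). The quotient of `γ` by its
dual then continues to a bounded entire function, so it is constant by Liouville. Its Stirling
expansion has `1/w` coefficient `(i/2) Im H(2)`, which must vanish (`H_two_im_eq_zero`). -/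

lemma exists_eq_add_mul_analyticAt {h : ℂ → ℂ} (hh : AnalyticAt ℂ h 0) :
    ∃ k : ℂ → ℂ, AnalyticAt ℂ k 0 ∧ ∀ x, h x = h 0 + x * k x := by
  obtain ⟨p, hp⟩ := hh
  refine ⟨dslope h 0, ⟨_, hp.has_fpower_series_dslope_fslope⟩, fun x => ?_⟩
  have := sub_smul_dslope h 0 x
  simp only [sub_zero, smul_eq_mul] at this
  rw [this]; ring

lemma hasDerivAt_zero_of_eq_add_mul {h k : ℂ → ℂ} (hk : AnalyticAt ℂ k 0)
    (hx : ∀ x, h x = h 0 + x * k x) : HasDerivAt h (k 0) 0 := by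
  have h1 := ((hasDerivAt_id (0 : ℂ)).mul hk.differentiableAt.hasDerivAt).const_add (h 0)
  simp only [id, zero_mul, one_mul, add_zero] at h1
  exact (funext hx : h = fun x => h 0 + x * k x) ▸ h1

/-- An analytic function has polynomial approximations of every order. -/
lemma exists_polynomial_add_pow_mul {h : ℂ → ℂ} (hh : AnalyticAt ℂ h 0) (n : ℕ) :
    ∃ (p : Polynomial ℂ) (k : ℂ → ℂ), AnalyticAt ℂ k 0 ∧ ∀ x, h x = p.eval x + x ^ n * k x := by
  induction n with
  | zero => exact ⟨0, h, hh, fun x => by simp⟩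
  | succ n ih =>
    obtain ⟨p, k, hk, h1⟩ := ih
    obtain ⟨k', hk', h2⟩ := exists_eq_add_mul_analyticAt hk
    refine ⟨p + Polynomial.C (k 0) * Polynomial.X ^ n, k', hk', fun x => ?_⟩
    rw [h1, h2 x]
    simp
    ring

/-- An analytic function which is `O(x ^ n)` at `0` is divisible by `x ^ n`. -/
lemma exists_eq_pow_mul_of_isBigO {h : ℂ → ℂ} (hh : AnalyticAt ℂ h 0) (n : ℕ)
    (hO : h =O[𝓝 0] fun x => x ^ n) :
    ∃ k : ℂ → ℂ, AnalyticAt ℂ k 0 ∧ ∀ x, h x = x ^ n * k x := by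
  induction n with
  | zero => exact ⟨h, hh, fun x => by simp⟩
  | succ n ih =>
    have h1 : (fun x : ℂ => x ^ (n + 1)) =O[𝓝 0] fun x => x ^ n :=
      IsBigO.of_bound 1 <| by
        filter_upwards [Metric.ball_mem_nhds (0 : ℂ) one_pos] with x hx
        have : ‖x‖ ≤ 1 := by simpa using (mem_ball_zero_iff.1 hx).le
        rw [one_mul, norm_pow, norm_pow]
        exact pow_le_pow_of_le_one (norm_nonneg _) this (Nat.le_succ n)
    obtain ⟨k, hk, hx⟩ := ih (hO.trans h1)
    obtain ⟨k1, hk1, hx1⟩ := exists_eq_add_mul_analyticAt hk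
    have hk0 : k 0 = 0 := by
      have hk_lim : Tendsto k (𝓝[≠] 0) (𝓝 (k 0)) := hk.continuousAt.tendsto.mono_left inf_le_left
      obtain ⟨C, hC⟩ := hO.bound
      have h0 : Tendsto (fun x : ℂ => C * ‖x‖) (𝓝[≠] 0) (𝓝 0) := by
        have : Tendsto (fun x : ℂ => C * ‖x‖) (𝓝 0) (𝓝 (C * ‖(0 : ℂ)‖)) :=
          (continuous_const.mul continuous_norm).tendsto _
        rw [norm_zero, mul_zero] at this
        exact this.mono_left inf_le_left
      have hk_zero : Tendsto k (𝓝[≠] 0) (𝓝 0) := by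
        refine squeeze_zero_norm' ?_ h0
        filter_upwards [hC.filter_mono inf_le_left, self_mem_nhdsWithin] with x hx' hne
        rw [hx, norm_mul, norm_pow, norm_pow, pow_succ] at hx'
        have hp : 0 < ‖x‖ ^ n := pow_pos (norm_pos_iff.2 hne) n
        refine le_of_mul_le_mul_left ?_ hp
        linarith
      exact tendsto_nhds_unique hk_lim hk_zero
    refine ⟨k1, hk1, fun x => ?_⟩
    rw [hx, hx1, hk0]; ring

lemma exists_log_one_add_eq :
    ∃ m : ℂ → ℂ, AnalyticAt ℂ m 0 ∧
      ∀ x, Complex.log (1 + x) = x - x ^ 2 / 2 + x ^ 3 / 3 + x ^ 4 * m x := by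
  have han : AnalyticAt ℂ (fun x : ℂ => Complex.log (1 + x) - (x - x ^ 2 / 2 + x ^ 3 / 3)) 0 := by
    refine AnalyticAt.sub (AnalyticAt.clog (by fun_prop) (by simp)) (by fun_prop)
  obtain ⟨m, hm, h⟩ := exists_eq_pow_mul_of_isBigO han 4 (by
    refine IsBigO.of_bound 1 ?_
    filter_upwards [Metric.ball_mem_nhds (0 : ℂ) (half_pos one_pos)] with x hx
    have hx' : ‖x‖ < 1 / 2 := by simpa using hx
    have := Complex.norm_log_sub_logTaylor_le 3 (z := x) (by linarith)
    have ht : Complex.logTaylor (3 + 1) x = x - x ^ 2 / 2 + x ^ 3 / 3 := by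
      simp [Complex.logTaylor, Finset.sum_range_succ]
      ring
    rw [ht] at this
    refine this.trans ?_
    have hi : (1 - ‖x‖)⁻¹ ≤ 2 := by
      rw [inv_le_comm₀ (by linarith) (by norm_num)]; linarith
    rw [norm_pow, one_mul]
    have h4 : 0 ≤ ‖x‖ ^ 4 := by positivity
    norm_num
    nlinarith)
  exact ⟨m, hm, fun x => by rw [← h x]; ring⟩

/-- With `x = 1/w` the map `x ↦ x / (1 + x)` is the shift `w ↦ w + 1`. The leading coefficient `j`
of the difference is nonzero for `j ≥ 1`, which lets the difference equation below be solved term by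
term. -/
lemma exists_pow_sub_pow_shift (j : ℕ) :
    ∃ k : ℂ → ℂ, AnalyticAt ℂ k 0 ∧ k 0 = j ∧
      ∀ x : ℂ, 1 + x ≠ 0 → x ^ j - (x / (1 + x)) ^ j = x ^ (j + 1) * k x := by
  have hsl : ((1 : ℂ) + 0) ^ j ≠ 0 := by simp
  have han : AnalyticAt ℂ (fun x : ℂ => 1 - ((1 + x) ^ j)⁻¹) 0 := by
    refine analyticAt_const.sub (AnalyticAt.inv ?_ hsl)
    fun_prop
  obtain ⟨k, hk, h⟩ := exists_eq_add_mul_analyticAt han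
  have h' : ∀ x, 1 - ((1 + x) ^ j)⁻¹ = x * k x := fun x => by simpa using h x
  refine ⟨k, hk, ?_, fun x hx => ?_⟩
  · have hd := hasDerivAt_zero_of_eq_add_mul hk h
    have hd' : HasDerivAt (fun x : ℂ => 1 - ((1 + x) ^ j)⁻¹) (j : ℂ) 0 := by
      have h1 : HasDerivAt (fun x : ℂ => (1 + x) ^ j) (j : ℂ) 0 := by
        simpa using ((hasDerivAt_id (0 : ℂ)).const_add 1).fun_pow j
      simpa using (h1.fun_inv hsl).const_sub 1
    exact hd.unique hd'
  · have : x ^ (j + 1) * k x = x ^ j * (x * k x) := by ring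
    rw [this, ← h' x, div_pow]
    field_simp

/-- Solving the difference equation `P(x) - P(x / (1 + x)) = x ^ 2 * g(x)` by polynomials. -/
lemma exists_polynomial_telescope {g : ℂ → ℂ} (hg : AnalyticAt ℂ g 0) (K : ℕ) :
    ∃ (P : Polynomial ℂ) (k : ℂ → ℂ), P.coeff 0 = 0 ∧ (1 ≤ K → P.coeff 1 = g 0) ∧
      (K = 0 → P = 0 ∧ k 0 = g 0) ∧ AnalyticAt ℂ k 0 ∧ ∀ x : ℂ, 1 + x ≠ 0 →
        x ^ 2 * g x - P.eval x + P.eval (x / (1 + x)) = x ^ (K + 2) * k x := by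
  induction K with
  | zero => exact ⟨0, g, by simp, by simp, by simp, hg, by simp⟩
  | succ K ih =>
    obtain ⟨P, k, hP0, hP1, hP2, hk, h⟩ := ih
    obtain ⟨k1, hk1, h1⟩ := exists_eq_add_mul_analyticAt hk
    obtain ⟨m, hm, hm0, hm'⟩ := exists_pow_sub_pow_shift (K + 1)
    obtain ⟨m1, hm1, h2⟩ := exists_eq_add_mul_analyticAt hm
    -- The monomial `c x^(K+1)` contributes `(K+1) c x^(K+2)` to leading order, so this `c` removes
    -- the leading term of the remainder.
    set c : ℂ := k 0 / (K + 1) with hc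
    have hK : (K + 1 : ℂ) ≠ 0 := Nat.cast_add_one_ne_zero K
    refine ⟨P + Polynomial.C c * Polynomial.X ^ (K + 1), fun x => k1 x - c * m1 x, ?_, ?_,
      by simp, hk1.sub (analyticAt_const.mul hm1), fun x hxne => ?_⟩
    · simp [hP0, Polynomial.coeff_X_pow]
    · intro _
      rcases Nat.eq_zero_or_pos K with rfl | hKpos
      · obtain ⟨rfl, hk0⟩ := hP2 rfl
        simp [hc, hk0]
      · simp [hP1 hKpos, Polynomial.coeff_X_pow, hKpos.ne']
    · have hx := h x hxne
      have e1 := hm' x hxne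
      rw [h2 x, hm0] at e1
      rw [h1 x] at hx
      simp only [Polynomial.eval_add, Polynomial.eval_mul, Polynomial.eval_C, Polynomial.eval_pow,
        Polynomial.eval_X]
      have hck : c * ((K + 1 : ℕ) : ℂ) = k 0 := by
        rw [hc]; push_cast; field_simp
      linear_combination hx - c * e1 - x ^ (K + 2) * hck

/-- The logarithmic increment in Stirling's formula is `O(x ^ 2)`, with `x = 1 / w`. -/
lemma exists_stirling_increment (a : ℂ) :
    ∃ g : ℂ → ℂ, AnalyticAt ℂ g 0 ∧ g 0 = (a ^ 2 - a + 1 / 6) / 2 ∧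
      ∀ x, x ≠ 0 → (x⁻¹ + a + 1 / 2) * Complex.log (1 + x) - 1 - Complex.log (1 + a * x) =
        x ^ 2 * g x := by
  obtain ⟨m, hm, h⟩ := exists_log_one_add_eq
  have hma : AnalyticAt ℂ (fun x => m (a * x)) 0 := by
    refine AnalyticAt.fun_comp_of_eq (y := 0) hm (by fun_prop) (by simp)
  -- The terms of order 0 and 1 in `x` cancel. At order 2 there remains `1/3 - (a + 1/2)/2 + a²/2`,
  -- which is `B_2(a)/2`.
  refine ⟨fun x => (a ^ 2 - a + 1 / 6) / 2 + x * (m x + a / 3 + 1 / 6 - a ^ 3 / 3)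
    + x ^ 2 * ((a + 1 / 2) * m x - a ^ 4 * m (a * x)), ?_, by simp, fun x hx => ?_⟩
  · have hx : AnalyticAt ℂ (fun x : ℂ => x) 0 := analyticAt_id
    have hc : ∀ c : ℂ, AnalyticAt ℂ (fun _ : ℂ => c) 0 := fun c => analyticAt_const
    exact ((hc _).add (hx.mul (((hm.add (hc _)).add (hc _)).sub (hc _)))).add
      ((hx.pow 2).mul (((hc _).mul hm).sub ((hc _).mul hma)))
  rw [h x, h (a * x)]
  field_simp
  ring

/-! ### Sectors -/

/-- Neighbourhoods of infinity in the sector `|arg w| ≤ π - δ`. -/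
noncomputable def sectorAtInf (δ : ℝ) : Filter ℂ := comap norm atTop ⊓ 𝓟 {w | |w.arg| ≤ Real.pi - δ}

lemma eventually_sectorAtInf {δ : ℝ} {p : ℂ → Prop} :
    (∀ᶠ w in sectorAtInf δ, p w) ↔ ∃ R : ℝ, ∀ w, R ≤ ‖w‖ → |w.arg| ≤ Real.pi - δ → p w := by
  rw [sectorAtInf, eventually_inf_principal, eventually_comap, eventually_atTop]
  constructor
  · rintro ⟨R, h⟩
    exact ⟨R, fun w hw => h _ hw w rfl⟩
  · rintro ⟨R, h⟩
    exact ⟨R, fun b hb w hw => h w (hw ▸ hb)⟩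

/-- In the sector `Re w ≥ -‖w‖ cos δ`. Since `cos δ = 1 - 2 sin²(δ/2)`, the squared inequality
reduces to `(1 - sin²(δ/2)) (‖w‖ - x)² ≥ 0`. It keeps all translates `w + n` away from 0, with
constants uniform in the sector. -/
lemma norm_add_ofReal_ge {δ : ℝ} (hδ : 0 < δ) {w : ℂ} (hw : |w.arg| ≤ Real.pi - δ) {x : ℝ}
    (hx : 0 ≤ x) : Real.sin (δ / 2) * (‖w‖ + x) ≤ ‖w + x‖ := by
  have hδ' : δ ≤ Real.pi := by linarith [abs_nonneg w.arg]
  have hcos : -Real.cos δ ≤ Real.cos w.arg := by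
    rw [← Real.cos_pi_sub, ← Real.cos_abs w.arg]
    exact Real.cos_le_cos_of_nonneg_of_le_pi (abs_nonneg _) (by linarith) hw
  have hre : -(‖w‖ * Real.cos δ) ≤ w.re := by
    rw [← Complex.norm_mul_cos_arg w]
    nlinarith [norm_nonneg w]
  have h1 : Real.cos δ = 1 - 2 * Real.sin (δ / 2) ^ 2 := by
    have := Real.cos_two_mul (δ / 2)
    rw [show 2 * (δ / 2) = δ by ring] at this
    rw [this]
    linarith [Real.sin_sq_add_cos_sq (δ / 2)]
  have hs0 : 0 ≤ Real.sin (δ / 2) := Real.sin_nonneg_of_nonneg_of_le_pi (by linarith) (by linarith)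
  have hs1 : Real.sin (δ / 2) ^ 2 ≤ 1 := by nlinarith [Real.sin_sq_add_cos_sq (δ / 2), sq_nonneg (Real.cos (δ/2))]
  have hsq : ‖w + x‖ ^ 2 = ‖w‖ ^ 2 + 2 * x * w.re + x ^ 2 := by
    rw [← Complex.normSq_eq_norm_sq, ← Complex.normSq_eq_norm_sq, Complex.normSq_apply,
      Complex.normSq_apply]
    simp
    ring
  refine abs_le_of_sq_le_sq' ?_ (norm_nonneg _) |>.2
  rw [hsq, mul_pow]
  have : 0 ≤ (1 - Real.sin (δ / 2) ^ 2) * (‖w‖ - x) ^ 2 := by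
    have := sq_nonneg (‖w‖ - x)
    nlinarith
  nlinarith

lemma sin_half_pos {δ : ℝ} (hδ : 0 < δ) (hδ' : δ ≤ Real.pi) : 0 < Real.sin (δ / 2) :=
  Real.sin_pos_of_pos_of_lt_pi (by linarith) (by linarith [Real.pi_pos])

/-- Two of the `K + 1` powers telescope, because `(x+n)⁻² ≤ (x-1+n)⁻¹ - (x+n)⁻¹`. The others are
bounded by their value at `n = 0`. -/
lemma sum_inv_pow_le {x : ℝ} (hx : 2 ≤ x) (K N : ℕ) (hK : 1 ≤ K) :
    ∑ n ∈ Finset.range N, ((x + n) ^ (K + 1))⁻¹ ≤ 2 * (x ^ K)⁻¹ := by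
  obtain ⟨K, rfl⟩ := Nat.exists_eq_add_of_le' hK
  have hx0 : 0 < x := by linarith
  have hb : ∀ n ∈ Finset.range N, ((x + n) ^ (K + 1 + 1))⁻¹ ≤
      (x ^ K)⁻¹ * ((x - 1 + n)⁻¹ - (x - 1 + (n + 1 : ℕ))⁻¹) := by
    intro n _
    have hn : (0 : ℝ) ≤ n := Nat.cast_nonneg n
    have h1 : ((x + n) ^ K)⁻¹ ≤ (x ^ K)⁻¹ := by gcongr; linarith
    have h2 : ((x + n) ^ 2)⁻¹ ≤ (x - 1 + n)⁻¹ - (x - 1 + (n + 1 : ℕ))⁻¹ := by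
      push_cast
      rw [show x - 1 + ((n : ℝ) + 1) = x + n by ring, inv_sub_inv (by linarith) (by linarith)]
      rw [show x + (n : ℝ) - (x - 1 + n) = 1 by ring, ← one_div]
      refine one_div_le_one_div_of_le (mul_pos (by linarith) (by linarith)) ?_
      nlinarith
    rw [show (x + n) ^ (K + 1 + 1) = (x + n) ^ K * (x + n) ^ 2 by ring, mul_inv]
    gcongr
  refine (Finset.sum_le_sum hb).trans ?_
  rw [← Finset.mul_sum, Finset.sum_range_sub' (fun n : ℕ => (x - 1 + (n : ℝ))⁻¹)]
  have h3 : (x - 1 + ((0 : ℕ) : ℝ))⁻¹ - (x - 1 + (N : ℝ))⁻¹ ≤ 2 * x⁻¹ := by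
    have : 0 ≤ (x - 1 + (N : ℝ))⁻¹ := inv_nonneg.2 (by linarith [Nat.cast_nonneg (α := ℝ) N])
    have h4 : (x - 1 + ((0 : ℕ) : ℝ))⁻¹ ≤ 2 * x⁻¹ := by
      rw [Nat.cast_zero, add_zero, ← div_eq_mul_inv, ← one_div, div_le_div_iff₀ (by linarith) hx0]
      linarith
    linarith
  calc (x ^ K)⁻¹ * ((x - 1 + ((0 : ℕ) : ℝ))⁻¹ - (x - 1 + (N : ℝ))⁻¹)
      ≤ (x ^ K)⁻¹ * (2 * x⁻¹) := by gcongr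
    _ = 2 * (x ^ (K + 1))⁻¹ := by rw [pow_succ, mul_inv]; ring

/-! ### Stirling's formula -/

/-- The quotient of `Γ(w + a)` by the main term in Stirling's formula. -/
noncomputable def stirlingQuotient (a w : ℂ) : ℂ :=
  Complex.Gamma (w + a) /
    ((Real.sqrt (2 * Real.pi) : ℂ) * Complex.exp ((w + a - 1 / 2) * Complex.log w - w))

lemma Gamma_eq_stirlingQuotient (a w : ℂ) :
    Complex.Gamma (w + a) = (Real.sqrt (2 * Real.pi) : ℂ) *
      Complex.exp ((w + a - 1 / 2) * Complex.log w - w) * stirlingQuotient a w := by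
  have : (Real.sqrt (2 * Real.pi) : ℂ) ≠ 0 := by
    rw [Complex.ofReal_ne_zero]; positivity
  rw [stirlingQuotient]
  field_simp [Complex.exp_ne_zero]

/-- For `w` off the real axis the arguments of `w` and `1 + 1/w` have opposite signs, so their sum
stays in the principal range. The condition `1 < ‖w‖` keeps `1 + 1/w` in the right half plane. -/
lemma log_add_one {w : ℂ} (hw : w ∈ Complex.slitPlane) (h1 : 1 < ‖w‖) :
    Complex.log (w + 1) = Complex.log w + Complex.log (1 + w⁻¹) := by
  have hw0 : w ≠ 0 := Complex.slitPlane_ne_zero hw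
  have hinv : ‖w⁻¹‖ < 1 := by rw [norm_inv]; exact inv_lt_one_of_one_lt₀ h1
  have hre : 0 < (1 + w⁻¹).re := by
    have := (abs_le.1 (Complex.abs_re_le_norm w⁻¹)).1
    simp only [Complex.add_re, Complex.one_re]; linarith
  have hne : 1 + w⁻¹ ≠ 0 := fun h => by rw [h] at hre; simp at hre
  have hmul : w * (1 + w⁻¹) = w + 1 := by field_simp
  rw [← hmul, Complex.log_mul_eq_add_log_iff hw0 hne]
  have hπ := Complex.neg_pi_lt_arg w
  have hπ' := Complex.arg_le_pi w
  have hhalf := abs_le.1 (Complex.abs_arg_le_pi_div_two_iff.2 hre.le)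
  have him : (1 + w⁻¹).im = -(w.im / Complex.normSq w) := by simp [Complex.inv_im, neg_div]
  have hn : 0 < Complex.normSq w := Complex.normSq_pos.2 hw0
  rcases le_or_gt 0 w.im with h | h
  · have ha : 0 ≤ w.arg := Complex.arg_nonneg_iff.2 h
    have hb : (1 + w⁻¹).arg ≤ 0 := by
      rcases h.eq_or_lt with h | h
      · rw [← h, zero_div, neg_zero] at him
        rw [Complex.arg_eq_zero_iff.2 ⟨hre.le, him⟩]
      · exact (Complex.arg_neg_iff.2 (by rw [him]; exact neg_lt_zero.2 (div_pos h hn))).le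
    constructor <;> linarith [Real.pi_pos]
  · have ha : w.arg < 0 := Complex.arg_neg_iff.2 h
    have hb : 0 ≤ (1 + w⁻¹).arg :=
      Complex.arg_nonneg_iff.2 (by rw [him]; exact (neg_pos.2 (div_neg_of_neg_of_pos h hn)).le)
    constructor <;> linarith [Real.pi_pos]

/-- This is the recurrence `Γ(z + 1) = z Γ(z)`. The exponent is the increment of
`exists_stirling_increment` at `x = w⁻¹`, which explains the double inverse. -/
lemma stirlingQuotient_eq_mul_succ {a w : ℂ} (hw : w ∈ Complex.slitPlane) (h1 : 1 < ‖w‖)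
    (ha : ‖a‖ < ‖w‖) :
    stirlingQuotient a w = stirlingQuotient a (w + 1) *
      Complex.exp ((w⁻¹⁻¹ + a + 1 / 2) * Complex.log (1 + w⁻¹) - 1 -
        Complex.log (1 + a * w⁻¹)) := by
  have hw0 : w ≠ 0 := Complex.slitPlane_ne_zero hw
  have hwa : w + a ≠ 0 := fun h => by
    rw [eq_neg_of_add_eq_zero_right h, norm_neg] at ha; exact lt_irrefl _ ha
  have hfac : w + a = w * (1 + a * w⁻¹) := by field_simp
  have hne : 1 + a * w⁻¹ ≠ 0 := fun h => hwa (by rw [hfac, h, mul_zero])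
  have hsq : (Real.sqrt (2 * Real.pi) : ℂ) ≠ 0 := by
    rw [Complex.ofReal_ne_zero]; positivity
  have hG : Complex.Gamma (w + 1 + a) = (w + a) * Complex.Gamma (w + a) := by
    rw [show w + 1 + a = w + a + 1 by ring, Complex.Gamma_add_one _ hwa]
  have hexp : w + a = Complex.exp (Complex.log w + Complex.log (1 + a * w⁻¹)) := by
    rw [Complex.exp_add, Complex.exp_log hw0, Complex.exp_log hne, ← hfac]
  rw [stirlingQuotient, stirlingQuotient, hG, log_add_one hw h1, inv_inv]
  rw [show (w + a) * Complex.Gamma (w + a) =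
    Complex.exp (Complex.log w + Complex.log (1 + a * w⁻¹)) * Complex.Gamma (w + a) by rw [← hexp]]
  rw [div_mul_eq_mul_div, div_eq_div_iff (mul_ne_zero hsq (Complex.exp_ne_zero _))
    (mul_ne_zero hsq (Complex.exp_ne_zero _))]
  have : ∀ A B C D G r : ℂ, Complex.exp A = Complex.exp (B + C + D) →
      G * (r * Complex.exp A) = Complex.exp B * G * Complex.exp C * (r * Complex.exp D) := by
    intro A B C D G r h
    rw [h, Complex.exp_add, Complex.exp_add]; ring
  apply this
  congr 1
  ring

lemma Gamma_add_nat_eq (s : ℂ) (hs : ∀ k : ℕ, s ≠ -k) (n : ℕ) :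
    Complex.Gamma (s + n) = Complex.Gamma s * ∏ j ∈ Finset.range n, (s + j) := by
  induction n with
  | zero => simp
  | succ n ih =>
    have : s + n ≠ 0 := fun h => hs n (eq_neg_of_add_eq_zero_left h)
    rw [Nat.cast_succ, ← add_assoc, Complex.Gamma_add_one _ this, ih, Finset.prod_range_succ]
    ring

/-- Euler's limit formula for `Γ(w + a)` combined with Stirling's formula for `n!`. This normalizes
the constant in the recursion, the limit at infinity being exactly 1. -/
lemma tendsto_stirlingQuotient_add_nat (a w : ℂ) (hs : ∀ k : ℕ, w + a ≠ -k) :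
    Tendsto (fun n : ℕ => stirlingQuotient a (w + n)) atTop (𝓝 1) := by
  set s := w + a with hsdef
  have hG0 : Complex.Gamma s ≠ 0 := Complex.Gamma_ne_zero hs
  have hnat : Tendsto (fun n : ℕ => ((n : ℂ))⁻¹) atTop (𝓝 0) := tendsto_inv_atTop_nhds_zero_nat
  have hwn : Tendsto (fun n : ℕ => (n : ℂ) * (w * (n : ℂ)⁻¹)) atTop (𝓝 w) := by
    refine tendsto_const_nhds.congr' ?_
    filter_upwards [eventually_ne_atTop 0] with n hn
    have : (n : ℂ) ≠ 0 := Nat.cast_ne_zero.2 hn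
    field_simp
  have hlog := Complex.tendsto_nat_mul_log_one_add_of_tendsto hwn
  have hw0 : Tendsto (fun n : ℕ => 1 + w * (n : ℂ)⁻¹) atTop (𝓝 1) := by
    simpa using (hnat.const_mul w).const_add 1
  have hlog0 : Tendsto (fun n : ℕ => Complex.log (1 + w * (n : ℂ)⁻¹)) atTop (𝓝 0) := by
    have := (continuousAt_clog (x := 1) (by simp)).tendsto.comp hw0
    simpa [Function.comp_def] using this
  have hexp : Tendsto (fun n : ℕ => Complex.exp (w - (n * Complex.log (1 + w * (n : ℂ)⁻¹) +
      (s - 1 / 2) * Complex.log (1 + w * (n : ℂ)⁻¹)))) atTop (𝓝 1) := by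
    have h : Tendsto (fun n : ℕ => w - (n * Complex.log (1 + w * (n : ℂ)⁻¹) +
      (s - 1 / 2) * Complex.log (1 + w * (n : ℂ)⁻¹))) atTop (𝓝 (w - (w + (s - 1/2) * 0))) :=
      tendsto_const_nhds.sub (hlog.add (hlog0.const_mul _))
    have := (Complex.continuous_exp.tendsto _).comp h
    simpa [Function.comp_def] using this
  have hseq : Tendsto (fun n : ℕ => Complex.Gamma s / Complex.GammaSeq s n) atTop (𝓝 1) := by
    have := (tendsto_const_nhds (x := Complex.Gamma s)).div (Complex.GammaSeq_tendsto_Gamma s) hG0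
    rwa [div_self hG0] at this
  have hstir : Tendsto (fun n : ℕ => ((Stirling.stirlingSeq n / Real.sqrt Real.pi : ℝ) : ℂ)) atTop
      (𝓝 1) := by
    have h := Stirling.tendsto_stirlingSeq_sqrt_pi.div_const (Real.sqrt Real.pi)
    rw [div_self (by positivity)] at h
    exact_mod_cast (Complex.continuous_ofReal.tendsto _).comp h
  have hrat : Tendsto (fun n : ℕ => (1 + s * (n : ℂ)⁻¹)⁻¹) atTop (𝓝 1) := by
    have : Tendsto (fun n : ℕ => 1 + s * (n : ℂ)⁻¹) atTop (𝓝 1) := by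
      simpa using (hnat.const_mul s).const_add 1
    simpa using this.inv₀ one_ne_zero
  -- The quotient at `w + n` is exactly the product of these four sequences, each of which tends to
  -- 1. The rest of the proof checks this identity.
  have hall := ((hseq.mul hstir).mul hrat).mul hexp
  simp only [mul_one] at hall
  refine hall.congr' ?_
  filter_upwards [eventually_gt_atTop 0, hw0.eventually_ne one_ne_zero] with n hn hne
  have hnC : (n : ℂ) ≠ 0 := Nat.cast_ne_zero.2 hn.ne'
  have hsn : ∀ j : ℕ, s + j ≠ 0 := fun j h => hs j (eq_neg_of_add_eq_zero_left h)
  have hprod : ∏ j ∈ Finset.range n, (s + (j : ℂ)) ≠ 0 :=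
    Finset.prod_ne_zero_iff.2 fun j _ => hsn j
  have hlogn : Complex.log (w + n) = Real.log n + Complex.log (1 + w * (n : ℂ)⁻¹) := by
    have : w + n = (1 + w * (n : ℂ)⁻¹) * ((n : ℝ) : ℂ) := by
      push_cast; field_simp; ring
    rw [this, Complex.log_mul_ofReal _ (by exact_mod_cast hn) _ hne]
  have hGam : Complex.Gamma (w + n + a) = Complex.Gamma s * ∏ j ∈ Finset.range n, (s + (j : ℂ)) := by
    rw [show w + n + a = s + n by rw [hsdef]; ring, Gamma_add_nat_eq s hs]
  have hfact : ((n.factorial : ℕ) : ℂ) = (Stirling.stirlingSeq n : ℂ) *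
      ((Real.sqrt (2 * n) : ℝ) : ℂ) * Complex.exp (n * Real.log n - n) := by
    have h1 : (n.factorial : ℝ) = Stirling.stirlingSeq n * Real.sqrt (2 * n) *
        Real.exp (n * Real.log n - n) := by
      have : Real.exp (n * Real.log n - n) = (n / Real.exp 1) ^ n := by
        rw [div_pow, Real.exp_sub, mul_comm, Real.exp_mul, Real.exp_log (by exact_mod_cast hn),
          Real.rpow_natCast, ← Real.exp_nat_mul, mul_one]
      rw [this, Stirling.stirlingSeq]
      have : 0 < Real.sqrt (2 * n) := Real.sqrt_pos.2 (by positivity)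
      field_simp
    have := congrArg (fun x : ℝ => (x : ℂ)) h1
    push_cast at this
    exact_mod_cast this
  have hsqrt : ((Real.sqrt (2 * n) : ℝ) : ℂ) = ((Real.sqrt 2 : ℝ) : ℂ) *
      Complex.exp (1 / 2 * Real.log n) := by
    have h1 : Real.sqrt n = Real.exp (1 / 2 * Real.log n) := by
      rw [Real.sqrt_eq_rpow, Real.rpow_def_of_pos (by exact_mod_cast hn), mul_comm]
    rw [Real.sqrt_mul (by norm_num), Complex.ofReal_mul, h1]
    push_cast
    rfl
  have hsqrt2 : ((Real.sqrt (2 * Real.pi) : ℝ) : ℂ) = ((Real.sqrt 2 : ℝ) : ℂ) *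
      ((Real.sqrt Real.pi : ℝ) : ℂ) := by
    rw [Real.sqrt_mul (by norm_num), Complex.ofReal_mul]
  have hq2 : ((Real.sqrt 2 : ℝ) : ℂ) ≠ 0 := by rw [Complex.ofReal_ne_zero]; positivity
  have hqπ : ((Real.sqrt Real.pi : ℝ) : ℂ) ≠ 0 := by rw [Complex.ofReal_ne_zero]; positivity
  have hst0 : (Stirling.stirlingSeq n : ℂ) ≠ 0 := by
    obtain ⟨m, rfl⟩ := Nat.exists_eq_succ_of_ne_zero hn.ne'
    exact_mod_cast (Stirling.stirlingSeq'_pos m).ne'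
  have hcpow : (n : ℂ) ^ s = Complex.exp (s * Real.log n) := by
    rw [Complex.cpow_def_of_ne_zero hnC, ← Complex.natCast_log, mul_comm]
  have hone : 1 + s * (n : ℂ)⁻¹ = (s + n) * (n : ℂ)⁻¹ := by field_simp; ring
  rw [stirlingQuotient, hGam, hlogn, Complex.GammaSeq, Finset.prod_range_succ, hfact, hsqrt, hsqrt2,
    hcpow, hone]
  have hnexp : (n : ℂ) = Complex.exp (Real.log n) := by
    rw [← Complex.ofReal_exp, Real.exp_log (by exact_mod_cast hn)]; simp
  rw [Complex.ofReal_div]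
  have e1 : (s + n : ℂ) ≠ 0 := hsn n
  set P := ∏ j ∈ Finset.range n, (s + (j : ℂ)) with hP
  set ℓ := Complex.log (1 + w * (n : ℂ)⁻¹) with hℓ
  have key : Complex.exp (w - (n * ℓ + (s - 1 / 2) * ℓ)) *
      Complex.exp ((w + n + a - 1 / 2) * (Real.log n + ℓ) - (w + n)) * (n : ℂ) =
      Complex.exp (s * Real.log n) * Complex.exp (1 / 2 * Real.log n) *
        Complex.exp (n * Real.log n - n) := by
    refine (congrArg _ hnexp).trans ?_
    simp only [← Complex.exp_add]
    congr 1
    rw [hsdef]; ring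
  have hE1 := Complex.exp_ne_zero (s * Real.log n)
  have hE2 := Complex.exp_ne_zero (1 / 2 * Real.log n)
  have hE3 := Complex.exp_ne_zero (n * Real.log n - n)
  have hE4 := Complex.exp_ne_zero ((w + n + a - 1 / 2) * (Real.log n + ℓ) - (w + n))
  set X1 := Complex.exp (s * Real.log n)
  set X2 := Complex.exp (1 / 2 * Real.log n)
  set X3 := Complex.exp (n * Real.log n - n)
  set X4 := Complex.exp ((w + n + a - 1 / 2) * (Real.log n + ℓ) - (w + n))
  set X5 := Complex.exp (w - (n * ℓ + (s - 1 / 2) * ℓ))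
  have hX5 : X5 = X1 * X2 * X3 / (X4 * n) := by
    rw [eq_div_iff (mul_ne_zero hE4 hnC), ← key]; ring
  rw [hX5]
  field_simp

lemma add_nat_mem_slitPlane {w : ℂ} (hw : w ∈ Complex.slitPlane) (n : ℕ) :
    w + n ∈ Complex.slitPlane := by
  rw [Complex.mem_slitPlane_iff] at hw ⊢
  rcases hw with h | h
  · left
    have : (0 : ℝ) ≤ n := Nat.cast_nonneg n
    simp; linarith
  · right; simpa using h

lemma mem_slitPlane_of_abs_arg_le {w : ℂ} {δ : ℝ} (hδ : 0 < δ) (h0 : w ≠ 0)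
    (hw : |w.arg| ≤ Real.pi - δ) : w ∈ Complex.slitPlane :=
  Complex.mem_slitPlane_iff_arg.2 ⟨fun h => by
    rw [h, abs_of_pos Real.pi_pos] at hw; linarith, h0⟩

/-- **Stirling's formula** to arbitrary order in sectors: `Γ(w + a)` is its main term times
`exp (P (1 / w))`, up to a relative error `O(w ^ (-K - 1))`. -/
theorem stirlingQuotient_isBigO (a : ℂ) (K : ℕ) (hK : 1 ≤ K) :
    ∃ P : Polynomial ℂ, P.coeff 0 = 0 ∧ P.coeff 1 = (a ^ 2 - a + 1 / 6) / 2 ∧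
      ∀ δ > 0, (fun w => stirlingQuotient a w * Complex.exp (-P.eval w⁻¹) - 1) =O[sectorAtInf δ]
        fun w => w⁻¹ ^ (K + 1) := by
  obtain ⟨g, hg, hg0, hinc⟩ := exists_stirling_increment a
  obtain ⟨P, k, hP0, hP1, -, hk, hP⟩ := exists_polynomial_telescope hg K
  refine ⟨P, hP0, by rw [hP1 hK, hg0], fun δ hδ => ?_⟩
  -- For `δ > π` the sector is empty.
  rcases lt_or_ge Real.pi δ with hδ' | hδ'
  · refine IsBigO.of_bound 1 ?_
    rw [eventually_sectorAtInf]
    exact ⟨0, fun w _ hw => absurd hw (not_le.2 (lt_of_lt_of_le (by linarith) (abs_nonneg _)))⟩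
  set c := Real.sin (δ / 2) with hc
  have hc0 : 0 < c := sin_half_pos hδ hδ'
  have hc1 : c ≤ 1 := Real.sin_le_one _
  obtain ⟨C, hC⟩ := (hk.continuousAt.norm.isBoundedUnder_le).eventually_le
  obtain ⟨r, hr, hball⟩ := Metric.eventually_nhds_iff.1 hC
  set D : ℝ := 2 * |C| * (c ^ (K + 2))⁻¹ with hD
  have hD0 : 0 ≤ D := by positivity
  -- The bound 2 serves `sum_inv_pow_le`, and `D` makes the total exponent at most 1. The last entry
  -- keeps `‖w + n‖` above `1`, `‖a‖` and `1/r`, so that the recurrence applies at every `w + n` and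
  -- `(w + n)⁻¹` lies where `k` is bounded.
  set R : ℝ := max 2 (max D (2 * (1 + ‖a‖ + 1 / r) / c)) with hR
  refine IsBigO.of_bound (2 * D) ?_
  rw [eventually_sectorAtInf]
  refine ⟨R, fun w hwR hw => ?_⟩
  have hw2 : 2 ≤ ‖w‖ := (le_max_left _ _).trans hwR
  have hwD : D ≤ ‖w‖ := ((le_max_left _ _).trans (le_max_right _ _)).trans hwR
  have hwr : 2 * (1 + ‖a‖ + 1 / r) ≤ c * ‖w‖ := by
    have := ((le_max_right _ _).trans (le_max_right _ _)).trans hwR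
    rw [div_le_iff₀ hc0] at this
    linarith
  have hw0 : w ≠ 0 := norm_pos_iff.1 (by linarith)
  have hsl := mem_slitPlane_of_abs_arg_le hδ hw0 hw
  have hge : ∀ n : ℕ, c * (‖w‖ + n) ≤ ‖w + n‖ := fun n => by
    simpa using norm_add_ofReal_ge hδ hw (Nat.cast_nonneg n)
  have hge' : ∀ n : ℕ, 2 * (1 + ‖a‖ + 1 / r) ≤ ‖w + n‖ := fun n => by
    have := hge n
    have : 0 ≤ c * n := by positivity
    nlinarith [hge n]
  have hr' : 0 < 1 / r := by positivity
  have hna := norm_nonneg a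
  have hne : ∀ n : ℕ, w + n ≠ 0 := fun n => norm_pos_iff.1 (by linarith [hge' n])
  have hpos : ∀ j : ℕ, w + a ≠ -j := fun j h => by
    have h1 := hge' j
    rw [show w + (j : ℂ) = -a by linear_combination h, norm_neg] at h1
    linarith
  set ψ : ℂ → ℂ := fun w => stirlingQuotient a w * Complex.exp (-P.eval w⁻¹) with hψ
  set ε : ℕ → ℂ := fun n => (w + n)⁻¹ ^ (K + 2) * k (w + n)⁻¹ with hε
  -- The polynomial `P` was built so that the factor `exp (-P(1/w))` absorbs the increment up to `ε
  -- n`, of order `(w + n)^(-K-2)`.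
  have hstep : ∀ n : ℕ, ψ (w + n) = ψ (w + (n + 1 : ℕ)) * Complex.exp (ε n) := by
    intro n
    have h1 : (1 : ℝ) < ‖w + n‖ := by linarith [hge' n]
    have h2 : ‖a‖ < ‖w + n‖ := by linarith [hge' n]
    have hx : (w + n : ℂ)⁻¹ ≠ 0 := inv_ne_zero (hne n)
    have hx1 : 1 + (w + n : ℂ)⁻¹ ≠ 0 := fun h => by
      have : (w + n : ℂ)⁻¹ = -1 := by linear_combination h
      rw [inv_eq_iff_eq_inv] at this
      rw [this] at h1
      norm_num at h1
    have h3 := hP _ hx1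
    rw [← hinc _ hx] at h3
    have h4 : (w + n : ℂ)⁻¹ / (1 + (w + n : ℂ)⁻¹) = (w + (n + 1 : ℕ))⁻¹ := by
      have h5 : w + (n + 1 : ℕ) = (w + n) * (1 + (w + n : ℂ)⁻¹) := by
        rw [mul_add, mul_one, mul_inv_cancel₀ (hne n)]; push_cast; ring
      rw [h5, mul_inv, div_eq_mul_inv]
    rw [h4] at h3
    simp only [hψ, hε]
    rw [stirlingQuotient_eq_mul_succ (add_nat_mem_slitPlane hsl n) h1 h2, ← h3]
    rw [show w + (n : ℂ) + 1 = w + (n + 1 : ℕ) by push_cast; ring]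
    rw [mul_assoc, mul_assoc, ← Complex.exp_add, ← Complex.exp_add]
    congr 2
    ring
  have hprod : ∀ N : ℕ, ψ w = ψ (w + N) * Complex.exp (∑ n ∈ Finset.range N, ε n) := by
    intro N
    induction N with
    | zero => simp
    | succ N ih =>
      rw [ih, hstep N, Finset.sum_range_succ, Complex.exp_add]; ring
  have hεb : ∀ n, ‖ε n‖ ≤ |C| * (c ^ (K + 2))⁻¹ * ((‖w‖ + n) ^ (K + 1 + 1))⁻¹ := by
    intro n
    have h1 : dist (w + n : ℂ)⁻¹ 0 < r := by
      rw [dist_zero_right, norm_inv, inv_lt_comm₀ (by linarith [hge' n]) hr, ← one_div]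
      linarith [hge' n]
    have h2 : ‖k (w + n)⁻¹‖ ≤ |C| := (hball h1).trans (le_abs_self C)
    have h3 : (‖w + (n : ℂ)‖ ^ (K + 2))⁻¹ ≤ (c ^ (K + 2))⁻¹ * ((‖w‖ + n) ^ (K + 1 + 1))⁻¹ := by
      rw [← mul_inv, show K + 1 + 1 = K + 2 by ring, ← mul_pow]
      have : 0 < c * (‖w‖ + n) := by positivity
      gcongr
      exact hge n
    simp only [hε]
    rw [norm_mul, norm_pow, norm_inv, inv_pow]
    calc (‖w + (n : ℂ)‖ ^ (K + 2))⁻¹ * ‖k (w + n)⁻¹‖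
        ≤ (c ^ (K + 2))⁻¹ * ((‖w‖ + n) ^ (K + 1 + 1))⁻¹ * |C| := by gcongr
      _ = _ := by ring
  have hsum : ∀ N : ℕ, ‖∑ n ∈ Finset.range N, ε n‖ ≤ D * (‖w‖ ^ (K + 1))⁻¹ := by
    intro N
    refine (norm_sum_le_of_le _ fun n _ => hεb n).trans ?_
    rw [← Finset.mul_sum]
    have := sum_inv_pow_le hw2 (K + 1) N (by omega)
    calc _ ≤ |C| * (c ^ (K + 2))⁻¹ * (2 * (‖w‖ ^ (K + 1))⁻¹) := by gcongr
      _ = _ := by rw [hD]; ring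
  have hsmall : D * (‖w‖ ^ (K + 1))⁻¹ ≤ 1 := by
    rw [← div_eq_mul_inv, div_le_one (by positivity)]
    exact hwD.trans (le_self_pow₀ (by linarith) (by omega))
  have hlim : Tendsto (fun N : ℕ => ψ (w + N)) atTop (𝓝 1) := by
    have h1 := tendsto_stirlingQuotient_add_nat a w hpos
    have h2 : Tendsto (fun N : ℕ => (w + N : ℂ)⁻¹) atTop (𝓝 0) := by
      refine tendsto_inv₀_cobounded.comp ?_
      rw [← tendsto_norm_atTop_iff_cobounded]
      refine tendsto_atTop_mono (f := fun N : ℕ => c * N) (fun N => ?_) ?_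
      · have := hge N
        nlinarith [norm_nonneg w]
      · exact tendsto_natCast_atTop_atTop.const_mul_atTop hc0
    have h3 : Tendsto (fun N : ℕ => Complex.exp (-P.eval (w + N : ℂ)⁻¹)) atTop (𝓝 1) := by
      have : Continuous fun x : ℂ => Complex.exp (-P.eval x) := by fun_prop
      have h4 := (this.tendsto 0).comp h2
      have h5 : P.eval 0 = 0 := by rw [← Polynomial.coeff_zero_eq_eval_zero, hP0]
      simpa [h5, Function.comp_def] using h4
    simpa using h1.mul h3
  have hbound : ∀ N : ℕ, ‖ψ w - ψ (w + N)‖ ≤ ‖ψ (w + N)‖ * (2 * (D * (‖w‖ ^ (K + 1))⁻¹)) := by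
    intro N
    have h1 := Complex.norm_exp_sub_one_le ((hsum N).trans hsmall)
    have h2 : ψ w - ψ (w + N) =
        ψ (w + N) * (Complex.exp (∑ n ∈ Finset.range N, ε n) - 1) := by
      conv_lhs => rw [hprod N]
      ring
    rw [h2, norm_mul]
    have := hsum N
    gcongr
    linarith
  -- Letting `N → ∞` replaces `ψ (w + N)` by 1 and leaves a bound for `ψ w - 1`.
  have hfin := le_of_tendsto_of_tendsto' ((tendsto_const_nhds.sub hlim).norm)
    (hlim.norm.mul_const (2 * (D * (‖w‖ ^ (K + 1))⁻¹))) hbound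
  rw [norm_one, one_mul] at hfin
  rw [norm_pow, norm_inv, inv_pow]
  linarith

/-! ### Asymptotic expansions in powers of `1 / w` -/

lemma tendsto_inv_sectorAtInf (δ : ℝ) : Tendsto (fun w : ℂ => w⁻¹) (sectorAtInf δ) (𝓝 0) := by
  refine tendsto_inv₀_cobounded.comp ?_
  rw [← comap_norm_atTop]
  exact tendsto_id'.2 inf_le_left

lemma tendsto_ofReal_sectorAtInf {δ : ℝ} (hδ : δ ≤ Real.pi) :
    Tendsto (fun x : ℝ => (x : ℂ)) atTop (sectorAtInf δ) := by
  refine tendsto_inf.2 ⟨tendsto_comap_iff.2 ?_, tendsto_principal.2 ?_⟩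
  · refine tendsto_abs_atTop_atTop.congr fun x => by simp
  · filter_upwards [eventually_ge_atTop 0] with x hx
    rw [Complex.arg_ofReal_of_nonneg hx, abs_zero]
    linarith

lemma neBot_sectorAtInf {δ : ℝ} (hδ : δ ≤ Real.pi) : (sectorAtInf δ).NeBot :=
  (tendsto_ofReal_sectorAtInf hδ).neBot

lemma tendsto_mul_sectorAtInf {r : ℝ} (hr : 0 < r) (δ : ℝ) :
    Tendsto (fun w : ℂ => (r : ℂ) * w) (sectorAtInf δ) (sectorAtInf δ) := by
  refine tendsto_inf.2 ⟨tendsto_comap_iff.2 ?_, tendsto_principal.2 ?_⟩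
  · have : Tendsto (fun w : ℂ => r * ‖w‖) (sectorAtInf δ) atTop :=
      (tendsto_comap.mono_left inf_le_left).const_mul_atTop hr
    refine this.congr fun w => by simp [abs_of_pos hr]
  · have : ∀ᶠ w in sectorAtInf δ, |w.arg| ≤ Real.pi - δ := mem_inf_of_right (mem_principal_self _)
    filter_upwards [this] with w hw
    rwa [Complex.arg_real_mul _ hr]

/-- `φ` has an asymptotic expansion in powers of `1 / w` in all sectors `|arg w| ≤ π - δ`. -/
def AsympExp (φ : ℂ → ℂ) : Prop :=
  ∀ K : ℕ, ∃ p : Polynomial ℂ, ∀ δ > 0,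
    (fun w => φ w - p.eval w⁻¹) =O[sectorAtInf δ] fun w => w⁻¹ ^ K

lemma isBigO_eval_inv_one (p : Polynomial ℂ) (δ : ℝ) :
    (fun w : ℂ => p.eval w⁻¹) =O[sectorAtInf δ] fun _ => (1 : ℂ) :=
  ((p.continuous.tendsto 0).comp (tendsto_inv_sectorAtInf δ)).isBigO_one ℂ

lemma isBigO_inv_pow_of_le {m n : ℕ} (h : m ≤ n) (δ : ℝ) :
    (fun w : ℂ => w⁻¹ ^ n) =O[sectorAtInf δ] fun w => w⁻¹ ^ m := by
  obtain ⟨k, rfl⟩ := Nat.exists_eq_add_of_le h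
  have h1 : (fun w : ℂ => w⁻¹ ^ k) =O[sectorAtInf δ] fun _ => (1 : ℂ) := by
    simpa using isBigO_eval_inv_one (Polynomial.X ^ k) δ
  simpa [pow_add] using (isBigO_refl (fun w : ℂ => w⁻¹ ^ m) (sectorAtInf δ)).mul h1

namespace AsympExp

variable {φ ψ : ℂ → ℂ}

lemma congr (h : AsympExp φ) (he : ∀ δ > 0, φ =ᶠ[sectorAtInf δ] ψ) : AsympExp ψ := fun K => by
  obtain ⟨p, hp⟩ := h K
  exact ⟨p, fun δ hδ => (hp δ hδ).congr' ((he δ hδ).sub EventuallyEq.rfl) EventuallyEq.rfl⟩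

lemma isBigO_one (h : AsympExp φ) {δ : ℝ} (hδ : 0 < δ) :
    φ =O[sectorAtInf δ] fun _ => (1 : ℂ) := by
  obtain ⟨p, hp⟩ := h 0
  have := (hp δ hδ).add ((isBigO_eval_inv_one p δ).congr_right fun w => (pow_zero w⁻¹).symm)
  simpa using this

lemma of_polynomial (p : Polynomial ℂ) : AsympExp fun w => p.eval w⁻¹ := fun K =>
  ⟨p, fun δ _ => by simpa using isBigO_zero (E' := ℂ) _ _⟩

lemma const (c : ℂ) : AsympExp fun _ => c := by simpa using of_polynomial (Polynomial.C c)

lemma add (h : AsympExp φ) (h' : AsympExp ψ) : AsympExp fun w => φ w + ψ w := fun K => by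
  obtain ⟨p, hp⟩ := h K
  obtain ⟨q, hq⟩ := h' K
  refine ⟨p + q, fun δ hδ => ((hp δ hδ).add (hq δ hδ)).congr_left fun w => ?_⟩
  rw [Polynomial.eval_add]; ring

lemma mul (h : AsympExp φ) (h' : AsympExp ψ) : AsympExp fun w => φ w * ψ w := fun K => by
  obtain ⟨p, hp⟩ := h K
  obtain ⟨q, hq⟩ := h' K
  refine ⟨p * q, fun δ hδ => ?_⟩
  have h1 := (h.isBigO_one hδ).mul (hq δ hδ)
  have h2 := (hp δ hδ).mul (isBigO_eval_inv_one q δ)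
  simp only [one_mul, mul_one] at h1 h2
  refine IsBigO.congr_left ?_ (f₁ := fun w => φ w * (ψ w - q.eval w⁻¹) +
    (φ w - p.eval w⁻¹) * q.eval w⁻¹) fun w => by rw [Polynomial.eval_mul]; ring
  exact h1.add h2

lemma pow (h : AsympExp φ) (n : ℕ) : AsympExp fun w => φ w ^ n := by
  induction n with
  | zero => simpa using const 1
  | succ n ih => simpa [pow_succ] using ih.mul h

lemma eval (h : AsympExp φ) (p : Polynomial ℂ) : AsympExp fun w => p.eval (φ w) := by
  induction p using Polynomial.induction_on' with
  | add p q hp hq => simpa using hp.add hq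
  | monomial n c => simpa using (const c).mul (h.pow n)

/-- Composition with a function which is analytic at `0`. -/
lemma comp_analytic (h : AsympExp φ) (h0 : ∀ δ > 0, φ =O[sectorAtInf δ] fun w => w⁻¹)
    {F : ℂ → ℂ} (hF : AnalyticAt ℂ F 0) : AsympExp fun w => F (φ w) := fun K => by
  obtain ⟨p, k, hk, hFp⟩ := exists_polynomial_add_pow_mul hF K
  obtain ⟨q, hq⟩ := h.eval p K
  refine ⟨q, fun δ hδ => ?_⟩
  have hφ : Tendsto φ (sectorAtInf δ) (𝓝 0) := (h0 δ hδ).trans_tendsto (tendsto_inv_sectorAtInf δ)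
  have h1 : (fun w => k (φ w)) =O[sectorAtInf δ] fun _ => (1 : ℂ) :=
    (hk.continuousAt.tendsto.comp hφ).isBigO_one ℂ
  have h2 := (hq δ hδ).add (by simpa using ((h0 δ hδ).pow K).mul h1)
  refine h2.congr_left fun w => ?_
  simp only [hFp]; ring

lemma comp_mul (h : AsympExp φ) {r : ℝ} (hr : 0 < r) : AsympExp fun w => φ (r * w) := fun K => by
  obtain ⟨p, hp⟩ := h K
  refine ⟨p.comp (Polynomial.C (r⁻¹ : ℂ) * Polynomial.X), fun δ hδ => ?_⟩
  have h1 := (hp δ hδ).comp_tendsto (tendsto_mul_sectorAtInf hr δ)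
  have h2 : (fun w : ℂ => (r * w)⁻¹ ^ K) =O[sectorAtInf δ] fun w => w⁻¹ ^ K := by
    refine IsBigO.of_bound ‖((r : ℂ)⁻¹) ^ K‖ (Eventually.of_forall fun w => ?_)
    rw [mul_inv, mul_pow, norm_mul]
  refine (h1.trans h2).congr_left fun w => ?_
  simp only [Function.comp, Polynomial.eval_comp, Polynomial.eval_mul, Polynomial.eval_C,
    Polynomial.eval_X, mul_inv]

lemma exists_const (h : AsympExp φ) :
    ∃ c : ℂ, ∀ δ > 0, (fun w => φ w - c) =O[sectorAtInf δ] fun w => w⁻¹ := by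
  obtain ⟨p, hp⟩ := h 1
  refine ⟨p.eval 0, fun δ hδ => ?_⟩
  have h1 : (fun w : ℂ => p.eval w⁻¹ - p.eval 0) =O[sectorAtInf δ] fun w => w⁻¹ := by
    have hd : (fun x : ℂ => p.eval x - p.eval 0) =O[𝓝 0] fun x => x - 0 :=
      (p.differentiableAt (x := (0 : ℂ))).isBigO_sub
    simpa [Function.comp_def] using hd.comp_tendsto (tendsto_inv_sectorAtInf δ)
  have h2 := hp δ hδ
  simp only [pow_one] at h2
  simpa using h2.add h1

/-- The decay of `φ` forces the approximating polynomial of order `K + 1` to vanish at 0. It is thus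
divisible by `X`, and the quotient approximates `w φ(w)` to order `K`. -/
lemma mul_self (h : AsympExp φ) (h0 : ∀ δ > 0, φ =O[sectorAtInf δ] fun w => w⁻¹) :
    AsympExp fun w => w * φ w := fun K => by
  obtain ⟨p, hp⟩ := h (K + 1)
  have hp0 : p.eval 0 = 0 := by
    have := neBot_sectorAtInf le_rfl
    have h1 := ((hp _ Real.pi_pos).trans (isBigO_inv_pow_of_le (Nat.succ_pos K) _)).trans_tendsto
      (by simpa using tendsto_inv_sectorAtInf Real.pi)
    have h2 := (h0 _ Real.pi_pos).trans_tendsto (tendsto_inv_sectorAtInf Real.pi)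
    have h3 := (p.continuous.tendsto 0).comp (tendsto_inv_sectorAtInf Real.pi)
    have h4 := h2.sub h1
    simp only [sub_sub_cancel, sub_zero] at h4
    exact tendsto_nhds_unique h3 h4
  obtain ⟨q, rfl⟩ : Polynomial.X ∣ p := by
    rw [Polynomial.X_dvd_iff, Polynomial.coeff_zero_eq_eval_zero, hp0]
  refine ⟨q, fun δ hδ => ?_⟩
  have h1 := (isBigO_refl (fun w : ℂ => w) (sectorAtInf δ)).mul (hp δ hδ)
  have hne : ∀ᶠ w in sectorAtInf δ, w ≠ 0 := by
    rw [eventually_sectorAtInf]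
    exact ⟨1, fun w hw _ => norm_pos_iff.1 (by linarith)⟩
  refine h1.congr' ?_ ?_
  · filter_upwards [hne] with w hw
    simp only [Polynomial.eval_mul, Polynomial.eval_X]
    field_simp
  · filter_upwards [hne] with w hw
    rw [pow_succ]
    field_simp

end AsympExp

/-- Up to a small relative error the quotient is `exp (P(1/w))` with `P(0) = 0`, an analytic
function of `1/w`. -/
lemma asympExp_stirlingQuotient (a : ℂ) : AsympExp (stirlingQuotient a) := fun K => by
  obtain ⟨P, hP0, -, hP⟩ := stirlingQuotient_isBigO a (K + 1) (by omega)
  have hz : P.eval 0 = 0 := by rw [← Polynomial.coeff_zero_eq_eval_zero, hP0]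
  have hexp : AsympExp fun w => Complex.exp (P.eval w⁻¹) :=
    (AsympExp.of_polynomial P).comp_analytic (fun δ _ => by
      have hd : (fun x : ℂ => P.eval x - P.eval 0) =O[𝓝 0] fun x => x - 0 :=
        (P.differentiableAt (x := (0 : ℂ))).isBigO_sub
      simpa [Function.comp_def, hz] using hd.comp_tendsto (tendsto_inv_sectorAtInf δ))
      (by fun_prop)
  obtain ⟨q, hq⟩ := hexp K
  refine ⟨q, fun δ hδ => ?_⟩
  have h1 := (hexp.isBigO_one hδ).mul
    ((hP δ hδ).trans (isBigO_inv_pow_of_le (show K ≤ K + 1 + 1 by omega) δ))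
  have h2 := (hq δ hδ).add (by simpa using h1)
  refine h2.congr_left fun w => ?_
  have : Complex.exp (P.eval w⁻¹) * Complex.exp (-P.eval w⁻¹) = 1 := by
    rw [← Complex.exp_add]; simp
  linear_combination (stirlingQuotient a w) * this

/-! ### Expansions to second order -/

/-- `φ(s) = 1 + c / s + O(s ^ (-2))` along the filter `l`. -/
def HasJet (l : Filter ℂ) (φ : ℂ → ℂ) (c : ℂ) : Prop :=
  (fun s => φ s - (1 + c * s⁻¹)) =O[l] fun s => s⁻¹ ^ 2

namespace HasJet

variable {l : Filter ℂ} {φ ψ : ℂ → ℂ} {c d : ℂ}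

lemma isBigO_sub_one (hl : Tendsto (fun s : ℂ => s⁻¹) l (𝓝 0)) (h : HasJet l φ c) :
    (fun s => φ s - 1) =O[l] fun s => s⁻¹ := by
  have h1 : (fun s : ℂ => s⁻¹ ^ 2) =O[l] fun s => s⁻¹ := by
    simpa [pow_two] using (isBigO_refl (fun s : ℂ => s⁻¹) l).mul (hl.isBigO_one ℂ)
  have h2 := (h.trans h1).add ((isBigO_refl (fun s : ℂ => s⁻¹) l).const_mul_left c)
  refine h2.congr_left fun s => by ring

lemma tendsto (hl : Tendsto (fun s : ℂ => s⁻¹) l (𝓝 0)) (h : HasJet l φ c) :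
    Tendsto φ l (𝓝 1) := by
  have := ((h.isBigO_sub_one hl).trans_tendsto hl).add_const 1
  simpa using this

lemma mul (hl : Tendsto (fun s : ℂ => s⁻¹) l (𝓝 0)) (h : HasJet l φ c) (h' : HasJet l ψ d) :
    HasJet l (fun s => φ s * ψ s) (c + d) := by
  have h1 := IsBigO.mul ((h.tendsto hl).isBigO_one ℂ) h'
  have h2 := IsBigO.mul h (((hl.const_mul d).const_add 1).isBigO_one ℂ)
  simp only [one_mul, mul_one] at h1 h2
  have h3 := (h1.add h2).add ((isBigO_refl (fun s : ℂ => s⁻¹ ^ 2) l).const_mul_left (c * d))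
  refine h3.congr_left fun s => by ring

lemma inv (hl : Tendsto (fun s : ℂ => s⁻¹) l (𝓝 0)) (h : HasJet l φ c) :
    HasJet l (fun s => (φ s)⁻¹) (-c) := by
  have ht := h.tendsto hl
  have h1 : (fun s => (φ s)⁻¹) =O[l] fun _ => (1 : ℂ) := (ht.inv₀ one_ne_zero).isBigO_one ℂ
  have h2 := IsBigO.mul ((hl.const_mul c).isBigO_one ℂ) h
  simp only [one_mul] at h2
  have h3 := (h2.sub h).add ((isBigO_refl (fun s : ℂ => s⁻¹ ^ 2) l).const_mul_left (c * c))
  have h4 : (fun s => 1 - φ s * (1 - c * s⁻¹)) =O[l] fun s => s⁻¹ ^ 2 :=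
    IsBigO.congr_left h3 fun s => by ring
  have h5 := h4.mul h1
  simp only [mul_one] at h5
  refine IsBigO.congr' h5 ?_ EventuallyEq.rfl
  filter_upwards [ht.eventually_ne one_ne_zero] with s hs
  field_simp
  ring

lemma prod {ι : Type*} (hl : Tendsto (fun s : ℂ => s⁻¹) l (𝓝 0)) (t : Finset ι)
    {φ : ι → ℂ → ℂ} {c : ι → ℂ} (h : ∀ i ∈ t, HasJet l (φ i) (c i)) :
    HasJet l (fun s => ∏ i ∈ t, φ i s) (∑ i ∈ t, c i) := by
  classical
  induction t using Finset.induction_on with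
  | empty => simpa [HasJet] using isBigO_zero (E' := ℂ) (fun s : ℂ => (s ^ 2)⁻¹) l
  | insert i t hi ih =>
    simp only [Finset.prod_insert hi, Finset.sum_insert hi]
    exact (h i (Finset.mem_insert_self _ _)).mul hl
      (ih fun j hj => h j (Finset.mem_insert_of_mem hj))

lemma comp_mul {δ : ℝ} (h : HasJet (sectorAtInf δ) φ c) {m : ℂ}
    (ht : Tendsto (fun s : ℂ => m * s) l (sectorAtInf δ)) :
    HasJet l (fun s => φ (m * s)) (c / m) := by
  have h1 := IsBigO.comp_tendsto h ht
  have h2 : (fun w : ℂ => (m * w)⁻¹ ^ 2) =O[l] fun w => w⁻¹ ^ 2 := by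
    refine IsBigO.of_bound ‖m⁻¹ ^ 2‖ (Eventually.of_forall fun w => ?_)
    rw [mul_inv, mul_pow, norm_mul]
  refine IsBigO.congr_left (h1.trans h2) fun s => ?_
  simp only [Function.comp, mul_inv]
  ring

end HasJet

/-- Only the linear coefficient of `P` in Stirling's formula matters at this order. It equals
`B_2(a)/2`. -/
lemma hasJet_stirlingQuotient (a : ℂ) {δ : ℝ} (hδ : 0 < δ) :
    HasJet (sectorAtInf δ) (stirlingQuotient a) ((a ^ 2 - a + 1 / 6) / 2) := by
  obtain ⟨P, hP0, hP1, hP⟩ := stirlingQuotient_isBigO a 1 le_rfl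
  have hl := tendsto_inv_sectorAtInf δ
  have hexp : HasJet (sectorAtInf δ) (fun w => Complex.exp (P.eval w⁻¹))
      ((a ^ 2 - a + 1 / 6) / 2) := by
    have han : AnalyticAt ℂ (fun x => Complex.exp (P.eval x)) 0 :=
      (show AnalyticAt ℂ (fun x => P.eval x) 0 from P.differentiable.analyticAt 0).cexp
    obtain ⟨k, hk, hx⟩ := exists_eq_add_mul_analyticAt han
    obtain ⟨k1, hk1, hx1⟩ := exists_eq_add_mul_analyticAt hk
    have hz : P.eval 0 = 0 := by rw [← Polynomial.coeff_zero_eq_eval_zero, hP0]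
    have hk0 : k 0 = (a ^ 2 - a + 1 / 6) / 2 := by
      have h1 := hasDerivAt_zero_of_eq_add_mul hk hx
      have h2 := (P.hasDerivAt 0).cexp
      rw [h1.unique h2, hz, Complex.exp_zero, one_mul, ← hP1,
        ← Polynomial.coeff_zero_eq_eval_zero, Polynomial.coeff_derivative]
      simp
    have h1 := (isBigO_refl (fun w : ℂ => w⁻¹ ^ 2) (sectorAtInf δ)).mul
      ((hk1.continuousAt.tendsto.comp hl).isBigO_one ℂ)
    simp only [mul_one] at h1
    refine IsBigO.congr_left h1 fun w => ?_
    show _ = Complex.exp (P.eval w⁻¹) - _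
    rw [hx, hx1, hk0, hz, Complex.exp_zero, Function.comp]
    ring
  have hq : HasJet (sectorAtInf δ) (fun w => stirlingQuotient a w * Complex.exp (-P.eval w⁻¹)) 0 := by
    simpa [HasJet] using hP δ hδ
  have := hexp.mul hl hq
  rw [add_zero] at this
  refine IsBigO.congr_left this fun w => ?_
  have : Complex.exp (P.eval w⁻¹) * Complex.exp (-P.eval w⁻¹) = 1 := by
    rw [← Complex.exp_add]; simp
  linear_combination (stirlingQuotient a w) * this

/-! ### Expansions in the scale `Γ(2 w + 3 / 2 - l)` -/

/-- `Γ(2 w + 3 / 2 - l) / Γ(2 w + 3 / 2)`. -/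
noncomputable def gammaScale (l : ℕ) (w : ℂ) : ℂ :=
  ∏ i ∈ Finset.range l, (2 * w + 1 / 2 - i)⁻¹

lemma ne_zero_of_norm_ge {w : ℂ} {i : ℕ} (h : (i : ℝ) + 1 ≤ ‖w‖) : 2 * w + 1 / 2 - i ≠ 0 := by
  intro h0
  have h1 : w = ((i : ℂ) - 1 / 2) / 2 := by linear_combination (1 / 2) * h0
  have h2 : ‖((i : ℂ) - 1 / 2) / 2‖ ≤ (i + 1 / 2) / 2 := by
    rw [norm_div]
    have : ‖(i : ℂ) - 1 / 2‖ ≤ i + 1 / 2 := by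
      refine (norm_sub_le _ _).trans ?_
      simp
    norm_num at this ⊢
    linarith
  rw [h1] at h
  have : (0 : ℝ) ≤ i := Nat.cast_nonneg i
  linarith

lemma Gamma_eq_gammaScale_mul {w : ℂ} {l : ℕ} (h : (l : ℝ) + 1 ≤ ‖w‖) :
    Complex.Gamma (2 * w + 3 / 2 - l) = gammaScale l w * Complex.Gamma (2 * w + 3 / 2) := by
  induction l with
  | zero => simp [gammaScale]
  | succ l ih =>
    push_cast at h
    have hne : 2 * w + 1 / 2 - l ≠ 0 := ne_zero_of_norm_ge (by linarith)
    have h1 := Complex.Gamma_add_one _ hne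
    rw [show 2 * w + 1 / 2 - l + 1 = 2 * w + 3 / 2 - l by ring, ih (by linarith)] at h1
    rw [gammaScale, Finset.prod_range_succ, ← gammaScale]
    push_cast
    rw [show 2 * w + 3 / 2 - ((l : ℂ) + 1) = 2 * w + 1 / 2 - l by ring]
    rw [mul_right_comm, h1, mul_right_comm, mul_inv_cancel₀ hne, one_mul]

/-- Subtracting the limit and multiplying by `2w + b` strips off one factor of the Gamma scale.
Iterating this reads off the coefficients one at a time. -/
lemma AsympExp.step {φ : ℂ → ℂ} (h : AsympExp φ) {c : ℂ}
    (hc : ∀ δ > 0, (fun w => φ w - c) =O[sectorAtInf δ] fun w => w⁻¹) (b : ℂ) :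
    AsympExp fun w => (φ w - c) * (2 * w + b) := by
  have h1 : AsympExp fun w => φ w - c := by simpa [sub_eq_add_neg] using h.add (.const (-c))
  have h2 := ((AsympExp.const 2).mul (h1.mul_self hc)).add ((AsympExp.const b).mul h1)
  exact h2.congr fun δ _ => Eventually.of_forall fun w => by ring

/-- An asymptotic expansion in powers of `1 / w` can be rewritten in the scale
`Γ(2 w + 3 / 2 - l) / Γ(2 w + 3 / 2)`. -/
lemma AsympExp.exists_gammaScale {φ : ℂ → ℂ} (h : AsympExp φ) :
    ∃ d : ℕ → ℂ, (∀ M : ℕ, ∀ δ > 0, (fun w => φ w - ∑ l ∈ Finset.range (M + 1),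
        d l * gammaScale l w) =O[sectorAtInf δ] fun w => gammaScale M w * w⁻¹) ∧
      (∀ δ > 0, (fun w => φ w - d 0) =O[sectorAtInf δ] fun w => w⁻¹) ∧
      ∀ δ > 0, (fun w => (φ w - d 0) * (2 * w + 1 / 2) - d 1) =O[sectorAtInf δ] fun w => w⁻¹ := by
  choose c hc using fun φ : {φ : ℂ → ℂ // AsympExp φ} => φ.2.exists_const
  -- `Φ l` is what remains after `l` steps, divided by `gammaScale l`. By `hsum` this is an exact
  -- identity for `‖w‖ ≥ M`, so the error estimate reduces to `Φ M - c (Φ M) = O(1/w)`.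
  let Φ : ℕ → {φ : ℂ → ℂ // AsympExp φ} := fun n => Nat.rec ⟨φ, h⟩
    (fun l ψ => ⟨fun w => (ψ.1 w - c ψ) * (2 * w + (1 / 2 - l)), ψ.2.step (hc ψ) _⟩) n
  have hΦ : ∀ l w, (Φ (l + 1)).1 w = ((Φ l).1 w - c (Φ l)) * (2 * w + (1 / 2 - l)) :=
    fun l w => rfl
  have hsum : ∀ (M : ℕ) (w : ℂ), (M : ℝ) ≤ ‖w‖ →
      φ w - ∑ l ∈ Finset.range M, c (Φ l) * gammaScale l w = (Φ M).1 w * gammaScale M w := by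
    intro M w hw
    induction M with
    | zero => simp [gammaScale, Φ]
    | succ M ih =>
      push_cast at hw
      rw [Finset.sum_range_succ, ← sub_sub, ih (by linarith), hΦ]
      have hne : 2 * w + 1 / 2 - M ≠ 0 := ne_zero_of_norm_ge (by linarith)
      have hg : gammaScale (M + 1) w = gammaScale M w * (2 * w + 1 / 2 - M)⁻¹ := by
        rw [gammaScale, Finset.prod_range_succ, ← gammaScale]
      rw [hg, show 2 * w + (1 / 2 - (M : ℂ)) = 2 * w + 1 / 2 - M by ring]
      generalize 2 * w + 1 / 2 - (M : ℂ) = y at hne ⊢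
      field_simp
  refine ⟨fun l => c (Φ l), fun M δ hδ => ?_, hc (Φ 0), fun δ hδ => ?_⟩
  · have h1 := (isBigO_refl (gammaScale M) (sectorAtInf δ)).mul (hc (Φ M) δ hδ)
    refine h1.congr' ?_ EventuallyEq.rfl
    have : ∀ᶠ w in sectorAtInf δ, (M : ℝ) ≤ ‖w‖ :=
      eventually_sectorAtInf.2 ⟨M, fun w hw _ => hw⟩
    filter_upwards [this] with w hw
    rw [Finset.sum_range_succ, ← sub_sub, hsum M w hw]
    ring
  · refine (hc (Φ 1) δ hδ).congr_left fun w => ?_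
    show (Φ (0 + 1)).1 w - _ = _
    rw [hΦ 0 w]
    simp [Φ]

/-! ### The `h`-function -/

namespace GammaFactor

variable (γ : GammaFactor)

lemma sum_lam (hdeg : γ.degree = 2) : ∑ j, γ.lam j = 1 := by
  rw [degree] at hdeg; linarith

/-- The internal shift is the only source of a power of `w` with imaginary exponent in the main
terms. This sum is the exponent. -/
lemma sum_mu_im (hdeg : γ.degree = 2) (hθ : γ.theta = 0) : ∑ j, (γ.mu j).im = 0 := by
  rw [theta, hdeg, div_eq_zero_iff, or_iff_left (by norm_num)] at hθ
  have : γ.xi.im = 2 * ∑ j, (γ.mu j).im := by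
    rw [xi]
    simp [Complex.im_sum]
  linarith

lemma log_conductor (hdeg : γ.degree = 2) (hcond : γ.conductor = 1) :
    Real.log γ.Q + ∑ j, γ.lam j * Real.log (γ.lam j) = -Real.log (2 * Real.pi) := by
  have hQ := γ.Q_pos
  have hπ := Real.pi_pos
  have h1 := congrArg Real.log hcond
  have hp : ∀ j, 0 < γ.lam j ^ (2 * γ.lam j) := fun j => Real.rpow_pos_of_pos (γ.lam_pos j) _
  have hprod : 0 < ∏ j, γ.lam j ^ (2 * γ.lam j) := Finset.prod_pos fun j _ => hp j
  rw [conductor, hdeg, Real.log_one, Real.log_mul (by positivity) hprod.ne',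
    Real.log_mul (by positivity) (by positivity), Real.log_rpow (by positivity), Real.log_pow,
    Real.log_prod fun j _ => (hp j).ne'] at h1
  have h2 : ∑ j, Real.log (γ.lam j ^ (2 * γ.lam j)) = 2 * ∑ j, γ.lam j * Real.log (γ.lam j) := by
    rw [Finset.mul_sum]
    refine Finset.sum_congr rfl fun j _ => ?_
    rw [Real.log_rpow (γ.lam_pos j)]; ring
  rw [h2] at h1
  push_cast at h1
  linarith

lemma log_lam_mul (j : Fin γ.r) {w : ℂ} (hw : w ≠ 0) :
    Complex.log (γ.lam j * w) = Real.log (γ.lam j) + Complex.log w :=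
  Complex.log_ofReal_mul (γ.lam_pos j) hw

/-- The correction factor `h(-w) / (prefactor * Γ(2 w + 3 / 2))`. -/
noncomputable def hQuotient (w : ℂ) : ℂ :=
  (∏ j, stirlingQuotient (γ.lam j + conj (γ.mu j)) (γ.lam j * w) *
    stirlingQuotient (1 - γ.mu j) (γ.lam j * w)) * (stirlingQuotient (3 / 2) (2 * w))⁻¹

lemma rootNumber_eq (ω : ℂ) : γ.rootNumber ω =
    ω * Complex.exp (∑ j, (conj (γ.mu j) - γ.mu j) * Real.log (γ.lam j)) := by
  rw [rootNumber, Complex.exp_sum]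
  congr 1
  refine Finset.prod_congr rfl fun j _ => ?_
  rw [Complex.cpow_def_of_ne_zero (by exact_mod_cast (γ.lam_pos j).ne'),
    ← Complex.ofReal_log (γ.lam_pos j).le]
  congr 1
  have : conj (γ.mu j) - γ.mu j = -(2 * Complex.I * ((γ.mu j).im : ℂ)) := by
    rw [← neg_sub, Complex.sub_conj]; push_cast; ring
  rw [this]; ring

lemma prefactor_eq (hdeg : γ.degree = 2) (hcond : γ.conductor = 1) (ω w : ℂ) :
    γ.prefactor ω (-w) = γ.rootNumber ω / (Real.sqrt (2 * Real.pi) : ℂ) *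
      Complex.exp (-(2 * w + 1) * (Real.log 2 + Real.log (2 * Real.pi))) := by
  have hπ := Real.pi_pos
  rw [prefactor, hdeg, hcond, Real.one_rpow]
  congr 1
  rw [Complex.cpow_def_of_ne_zero (by
    rw [Complex.ofReal_ne_zero]; positivity), ← Complex.ofReal_log (by positivity),
    one_div, Real.log_inv, Real.log_mul (by positivity) (by positivity)]
  congr 1
  push_cast
  ring

/-- Stirling's formula is applied to all Gamma functions with the same `log w`. The coefficient of
`log w` becomes `2w + 1` because the `λ_j` sum to 1 and the imaginary parts of the `μ_j` cancel. The
conductor condition matches the constants, and what survives of the `log λ_j` is the root number. -/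
lemma hFun_eq (hdeg : γ.degree = 2) (hcond : γ.conductor = 1) (hθ : γ.theta = 0) (ω : ℂ) {w : ℂ}
    (hw : w ≠ 0) (hΓ : stirlingQuotient (3 / 2) (2 * w) ≠ 0) :
    γ.hFun ω (-w) = γ.prefactor ω (-w) * Complex.Gamma (2 * w + 3 / 2) * γ.hQuotient w := by
  have hs : (Real.sqrt (2 * Real.pi) : ℂ) ≠ 0 := by
    rw [Complex.ofReal_ne_zero]; positivity
  have hs2 : (Real.sqrt (2 * Real.pi) : ℂ) * (Real.sqrt (2 * Real.pi) : ℂ) = 2 * Real.pi := by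
    rw [← Complex.ofReal_mul, Real.mul_self_sqrt (by positivity)]; push_cast; ring
  have hpi : (2 * Real.pi : ℂ) ≠ 0 := by exact_mod_cast (by positivity : 2 * Real.pi ≠ 0)
  set L := Complex.log w with hL
  have hpair : ∀ j, Complex.Gamma (γ.lam j * (1 - -w) + conj (γ.mu j)) *
      Complex.Gamma (1 - γ.lam j * -w - γ.mu j) = (2 * Real.pi) *
      Complex.exp ((2 * γ.lam j * w + γ.lam j + (conj (γ.mu j) - γ.mu j)) *
        (Real.log (γ.lam j) + L) - 2 * γ.lam j * w) *
      (stirlingQuotient (γ.lam j + conj (γ.mu j)) (γ.lam j * w) *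
        stirlingQuotient (1 - γ.mu j) (γ.lam j * w)) := by
    intro j
    have e1 := Gamma_eq_stirlingQuotient (γ.lam j + conj (γ.mu j)) (γ.lam j * w)
    have e2 := Gamma_eq_stirlingQuotient (1 - γ.mu j) (γ.lam j * w)
    rw [γ.log_lam_mul j hw] at e1 e2
    rw [show (γ.lam j : ℂ) * (1 - -w) + conj (γ.mu j) =
      γ.lam j * w + (γ.lam j + conj (γ.mu j)) by ring,
      show 1 - (γ.lam j : ℂ) * -w - γ.mu j = γ.lam j * w + (1 - γ.mu j) by ring, e1, e2, ← hs2]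
    have : ((2 * γ.lam j * w + γ.lam j + (conj (γ.mu j) - γ.mu j)) *
        (Real.log (γ.lam j) + L) - 2 * γ.lam j * w) =
        ((γ.lam j * w + (γ.lam j + conj (γ.mu j)) - 1 / 2) * (Real.log (γ.lam j) + L) -
          γ.lam j * w) + ((γ.lam j * w + (1 - γ.mu j) - 1 / 2) * (Real.log (γ.lam j) + L) -
          γ.lam j * w) := by ring
    rw [this, Complex.exp_add]
    ring
  have hprod : ∏ j, (Complex.Gamma (γ.lam j * (1 - -w) + conj (γ.mu j)) *
      Complex.Gamma (1 - γ.lam j * -w - γ.mu j)) = (2 * Real.pi) ^ γ.r *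
      Complex.exp (∑ j, ((2 * γ.lam j * w + γ.lam j + (conj (γ.mu j) - γ.mu j)) *
        (Real.log (γ.lam j) + L) - 2 * γ.lam j * w)) *
      ∏ j, (stirlingQuotient (γ.lam j + conj (γ.mu j)) (γ.lam j * w) *
        stirlingQuotient (1 - γ.mu j) (γ.lam j * w)) := by
    rw [Finset.prod_congr rfl fun j _ => hpair j, Finset.prod_mul_distrib, Finset.prod_mul_distrib,
      Complex.exp_sum]
    simp
  have hlam : ∑ j, (γ.lam j : ℂ) = 1 := by exact_mod_cast γ.sum_lam hdeg
  have hmu : ∑ j, (conj (γ.mu j) - γ.mu j) = 0 := by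
    have : ∀ j, conj (γ.mu j) - γ.mu j = ((γ.mu j).im : ℂ) * (-2 * Complex.I) := fun j => by
      rw [← neg_sub, Complex.sub_conj]; push_cast; ring
    rw [Finset.sum_congr rfl fun j _ => this j, ← Finset.sum_mul]
    have h0 : ∑ j, ((γ.mu j).im : ℂ) = 0 := by exact_mod_cast γ.sum_mu_im hdeg hθ
    rw [h0, zero_mul]
  have hlog : (Real.log γ.Q : ℂ) + ∑ j, (γ.lam j : ℂ) * Real.log (γ.lam j) =
      -Real.log (2 * Real.pi) := by exact_mod_cast γ.log_conductor hdeg hcond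
  -- Summing the exponents over `j`: the terms multiplied by `log w` collapse by `hlam` and `hmu`.
  have hexpo : ∑ j, ((2 * γ.lam j * w + γ.lam j + (conj (γ.mu j) - γ.mu j)) *
        (Real.log (γ.lam j) + L) - 2 * γ.lam j * w) =
      (2 * w + 1) * ∑ j, (γ.lam j : ℂ) * Real.log (γ.lam j) +
      ∑ j, (conj (γ.mu j) - γ.mu j) * Real.log (γ.lam j) + (2 * w + 1) * L - 2 * w := by
    have : ∀ j, ((2 * γ.lam j * w + γ.lam j + (conj (γ.mu j) - γ.mu j)) *
        (Real.log (γ.lam j) + L) - 2 * γ.lam j * w) =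
        (2 * w + 1) * ((γ.lam j : ℂ) * Real.log (γ.lam j)) +
        (conj (γ.mu j) - γ.mu j) * Real.log (γ.lam j) + γ.lam j * ((2 * w + 1) * L - 2 * w) +
        (conj (γ.mu j) - γ.mu j) * L := fun j => by ring
    rw [Finset.sum_congr rfl fun j _ => this j, Finset.sum_add_distrib, Finset.sum_add_distrib,
      Finset.sum_add_distrib, ← Finset.mul_sum, ← Finset.sum_mul, ← Finset.sum_mul, hlam, hmu]
    ring
  have hG := Gamma_eq_stirlingQuotient (3 / 2) (2 * w)
  have hlog2 : Complex.log (2 * w) = Real.log 2 + L := by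
    have := Complex.log_ofReal_mul (r := 2) (by norm_num) hw
    simpa using this
  have hQ : (γ.Q : ℂ) ^ (1 - 2 * -w) = Complex.exp ((2 * w + 1) * Real.log γ.Q) := by
    rw [Complex.cpow_def_of_ne_zero (by exact_mod_cast γ.Q_pos.ne'),
      ← Complex.ofReal_log γ.Q_pos.le]
    congr 1; ring
  rw [hFun, hprod, hexpo, γ.prefactor_eq hdeg hcond, γ.rootNumber_eq, hG, hlog2, hQ, hQuotient]
  have key : Complex.exp ((2 * w + 1) * Real.log γ.Q) * Complex.exp
      ((2 * w + 1) * ∑ j, (γ.lam j : ℂ) * Real.log (γ.lam j) +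
      ∑ j, (conj (γ.mu j) - γ.mu j) * Real.log (γ.lam j) + (2 * w + 1) * L - 2 * w) =
      Complex.exp (∑ j, (conj (γ.mu j) - γ.mu j) * Real.log (γ.lam j)) *
      Complex.exp (-(2 * w + 1) * (Real.log 2 + Real.log (2 * Real.pi))) *
      Complex.exp ((2 * w + 3 / 2 - 1 / 2) * (Real.log 2 + L) - 2 * w) := by
    simp only [← Complex.exp_add]
    congr 1
    linear_combination (2 * w + 1) * hlog
  set P := ∏ j, (stirlingQuotient (γ.lam j + conj (γ.mu j)) (γ.lam j * w) *
        stirlingQuotient (1 - γ.mu j) (γ.lam j * w))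
  set X := stirlingQuotient (3 / 2) (2 * w)
  rw [eq_comm]
  generalize Complex.exp ((2 * w + 1) * Real.log γ.Q) = E1 at key ⊢
  generalize Complex.exp (-(2 * w + 1) * (Real.log 2 + Real.log (2 * Real.pi))) = E2 at key ⊢
  generalize Complex.exp ((2 * w + 3 / 2 - 1 / 2) * (Real.log 2 + L) - 2 * w) = E3 at key ⊢
  generalize Complex.exp (∑ j, (conj (γ.mu j) - γ.mu j) * Real.log (γ.lam j)) = E4 at key ⊢
  have hpow : (2 * Real.pi : ℂ) ^ γ.r ≠ 0 := pow_ne_zero _ hpi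
  generalize (2 * Real.pi : ℂ) ^ γ.r = p at hpow ⊢
  generalize (Real.sqrt (2 * Real.pi) : ℂ) = q at hs ⊢
  field_simp
  linear_combination -(ω * P) * key

lemma asympExp_hQuotient : AsympExp γ.hQuotient := by
  have h1 : ∀ (a : ℂ) (j : Fin γ.r), AsympExp fun w => stirlingQuotient a (γ.lam j * w) :=
    fun a j => (asympExp_stirlingQuotient a).comp_mul (γ.lam_pos j)
  have h2 : ∀ t : Finset (Fin γ.r), AsympExp fun w => ∏ j ∈ t,
      stirlingQuotient (γ.lam j + conj (γ.mu j)) (γ.lam j * w) *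
        stirlingQuotient (1 - γ.mu j) (γ.lam j * w) := by
    intro t
    classical
    induction t using Finset.induction_on with
    | empty => simpa using AsympExp.const 1
    | insert j t hj ih =>
      simp only [Finset.prod_insert hj]
      exact ((h1 _ j).mul (h1 _ j)).mul ih
  refine (h2 Finset.univ).mul ?_
  have h3 : AsympExp fun w => stirlingQuotient (3 / 2) (2 * w) + (-1) := by
    have := (asympExp_stirlingQuotient (3 / 2)).comp_mul (r := 2) (by norm_num)
    simpa using this.add (.const (-1))
  have h4 := h3.comp_analytic (F := fun x => (1 + x)⁻¹) (fun δ hδ => ?_)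
    (AnalyticAt.inv (by fun_prop) (by simp))
  · exact h4.congr fun δ _ => Eventually.of_forall fun w => by simp
  · have hj := (hasJet_stirlingQuotient (3 / 2) hδ).isBigO_sub_one (tendsto_inv_sectorAtInf δ)
    have ht := tendsto_mul_sectorAtInf (r := 2) (by norm_num) δ
    have h5 := hj.comp_tendsto ht
    have h6 : (fun w : ℂ => (((2 : ℝ) : ℂ) * w)⁻¹) =O[sectorAtInf δ] fun w => w⁻¹ :=
      IsBigO.of_bound ‖((2 : ℝ) : ℂ)⁻¹‖ (Eventually.of_forall fun w => by rw [mul_inv, norm_mul])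
    refine (h5.trans h6).congr_left fun w => ?_
    simp [sub_eq_add_neg]

lemma hasJet_hQuotient {δ : ℝ} (hδ : 0 < δ) :
    HasJet (sectorAtInf δ) γ.hQuotient (∑ j, ((((γ.lam j + conj (γ.mu j)) ^ 2 -
      (γ.lam j + conj (γ.mu j)) + 1 / 6) / 2) / γ.lam j +
      (((1 - γ.mu j) ^ 2 - (1 - γ.mu j) + 1 / 6) / 2) / γ.lam j) + -(11 / 48)) := by
  have hl := tendsto_inv_sectorAtInf δ
  refine HasJet.mul hl (HasJet.prod hl _ fun j _ => HasJet.mul hl ?_ ?_) (HasJet.inv hl ?_)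
  · exact (hasJet_stirlingQuotient _ hδ).comp_mul (tendsto_mul_sectorAtInf (γ.lam_pos j) δ)
  · exact (hasJet_stirlingQuotient _ hδ).comp_mul (tendsto_mul_sectorAtInf (γ.lam_pos j) δ)
  -- `B_2(3/2)/2 = 11/24`, and the argument `2w` halves it to `11/48`.
  · have := (hasJet_stirlingQuotient (3 / 2) hδ).comp_mul (m := ((2 : ℝ) : ℂ))
      (tendsto_mul_sectorAtInf (by norm_num) δ)
    convert! this using 1
    norm_num

lemma scale_arg (hdeg : γ.degree = 2) (hθ : γ.theta = 0) (l : ℕ) (w : ℂ) :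
    (γ.degree : ℂ) * (γ.sStar l - -w) = 2 * w + 3 / 2 - l := by
  rw [sStar, hdeg, hθ]
  push_cast
  ring

lemma abs_arg_neg_le {s : ℂ} {δ : ℝ} (hδ : 0 < δ) (h : δ ≤ |s.arg|) :
    |(-s).arg| ≤ Real.pi - δ := by
  rcases lt_trichotomy s.im 0 with hi | hi | hi
  · rw [Complex.arg_neg_eq_arg_add_pi_of_im_neg hi]
    rw [abs_of_neg (Complex.arg_neg_iff.2 hi)] at h
    rw [abs_of_nonneg (by linarith [Complex.neg_pi_lt_arg s])]
    linarith
  · have hs : s.re < 0 := by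
      by_contra hre
      rw [Complex.arg_eq_zero_iff.2 ⟨not_lt.1 hre, hi⟩, abs_zero] at h
      linarith
    have h1 : s.arg = Real.pi := Complex.arg_eq_pi_iff.2 ⟨hs, hi⟩
    rw [h1, abs_of_pos Real.pi_pos] at h
    have h2 : (-s).arg = 0 := Complex.arg_eq_zero_iff.2 ⟨by simpa using hs.le, by simpa using hi⟩
    rw [h2, abs_zero]
    linarith
  · rw [Complex.arg_neg_eq_arg_sub_pi_of_im_pos hi]
    rw [abs_of_nonneg (Complex.arg_nonneg_iff.2 hi.le)] at h
    rw [abs_of_nonpos (by linarith [Complex.arg_le_pi s])]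
    linarith

/-- The second scale function is `1 / (2w + 1/2)`, so the coefficient `c` of `1/w` in `hQuotient`
corresponds to `d_1 = 2c`. -/
theorem exists_isStructuralInvariants (hdeg : γ.degree = 2) (hcond : γ.conductor = 1)
    (hθ : γ.theta = 0) (ω : ℂ) :
    ∃ d : ℕ → ℂ, γ.IsStructuralInvariants ω d ∧ d 1 = 2 * (∑ j, ((((γ.lam j + conj (γ.mu j)) ^ 2 -
      (γ.lam j + conj (γ.mu j)) + 1 / 6) / 2) / γ.lam j +
      (((1 - γ.mu j) ^ 2 - (1 - γ.mu j) + 1 / 6) / 2) / γ.lam j) + -(11 / 48)) := by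
  obtain ⟨d, hd, hd0, hd1⟩ := γ.asympExp_hQuotient.exists_gammaScale
  refine ⟨d, fun M δ hδ => ?_, ?_⟩
  · obtain ⟨C, hC⟩ := (hd M δ hδ).bound
    have hE : ∀ᶠ w in sectorAtInf δ, stirlingQuotient (3 / 2) (((2 : ℝ) : ℂ) * w) ≠ 0 :=
      (tendsto_mul_sectorAtInf (r := 2) (by norm_num) δ).eventually
        (((hasJet_stirlingQuotient (3 / 2) hδ).tendsto
          (tendsto_inv_sectorAtInf δ)).eventually_ne one_ne_zero)
    obtain ⟨R, hR⟩ := eventually_sectorAtInf.1 (hC.and hE)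
    refine ⟨C, max R (M + 1), fun s hs harg => ?_⟩
    have hwR : R ≤ ‖-s‖ := by rw [norm_neg]; exact (le_max_left _ _).trans hs
    have hwM : (M : ℝ) + 1 ≤ ‖-s‖ := by rw [norm_neg]; exact (le_max_right _ _).trans hs
    obtain ⟨w, rfl⟩ : ∃ w, s = -w := ⟨-s, by simp⟩
    rw [neg_neg] at hwR hwM
    obtain ⟨h1, h2⟩ := hR w hwR (by simpa using abs_arg_neg_le hδ harg)
    have hw0 : w ≠ 0 := norm_pos_iff.1 (by have : (0 : ℝ) ≤ M := Nat.cast_nonneg M; linarith)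
    push_cast at h2
    rw [γ.hFun_eq hdeg hcond hθ ω hw0 h2, γ.scale_arg hdeg hθ, Gamma_eq_gammaScale_mul hwM]
    have hsum : ∑ l ∈ Finset.range (M + 1), d l *
        Complex.Gamma (γ.degree * (γ.sStar l - -w)) =
        (∑ l ∈ Finset.range (M + 1), d l * gammaScale l w) * Complex.Gamma (2 * w + 3 / 2) := by
      rw [Finset.sum_mul]
      refine Finset.sum_congr rfl fun l hl => ?_
      have : (l : ℝ) ≤ M := by exact_mod_cast Nat.lt_succ_iff.1 (Finset.mem_range.1 hl)
      rw [γ.scale_arg hdeg hθ, Gamma_eq_gammaScale_mul (by linarith)]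
      ring
    rw [hsum]
    set p := γ.prefactor ω (-w)
    set G := Complex.Gamma (2 * w + 3 / 2)
    set S := ∑ l ∈ Finset.range (M + 1), d l * gammaScale l w
    calc ‖p * G * γ.hQuotient w - p * (S * G)‖ = ‖p * G‖ * ‖γ.hQuotient w - S‖ := by
          rw [← norm_mul]; congr 1; ring
      _ ≤ ‖p * G‖ * (C * ‖gammaScale M w * w⁻¹‖) := by gcongr
      _ = C * (‖p * (gammaScale M w * G)‖ / ‖-w‖) := by
          simp only [norm_mul, norm_inv, norm_neg]; ring
  · have hπ := Real.pi_pos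
    -- For `δ = π` the sector degenerates to the ray `arg w = 0`. It is still unbounded, so limits
    -- along it are unique.
    have := neBot_sectorAtInf (le_refl Real.pi)
    have hl := tendsto_inv_sectorAtInf Real.pi
    have hjet := γ.hasJet_hQuotient hπ
    set c := ∑ j, ((((γ.lam j + conj (γ.mu j)) ^ 2 -
      (γ.lam j + conj (γ.mu j)) + 1 / 6) / 2) / γ.lam j +
      (((1 - γ.mu j) ^ 2 - (1 - γ.mu j) + 1 / 6) / 2) / γ.lam j) + -(11 / 48) with hc
    have hd0' : d 0 = 1 := by
      have h1 := ((hd0 _ hπ).trans_tendsto hl).add_const (d 0)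
      simp only [sub_add_cancel, zero_add] at h1
      exact tendsto_nhds_unique h1 (hjet.tendsto hl)
    have h1 := ((hd1 _ hπ).trans_tendsto hl).add_const (d 1)
    simp only [sub_add_cancel, zero_add, hd0'] at h1
    have hne : ∀ᶠ w in sectorAtInf Real.pi, w ≠ 0 :=
      eventually_sectorAtInf.2 ⟨1, fun w hw _ => norm_pos_iff.1 (by linarith)⟩
    have h2 : Tendsto (fun w => (γ.hQuotient w - 1) * w) (sectorAtInf Real.pi) (𝓝 c) := by
      have h3 := IsBigO.mul hjet (isBigO_refl (fun w : ℂ => w) (sectorAtInf Real.pi))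
      have h4 : (fun w => (γ.hQuotient w - 1) * w - c) =O[sectorAtInf Real.pi] fun w => w⁻¹ := by
        refine IsBigO.congr' h3 ?_ ?_
        · filter_upwards [hne] with w hw
          field_simp
          ring
        · filter_upwards [hne] with w hw
          field_simp
      have h5 := (h4.trans_tendsto hl).add_const c
      simpa using h5
    -- `(Q - 1)(2w + 1/2)` tends to `2c`, because `Q → 1` makes the contribution of `1/2` vanish.
    have h6 := (h2.const_mul 2).add ((((hjet.tendsto hl).sub_const 1)).mul_const (1 / 2))
    refine tendsto_nhds_unique h1 ?_
    simp only [sub_self, zero_mul, add_zero] at h6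
    exact h6.congr fun w => by ring

/-! ### Uniqueness of the structural invariants -/

lemma prefactor_ne_zero (hdeg : γ.degree = 2) (hcond : γ.conductor = 1) {ω : ℂ} (hω : ω ≠ 0)
    (w : ℂ) : γ.prefactor ω (-w) ≠ 0 := by
  rw [γ.prefactor_eq hdeg hcond, γ.rootNumber_eq]
  have hs : (Real.sqrt (2 * Real.pi) : ℂ) ≠ 0 := by
    rw [Complex.ofReal_ne_zero]; positivity
  exact mul_ne_zero (div_ne_zero (mul_ne_zero hω (Complex.exp_ne_zero _)) hs)
    (Complex.exp_ne_zero _)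

/-- If the sequences agree below `M`, subtracting the two expansions at `s = -x` leaves `c M - d M`
times a nonzero function of the scale. Hence `c M - d M = O(1/x)`. On this ray the Gamma function
has no zero or pole once `x ≥ M + 1`. -/
theorem isStructuralInvariants_unique (hdeg : γ.degree = 2) (hcond : γ.conductor = 1)
    (hθ : γ.theta = 0) {ω : ℂ} (hω : ω ≠ 0) {c d : ℕ → ℂ} (hc : γ.IsStructuralInvariants ω c)
    (hd : γ.IsStructuralInvariants ω d) : c = d := by
  funext M
  induction M using Nat.strong_induction_on with
  | _ M ih =>
    obtain ⟨C, R, h⟩ := hc M 1 one_pos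
    obtain ⟨C', R', h'⟩ := hd M 1 one_pos
    have hbound : ∀ᶠ x : ℝ in atTop, ‖c M - d M‖ ≤ (C + C') * x⁻¹ := by
      filter_upwards [eventually_ge_atTop (max R (max R' (M + 1)))] with x hx
      have hxR : R ≤ x := (le_max_left _ _).trans hx
      have hxR' : R' ≤ x := ((le_max_left _ _).trans (le_max_right _ _)).trans hx
      have hxM : (M : ℝ) + 1 ≤ x := ((le_max_right _ _).trans (le_max_right _ _)).trans hx
      have hM : (0 : ℝ) ≤ M := Nat.cast_nonneg M
      have hx0 : 0 < x := by linarith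
      have hnorm : ‖(-(x : ℂ))‖ = x := by simp [abs_of_pos hx0]
      have harg : (1 : ℝ) ≤ |(-(x : ℂ)).arg| := by
        rw [← Complex.ofReal_neg, Complex.arg_ofReal_of_neg (by linarith), abs_of_pos Real.pi_pos]
        linarith [Real.pi_gt_three]
      have e := h (-x) (by rw [hnorm]; exact hxR) harg
      have e' := h' (-x) (by rw [hnorm]; exact hxR') harg
      have hp := γ.prefactor_ne_zero hdeg hcond hω x
      have hG : Complex.Gamma (γ.degree * (γ.sStar M - -x)) ≠ 0 := by
        rw [γ.scale_arg hdeg hθ]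
        refine Complex.Gamma_ne_zero_of_re_pos ?_
        simp
        linarith
      have hsum : ∑ l ∈ Finset.range (M + 1), c l * Complex.Gamma (γ.degree * (γ.sStar l - -x)) -
          ∑ l ∈ Finset.range (M + 1), d l * Complex.Gamma (γ.degree * (γ.sStar l - -x)) =
          (c M - d M) * Complex.Gamma (γ.degree * (γ.sStar M - -x)) := by
        rw [Finset.sum_range_succ, Finset.sum_range_succ,
          Finset.sum_congr rfl fun l hl => by rw [ih l (Finset.mem_range.1 hl)]]
        ring
      rw [hnorm] at e e'
      have hn : 0 < ‖γ.prefactor ω (-x) * Complex.Gamma (γ.degree * (γ.sStar M - -x))‖ :=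
        norm_pos_iff.2 (mul_ne_zero hp hG)
      refine le_of_mul_le_mul_right ?_ hn
      rw [← norm_mul]
      have e2 := norm_sub_le_of_le e' e
      refine le_trans (le_of_eq ?_) (e2.trans (le_of_eq (by ring)))
      congr 1
      linear_combination (-γ.prefactor ω (-x)) * hsum
    have hlim : Tendsto (fun x : ℝ => (C + C') * x⁻¹) atTop (𝓝 0) := by
      simpa using tendsto_inv_atTop_zero.const_mul (C + C')
    have := ge_of_tendsto hlim hbound
    exact sub_eq_zero.1 (norm_le_zero_iff.1 this)

/-! ### The value of the first invariant -/

lemma H_two : γ.H 2 = 2 * ∑ j, ((γ.mu j) ^ 2 - γ.mu j + 1 / 6) / γ.lam j := by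
  rw [H]
  congr 1
  refine Finset.sum_congr rfl fun j _ => ?_
  congr 1
  · rw [Polynomial.bernoulli]
    simp [Finset.sum_range_succ, bernoulli_two]
    ring
  · norm_num

/-- By `B_2(1 - μ) = B_2(μ)` and `B_2(λ + ν) = B_2(ν) + λ² + 2λν - λ` the sum contains `H(2)` and
its conjugate with equal weights, together with `conj ξ`. Reality of `H(2)` and `ξ` removes the
conjugates, and the constants combine as `1 - 11/24 = 2/3 - 1/8`. -/
theorem jet_eq_chi (hdeg : γ.degree = 2) (hθ : γ.theta = 0) (hH : (γ.H 2).im = 0) :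
    2 * (∑ j, ((((γ.lam j + conj (γ.mu j)) ^ 2 - (γ.lam j + conj (γ.mu j)) + 1 / 6) / 2) /
      γ.lam j + (((1 - γ.mu j) ^ 2 - (1 - γ.mu j) + 1 / 6) / 2) / γ.lam j) + -(11 / 48)) =
      γ.chi - 1 / 8 := by
  have hlam : ∑ j, (γ.lam j : ℂ) = 1 := by exact_mod_cast γ.sum_lam hdeg
  have hξ : conj (γ.xi) = γ.xi := by
    rw [Complex.conj_eq_iff_im]
    rw [theta, hdeg, div_eq_zero_iff, or_iff_left (by norm_num)] at hθ
    exact hθ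
  have hH' : conj (γ.H 2) = γ.H 2 := Complex.conj_eq_iff_im.2 hH
  have e1 : conj (γ.H 2) = 2 * ∑ j, (conj (γ.mu j) ^ 2 - conj (γ.mu j) + 1 / 6) / γ.lam j := by
    rw [H_two]; simp [map_ofNat]
  have e2 : conj γ.xi = 2 * ∑ j, (conj (γ.mu j) - 1 / 2) := by
    rw [xi]; simp [map_ofNat]
  have hterm : ∀ j, ((((γ.lam j + conj (γ.mu j)) ^ 2 - (γ.lam j + conj (γ.mu j)) + 1 / 6) / 2) /
      γ.lam j + (((1 - γ.mu j) ^ 2 - (1 - γ.mu j) + 1 / 6) / 2) / γ.lam j) =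
      (1 / 2) * ((conj (γ.mu j) ^ 2 - conj (γ.mu j) + 1 / 6) / γ.lam j) +
      (1 / 2) * ((γ.mu j ^ 2 - γ.mu j + 1 / 6) / γ.lam j) + (1 / 2) * (γ.lam j : ℂ) +
      (conj (γ.mu j) - 1 / 2) := fun j => by
    have : (γ.lam j : ℂ) ≠ 0 := by exact_mod_cast (γ.lam_pos j).ne'
    field_simp
    ring
  rw [Finset.sum_congr rfl fun j _ => hterm j, Finset.sum_add_distrib, Finset.sum_add_distrib,
    Finset.sum_add_distrib, ← Finset.mul_sum, ← Finset.mul_sum, ← Finset.mul_sum, hlam, chi]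
  linear_combination (-1 / 2) * e1 - (1 / 2) * γ.H_two - e2 + hξ + (1 / 2) * hH'

end GammaFactor

/-! ### The Gamma function on vertical lines -/

/-- Points of the strip `A ≤ Re s ≤ B` with `|Im s| → ∞`. -/
noncomputable def stripAtInf (A B : ℝ) : Filter ℂ :=
  comap (fun s : ℂ => |s.im|) atTop ⊓ 𝓟 {s | A ≤ s.re ∧ s.re ≤ B}

lemma eventually_stripAtInf {A B : ℝ} {p : ℂ → Prop} :
    (∀ᶠ s in stripAtInf A B, p s) ↔
      ∃ T : ℝ, ∀ s : ℂ, T ≤ |s.im| → A ≤ s.re → s.re ≤ B → p s := by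
  rw [stripAtInf, eventually_inf_principal, eventually_comap, eventually_atTop]
  constructor
  · rintro ⟨R, h⟩
    exact ⟨R, fun w hw h1 h2 => h _ hw w rfl ⟨h1, h2⟩⟩
  · rintro ⟨R, h⟩
    exact ⟨R, fun b hb w hw h' => h w (hw ▸ hb) h'.1 h'.2⟩

lemma abs_arg_le_of_abs_re_le {s : ℂ} (hs : s ≠ 0) (h : |s.re| ≤ |s.im|) :
    |s.arg| ≤ Real.pi - Real.pi / 4 := by
  by_contra hcon
  rw [not_le] at hcon
  have hπ := Real.pi_pos
  have h1 : Real.cos |s.arg| < Real.cos (Real.pi - Real.pi / 4) :=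
    Real.strictAntiOn_cos ⟨by linarith, by linarith⟩ ⟨abs_nonneg _, Complex.abs_arg_le_pi s⟩ hcon
  rw [Real.cos_abs, Real.cos_pi_sub, Real.cos_pi_div_four] at h1
  have hn : 0 < ‖s‖ := norm_pos_iff.2 hs
  have h2 := Complex.norm_mul_cos_arg s
  have h3 : s.re < -(‖s‖ * (Real.sqrt 2 / 2)) := by rw [← h2]; nlinarith
  have h4 : (‖s‖ * (Real.sqrt 2 / 2)) ^ 2 < s.re ^ 2 := by
    rw [← neg_sq s.re]
    exact pow_lt_pow_left₀ (by linarith) (by positivity) two_ne_zero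
  have h5 : ‖s‖ ^ 2 = s.re ^ 2 + s.im ^ 2 := by
    rw [← Complex.normSq_eq_norm_sq, Complex.normSq_apply]; ring
  have h6 : s.re ^ 2 ≤ s.im ^ 2 := sq_le_sq.2 h
  have h7 : (Real.sqrt 2 / 2) ^ 2 = 1 / 2 := by
    rw [div_pow, Real.sq_sqrt (by norm_num)]; norm_num
  rw [mul_pow, h7, h5] at h4
  linarith

/-- Far from the real axis a vertical strip lies in the sector `|arg s| ≤ 3π/4`, and so does its
image under `s ↦ -s`. Stirling's formula is therefore available for Gamma functions of `λs` and of
`-λs` at the same time. -/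
lemma tendsto_stripAtInf_sectorAtInf (A B : ℝ) :
    Tendsto (fun s : ℂ => s) (stripAtInf A B) (sectorAtInf (Real.pi / 4)) := by
  have h1 : Tendsto (fun s : ℂ => |s.im|) (stripAtInf A B) atTop :=
    tendsto_comap.mono_left inf_le_left
  refine tendsto_inf.2 ⟨tendsto_comap_iff.2 ?_, tendsto_principal.2 ?_⟩
  · exact tendsto_atTop_mono (fun s => Complex.abs_im_le_norm s) h1
  · rw [eventually_stripAtInf]
    refine ⟨max 1 (max |A| |B|), fun s hs h2 h3 => abs_arg_le_of_abs_re_le ?_ ?_⟩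
    · rintro rfl
      simp at hs
      linarith [hs.1]
    · exact (abs_le_max_abs_abs h2 h3).trans ((le_max_right _ _).trans hs)

lemma tendsto_neg_stripAtInf (A B : ℝ) :
    Tendsto (fun s : ℂ => -s) (stripAtInf A B) (stripAtInf (-B) (-A)) := by
  refine tendsto_inf.2 ⟨tendsto_comap_iff.2 ?_, tendsto_principal.2 ?_⟩
  · have h1 : Tendsto (fun s : ℂ => |s.im|) (stripAtInf A B) atTop :=
      tendsto_comap.mono_left inf_le_left
    exact h1.congr fun s => by simp
  · rw [eventually_stripAtInf]
    exact ⟨0, fun s _ h1 h2 => ⟨by simpa using h2, by simpa using h1⟩⟩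

lemma tendsto_mul_stripAtInf_sectorAtInf {A B r : ℝ} (hr : 0 < r) :
    Tendsto (fun s : ℂ => (r : ℂ) * s) (stripAtInf A B) (sectorAtInf (Real.pi / 4)) :=
  (tendsto_mul_sectorAtInf hr _).comp (tendsto_stripAtInf_sectorAtInf A B)

lemma tendsto_neg_mul_stripAtInf_sectorAtInf {A B r : ℝ} (hr : 0 < r) :
    Tendsto (fun s : ℂ => (-r : ℂ) * s) (stripAtInf A B) (sectorAtInf (Real.pi / 4)) :=
  ((tendsto_mul_stripAtInf_sectorAtInf hr).comp (tendsto_neg_stripAtInf A B)).congr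
    fun s => by simp

lemma tendsto_inv_stripAtInf (A B : ℝ) :
    Tendsto (fun s : ℂ => s⁻¹) (stripAtInf A B) (𝓝 0) :=
  (tendsto_inv_sectorAtInf _).comp (tendsto_stripAtInf_sectorAtInf A B)

/-- Jordan's inequality gives `π/2 - |arg s| ≤ (π/2) cos (arg s)`, and multiplying by `‖s‖` turns
the cosine into `Re s`. The exponential decay of `Γ` thus has rate `π/2` up to a bounded factor in a
strip. -/
lemma pi_div_two_sub_le_mul_arg {s : ℂ} :
    Real.pi / 2 * |s.im| - Real.pi / 2 * |s.re| ≤ s.im * s.arg := by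
  have hπ := Real.pi_pos
  have h0 : s.im * s.arg = |s.im| * |s.arg| := by
    rw [← abs_mul, abs_of_nonneg]
    rcases le_or_gt 0 s.im with h | h
    · exact mul_nonneg h (Complex.arg_nonneg_iff.2 h)
    · exact mul_nonneg_of_nonpos_of_nonpos h.le (Complex.arg_neg_iff.2 h).le
  rw [h0]
  rcases le_or_gt (Real.pi / 2) |s.arg| with h | h
  · have := abs_nonneg s.re
    have := abs_nonneg s.im
    nlinarith
  · have h1 := Real.mul_le_sin (x := Real.pi / 2 - |s.arg|) (by linarith)
      (by linarith [abs_nonneg s.arg])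
    rw [Real.sin_pi_div_two_sub, Real.cos_abs] at h1
    have h2 := Complex.norm_mul_cos_arg s
    have h3 : |s.im| * (Real.pi / 2 - |s.arg|) ≤ ‖s‖ * (Real.pi / 2 - |s.arg|) :=
      mul_le_mul_of_nonneg_right (Complex.abs_im_le_norm s) (by linarith)
    have h4 : ‖s‖ * (2 / Real.pi * (Real.pi / 2 - |s.arg|)) ≤ s.re := by
      rw [← h2]
      exact mul_le_mul_of_nonneg_left h1 (norm_nonneg s)
    have h5 : ‖s‖ * (Real.pi / 2 - |s.arg|) ≤ Real.pi / 2 * s.re := by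
      have : ‖s‖ * (Real.pi / 2 - |s.arg|) =
        Real.pi / 2 * (‖s‖ * (2 / Real.pi * (Real.pi / 2 - |s.arg|))) := by field_simp
      rw [this]
      gcongr
    have h6 := le_abs_self s.re
    nlinarith

/-- The decay of the Gamma function in vertical strips. -/
theorem exists_norm_Gamma_le (A B : ℝ) :
    ∃ C T : ℝ, 0 < C ∧ 1 ≤ T ∧ ∀ s : ℂ, T ≤ |s.im| → A ≤ s.re → s.re ≤ B →
      ‖Complex.Gamma s‖ ≤ C * |s.im| ^ (s.re - 1 / 2) * Real.exp (-(Real.pi / 2 * |s.im|)) := by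
  have hlim : Tendsto (fun s : ℂ => ‖stirlingQuotient 0 s‖) (stripAtInf A B) (𝓝 1) := by
    have := ((hasJet_stirlingQuotient 0 (by positivity : 0 < Real.pi / 4)).tendsto
      (tendsto_inv_sectorAtInf _)).comp (tendsto_stripAtInf_sectorAtInf A B)
    simpa using this.norm
  obtain ⟨T, hT⟩ := eventually_stripAtInf.1 (hlim.eventually_le_const (show (1 : ℝ) < 2 by norm_num))
  set m := max |A| |B| with hm
  set c := (m + 1) * Real.log 2 + Real.pi / 2 * m + m with hc
  refine ⟨Real.sqrt (2 * Real.pi) * 2 * Real.exp c, max 1 (max T m), by positivity,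
    le_max_left _ _, fun s hs hA hB => ?_⟩
  have h1 : 1 ≤ |s.im| := (le_max_left _ _).trans hs
  have hTs : T ≤ |s.im| := ((le_max_left _ _).trans (le_max_right _ _)).trans hs
  have hms : m ≤ |s.im| := ((le_max_right _ _).trans (le_max_right _ _)).trans hs
  have hre : |s.re| ≤ m := abs_le_max_abs_abs hA hB
  have him : 0 < |s.im| := by linarith
  have hE := hT s hTs hA hB
  have hG := Gamma_eq_stirlingQuotient 0 s
  rw [add_zero] at hG
  rw [hG, norm_mul, norm_mul, Complex.norm_real, Real.norm_of_nonneg (Real.sqrt_nonneg _),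
    Complex.norm_exp]
  have hexp : ((s - 1 / 2) * Complex.log s - s).re ≤
      c + Real.log |s.im| * (s.re - 1 / 2) + -(Real.pi / 2 * |s.im|) := by
    have e1 : ((s - 1 / 2) * Complex.log s - s).re =
        (s.re - 1 / 2) * Real.log ‖s‖ - s.im * s.arg - s.re := by
      simp [Complex.log_re, Complex.log_im, Complex.mul_re]
    have hn1 : |s.im| ≤ ‖s‖ := Complex.abs_im_le_norm s
    have hn2 : ‖s‖ ≤ 2 * |s.im| := by
      have := Complex.norm_le_abs_re_add_abs_im s
      linarith
    have l1 : Real.log |s.im| ≤ Real.log ‖s‖ := Real.log_le_log him hn1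
    have l2 : Real.log ‖s‖ ≤ Real.log 2 + Real.log |s.im| := by
      rw [← Real.log_mul (by norm_num) him.ne']
      exact Real.log_le_log (by linarith) hn2
    have e2 : (s.re - 1 / 2) * (Real.log ‖s‖ - Real.log |s.im|) ≤ (m + 1) * Real.log 2 := by
      have : s.re - 1 / 2 ≤ m + 1 := by linarith [le_abs_self s.re]
      have h0 : 0 ≤ m + 1 := by linarith [abs_nonneg s.re]
      calc (s.re - 1 / 2) * (Real.log ‖s‖ - Real.log |s.im|)
          ≤ (m + 1) * (Real.log ‖s‖ - Real.log |s.im|) := by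
            apply mul_le_mul_of_nonneg_right this; linarith
        _ ≤ (m + 1) * Real.log 2 := by apply mul_le_mul_of_nonneg_left _ h0; linarith
    have e3 := pi_div_two_sub_le_mul_arg (s := s)
    have e4 : Real.pi / 2 * |s.re| ≤ Real.pi / 2 * m := by gcongr
    rw [e1, hc]
    linarith [neg_abs_le s.re]
  rw [Real.rpow_def_of_pos him]
  calc Real.sqrt (2 * Real.pi) * Real.exp ((s - 1 / 2) * Complex.log s - s).re *
        ‖stirlingQuotient 0 s‖
      ≤ Real.sqrt (2 * Real.pi) * Real.exp (c + Real.log |s.im| * (s.re - 1 / 2) +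
        -(Real.pi / 2 * |s.im|)) * 2 := by gcongr
    _ = _ := by rw [Real.exp_add, Real.exp_add]; ring

lemma continuous_Gamma_vertical {c : ℝ} (hc : 0 < c) :
    Continuous fun t : ℝ => Complex.Gamma (c + t * Complex.I) := by
  refine continuous_iff_continuousAt.2 fun t => ?_
  have h1 : ContinuousAt Complex.Gamma (c + t * Complex.I) :=
    (Complex.differentiableAt_Gamma _ fun m h => by
      have := congrArg Complex.re h
      simp at this
      have : (0 : ℝ) ≤ m := Nat.cast_nonneg m
      linarith).continuousAt
  have h2 : ContinuousAt (fun t : ℝ => (c + t * Complex.I : ℂ)) t := by fun_prop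
  exact ContinuousAt.comp (f := fun t : ℝ => (c + t * Complex.I : ℂ)) (x := t) h1 h2

lemma norm_Gamma_vertical_le {c : ℝ} (hc : 0 < c) {η : ℝ} (hη : η < Real.pi / 2) :
    ∃ C : ℝ, 0 < C ∧ ∀ t : ℝ, ‖Complex.Gamma (c + t * Complex.I)‖ ≤ C * Real.exp (-(η * |t|)) := by
  obtain ⟨C, T, hC, hT, h⟩ := exists_norm_Gamma_le c c
  -- polynomial growth is absorbed by the exponential
  have hlim : Tendsto (fun x : ℝ => x ^ (c - 1 / 2) * Real.exp (-(Real.pi / 2 - η) * x)) atTop (𝓝 0) :=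
    tendsto_rpow_mul_exp_neg_mul_atTop_nhds_zero _ _ (by linarith)
  obtain ⟨T', hT'⟩ := eventually_atTop.1 (hlim.eventually_le_const one_pos)
  obtain ⟨D, hD⟩ := (isCompact_Icc (a := -max T T') (b := max T T')).exists_bound_of_continuousOn
    ((continuous_Gamma_vertical hc).mul
      (show Continuous fun t : ℝ => ((Real.exp (η * |t|) : ℝ) : ℂ) by fun_prop)).continuousOn
  have hD0 : 0 ≤ D := (norm_nonneg _).trans (hD 0 ⟨by simp; left; linarith, by simp; left; linarith⟩)
  refine ⟨C + D, by linarith, fun t => ?_⟩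
  rcases le_or_gt |t| (max T T') with ht | ht
  · have h1 : ‖Complex.Gamma (c + t * Complex.I) * ((Real.exp (η * |t|) : ℝ) : ℂ)‖ ≤ D :=
      hD t (abs_le.1 ht)
    rw [norm_mul, Complex.norm_real, Real.norm_of_nonneg (Real.exp_nonneg _)] at h1
    rw [Real.exp_neg, ← div_eq_mul_inv, le_div_iff₀ (Real.exp_pos _)]
    linarith
  · have h1 := h (c + t * Complex.I) (by simpa using (le_max_left _ _).trans ht.le)
      (by simp) (by simp)
    simp at h1
    have h2 := hT' |t| ((le_max_right _ _).trans ht.le)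
    have h3 : |t| ^ (c - 1 / 2) * Real.exp (-(Real.pi / 2 * |t|)) ≤ Real.exp (-(η * |t|)) := by
      have : Real.exp (-(Real.pi / 2 * |t|)) =
          Real.exp (-(Real.pi / 2 - η) * |t|) * Real.exp (-(η * |t|)) := by
        rw [← Real.exp_add]; congr 1; ring
      rw [this, ← mul_assoc]
      exact mul_le_of_le_one_left (Real.exp_nonneg _) h2
    norm_num at h1 h3 ⊢
    calc _ ≤ _ := h1
      _ = C * (|t| ^ (c - 1 / 2) * Real.exp (-(Real.pi / 2 * |t|))) := by norm_num; ring
      _ ≤ C * Real.exp (-(η * |t|)) := by norm_num; gcongr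
      _ ≤ (C + D) * Real.exp (-(η * |t|)) := by gcongr; linarith

/-! ### The inverse Mellin transform of the exponential -/

lemma integrable_exp_neg_mul_abs {ε : ℝ} (hε : 0 < ε) :
    Integrable fun t : ℝ => Real.exp (-(ε * |t|)) := by
  rw [← integrableOn_univ, ← Set.Iic_union_Ioi (a := (0 : ℝ)), integrableOn_union]
  constructor
  · refine (integrableOn_exp_mul_Iic hε 0).congr_fun (fun t ht => ?_) measurableSet_Iic
    have : |t| = -t := abs_of_nonpos ht
    simp [this]
  · refine (integrableOn_exp_mul_Ioi (neg_lt_zero.2 hε) 0).congr_fun (fun t ht => ?_)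
      measurableSet_Ioi
    have : |t| = t := abs_of_pos ht
    simp [this]

/-- The constants do not depend on `L` as long as `|Im L| ≤ β`. This uniformity is what permits
differentiation under the integral sign. -/
lemma norm_Gamma_mul_exp_le {c β : ℝ} (hc : 0 < c) (hβ : β < Real.pi / 2) :
    ∃ C ε : ℝ, 0 < C ∧ 0 < ε ∧ ∀ L : ℂ, |L.im| ≤ β → ∀ t : ℝ,
      ‖Complex.Gamma (c + t * Complex.I) * Complex.exp (-(c + t * Complex.I) * L)‖ ≤
        C * Real.exp (-(c * L.re)) * Real.exp (-(ε * |t|)) := by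
  obtain ⟨C, hC, h⟩ := norm_Gamma_vertical_le hc (η := (β + Real.pi / 2) / 2) (by linarith)
  refine ⟨C, (Real.pi / 2 - β) / 2, hC, by linarith, fun L hL t => ?_⟩
  rw [norm_mul, Complex.norm_exp]
  have h1 : (-(c + t * Complex.I) * L).re = -(c * L.re) + t * L.im := by simp
  have h2 : t * L.im ≤ |t| * β :=
    (le_abs_self _).trans (by rw [abs_mul]; gcongr)
  rw [h1]
  calc _ ≤ (C * Real.exp (-((β + Real.pi / 2) / 2 * |t|))) *
        Real.exp (-(c * L.re) + |t| * β) := by gcongr; exact h t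
    _ = _ := by
      rw [mul_assoc, mul_assoc, ← Real.exp_add, ← Real.exp_add]
      congr 2
      ring

lemma integrable_Gamma_mul_exp {c : ℝ} (hc : 0 < c) {L : ℂ} (hL : |L.im| < Real.pi / 2) :
    Integrable fun t : ℝ =>
      Complex.Gamma (c + t * Complex.I) * Complex.exp (-(c + t * Complex.I) * L) := by
  obtain ⟨C, ε, -, hε, h⟩ := norm_Gamma_mul_exp_le hc hL
  refine ((integrable_exp_neg_mul_abs hε).const_mul (C * Real.exp (-(c * L.re)))).mono' ?_
    (Eventually.of_forall fun t => h L le_rfl t)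
  exact ((continuous_Gamma_vertical hc).mul (by fun_prop)).aestronglyMeasurable

/-- Mellin inversion for `exp (-y)`, whose Mellin transform is `Γ`, at the point `y = exp x`. -/
lemma integral_Gamma_mul_exp_ofReal {c : ℝ} (hc : 0 < c) (x : ℝ) :
    ∫ t : ℝ, Complex.Gamma (c + t * Complex.I) * Complex.exp (-(c + t * Complex.I) * x) =
      2 * Real.pi * Complex.exp (-Complex.exp x) := by
  set f : ℝ → ℂ := fun y => ((Real.exp (-y) : ℝ) : ℂ) with hf
  have hmel : ∀ t : ℝ, mellin f (c + t * Complex.I) = Complex.Gamma (c + t * Complex.I) := by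
    intro t
    rw [hf, ← Complex.GammaIntegral_eq_mellin, Complex.Gamma_eq_integral (by simpa using hc)]
  have hconv : MellinConvergent f c := by
    have := Complex.GammaIntegral_convergent (s := c) (by simpa using hc)
    refine this.congr_fun (fun t _ => ?_) measurableSet_Ioi
    simp [hf, mul_comm]
  have hvert : Complex.VerticalIntegrable (mellin f) c := by
    unfold Complex.VerticalIntegrable
    simp_rw [hmel]
    have := integrable_Gamma_mul_exp hc (L := 0) (by simp [Real.pi_pos])
    simpa using this
  have h := mellinInv_mellin_eq c f (Real.exp_pos x) hconv hvert (by
    have : Continuous f := by fun_prop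
    exact this.continuousAt)
  rw [mellinInv] at h
  have hint : ∀ t : ℝ, ((Real.exp x : ℝ) : ℂ) ^ (-(c + t * Complex.I : ℂ)) •
      mellin f (c + t * Complex.I) =
      Complex.Gamma (c + t * Complex.I) * Complex.exp (-(c + t * Complex.I) * x) := by
    intro t
    rw [hmel, smul_eq_mul, Complex.cpow_def_of_ne_zero (by
      rw [Complex.ofReal_ne_zero]; exact (Real.exp_pos x).ne'), ← Complex.ofReal_log
      (Real.exp_pos x).le, Real.log_exp, mul_comm]
    congr 2
    ring
  simp_rw [hint] at h
  have hpi : (2 * Real.pi : ℂ) ≠ 0 := by exact_mod_cast (by positivity : 2 * Real.pi ≠ 0)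
  rw [hf] at h
  have h2 : (2 * Real.pi : ℂ) * ((1 / (2 * Real.pi) : ℝ) • ∫ t : ℝ,
      Complex.Gamma (c + t * Complex.I) * Complex.exp (-(c + t * Complex.I) * x)) =
      2 * Real.pi * Complex.exp (-Complex.exp x) := by
    rw [h]; push_cast; rfl
  have h3 : (2 * Real.pi : ℂ) * ((1 / (2 * Real.pi) : ℝ) : ℂ) = 1 := by
    push_cast; field_simp
  rw [← h2, Complex.real_smul, ← mul_assoc, h3, one_mul]

/-- Both sides are holomorphic in the strip `|Im L| < π/2` and agree for real `L`, so the identity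
theorem applies. The points `1/(n+1)`, accumulating at 0, are enough. -/
theorem integral_Gamma_mul_exp {c : ℝ} (hc : 0 < c) {L : ℂ} (hL : |L.im| < Real.pi / 2) :
    ∫ t : ℝ, Complex.Gamma (c + t * Complex.I) * Complex.exp (-(c + t * Complex.I) * L) =
      2 * Real.pi * Complex.exp (-Complex.exp L) := by
  set U : Set ℂ := {L | |L.im| < Real.pi / 2} with hU
  have hUo : IsOpen U := isOpen_lt (by fun_prop) continuous_const
  have hUc : IsPreconnected U := by
    have : U = Complex.im ⁻¹' (Set.Ioo (-(Real.pi / 2)) (Real.pi / 2)) := by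
      ext z; simp [hU, abs_lt]
    rw [this]
    exact ((convex_Ioo _ _).linear_preimage Complex.imLm).isPreconnected
  set G : ℂ → ℂ := fun L => ∫ t : ℝ,
    Complex.Gamma (c + t * Complex.I) * Complex.exp (-(c + t * Complex.I) * L) with hG
  have hdiff : DifferentiableOn ℂ G U := by
    intro L0 hL0
    have hL0' : |L0.im| < Real.pi / 2 := hL0
    set ρ := (Real.pi / 2 - |L0.im|) / 2 with hρ
    have hρ0 : 0 < ρ := by linarith
    have hball : ∀ L ∈ Metric.ball L0 ρ, |L.im| ≤ |L0.im| + ρ ∧ L0.re - ρ ≤ L.re := by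
      intro L hL
      have h1 : ‖L - L0‖ < ρ := by simpa [dist_eq_norm] using hL
      have h2 := (Complex.abs_im_le_norm (L - L0)).trans h1.le
      have h3 := (Complex.abs_re_le_norm (L - L0)).trans h1.le
      rw [Complex.sub_im] at h2
      rw [Complex.sub_re] at h3
      constructor
      · have := abs_sub_abs_le_abs_sub L.im L0.im
        linarith
      · linarith [(abs_le.1 h3).1]
    obtain ⟨C, ε, hC, hε, h⟩ := norm_Gamma_mul_exp_le hc (β := |L0.im| + ρ) (by linarith)
    have key := hasDerivAt_integral_of_dominated_loc_of_deriv_le (μ := volume) (𝕜 := ℂ)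
      (F := fun L (t : ℝ) => Complex.Gamma (c + t * Complex.I) *
        Complex.exp (-(c + t * Complex.I) * L))
      (F' := fun L (t : ℝ) => Complex.Gamma (c + t * Complex.I) *
        (Complex.exp (-(c + t * Complex.I) * L) * -(c + t * Complex.I)))
      (bound := fun t => (c + 2 / ε) * (C * Real.exp (-(c * (L0.re - ρ)))) *
        Real.exp (-(ε / 2 * |t|)))
      (x₀ := L0) (s := Metric.ball L0 ρ) (Metric.ball_mem_nhds _ hρ0) ?_ ?_ ?_ ?_ ?_ ?_
    · exact key.2.differentiableAt.differentiableWithinAt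
    · exact Eventually.of_forall fun L =>
        ((continuous_Gamma_vertical hc).mul (by fun_prop)).aestronglyMeasurable
    · exact integrable_Gamma_mul_exp hc hL0'
    · exact ((continuous_Gamma_vertical hc).mul (by fun_prop)).aestronglyMeasurable
    · refine Eventually.of_forall fun t L hL => ?_
      obtain ⟨h1, h2⟩ := hball L hL
      have h3 := h L h1 t
      have h4 : ‖-(c + t * Complex.I : ℂ)‖ ≤ (c + 2 / ε) * Real.exp (ε / 2 * |t|) := by
        rw [norm_neg]
        have e1 : ‖(c + t * Complex.I : ℂ)‖ ≤ c + |t| := by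
          refine (norm_add_le _ _).trans ?_
          simp [abs_of_pos hc]
        have e2 : 1 ≤ Real.exp (ε / 2 * |t|) := Real.one_le_exp (by positivity)
        have e3 : |t| ≤ 2 / ε * Real.exp (ε / 2 * |t|) := by
          have := Real.add_one_le_exp (ε / 2 * |t|)
          rw [div_mul_eq_mul_div, le_div_iff₀ hε]
          linarith
        nlinarith
      rw [← mul_assoc, norm_mul]
      have h5 : Real.exp (-(c * L.re)) ≤ Real.exp (-(c * (L0.re - ρ))) := by gcongr
      calc _ ≤ (C * Real.exp (-(c * (L0.re - ρ))) * Real.exp (-(ε * |t|))) *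
            ((c + 2 / ε) * Real.exp (ε / 2 * |t|)) := by
            refine mul_le_mul (h3.trans ?_) h4 (norm_nonneg _) (by positivity)
            gcongr
        _ = _ := by
          have : Real.exp (-(ε / 2 * |t|)) = Real.exp (-(ε * |t|)) * Real.exp (ε / 2 * |t|) := by
            rw [← Real.exp_add]; congr 1; ring
          rw [this]; ring
    · exact (integrable_exp_neg_mul_abs (by positivity)).const_mul _
    · refine Eventually.of_forall fun t L _ => ?_
      refine HasDerivAt.const_mul _ ?_
      have := ((hasDerivAt_id L).const_mul (-(c + t * Complex.I : ℂ))).cexp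
      simpa using this
  have h1 : AnalyticOnNhd ℂ G U := hdiff.analyticOnNhd hUo
  have h2 : AnalyticOnNhd ℂ (fun L => 2 * Real.pi * Complex.exp (-Complex.exp L)) U :=
    fun L _ => by fun_prop
  refine AnalyticOnNhd.eqOn_of_preconnected_of_frequently_eq h1 h2 hUc (z₀ := 0)
    (by simp [hU, Real.pi_pos]) ?_ hL
  have hseq : Tendsto (fun n : ℕ => (((n : ℝ) + 1)⁻¹ : ℂ)) atTop (𝓝[≠] 0) := by
    refine tendsto_nhdsWithin_iff.2 ⟨?_, Eventually.of_forall fun n => ?_⟩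
    · have := tendsto_one_div_add_atTop_nhds_zero_nat (𝕜 := ℂ)
      simpa using this
    · simp only [Set.mem_compl_iff, Set.mem_singleton_iff, inv_eq_zero]
      push_cast
      exact Nat.cast_add_one_ne_zero n
  refine hseq.frequently (Frequently.of_forall fun n => ?_)
  have := integral_Gamma_mul_exp_ofReal hc ((n : ℝ) + 1)⁻¹
  push_cast at this
  simpa [hG] using this

/-! ### Mellin representation of exponential sums -/

/-- `∑ A(n) exp (-n e ^ L)` as an inverse Mellin transform of the Dirichlet series. -/
theorem hasSum_integral_LSeries_mul_Gamma {A : ℕ → ℂ} {c : ℝ} (hc : 0 < c) (hA : LSeriesSummable A c) {L : ℂ}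
    (hL : |L.im| < Real.pi / 2) :
    Integrable (fun t : ℝ => LSeries A (c + t * Complex.I) *
      (Complex.Gamma (c + t * Complex.I) * Complex.exp (-(c + t * Complex.I) * L))) ∧
    HasSum (fun n : ℕ => 2 * Real.pi * (A (n + 1) * Complex.exp (-((n + 1 : ℕ) * Complex.exp L))))
      (∫ t : ℝ, LSeries A (c + t * Complex.I) *
      (Complex.Gamma (c + t * Complex.I) * Complex.exp (-(c + t * Complex.I) * L))) := by
  set g : ℝ → ℂ := fun t => Complex.Gamma (c + t * Complex.I) *
    Complex.exp (-(c + t * Complex.I) * L) with hg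
  have hgi : Integrable g := integrable_Gamma_mul_exp hc hL
  have hterm : ∀ (n : ℕ) (t : ℝ), LSeries.term A (c + t * Complex.I) (n + 1) =
      A (n + 1) * Complex.exp (-(c + t * Complex.I) * Real.log (n + 1 : ℕ)) := by
    intro n t
    have hne : ((n + 1 : ℕ) : ℂ) ≠ 0 := Nat.cast_ne_zero.2 (Nat.succ_ne_zero n)
    rw [LSeries.term_of_ne_zero (Nat.succ_ne_zero n), Complex.cpow_def_of_ne_zero hne,
      ← Complex.natCast_log, div_eq_mul_inv, ← Complex.exp_neg]
    congr 2
    ring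
  have hnorm : ∀ (n : ℕ) (t : ℝ), ‖LSeries.term A (c + t * Complex.I) (n + 1)‖ =
      ‖LSeries.term A c (n + 1)‖ := by
    intro n t
    rw [LSeries.norm_term_eq, LSeries.norm_term_eq]
    simp
  have hs : Summable fun n : ℕ => ‖LSeries.term A c (n + 1)‖ :=
    ((summable_nat_add_iff 1).2 hA).norm
  have hL_eq : ∀ t : ℝ, LSeries A (c + t * Complex.I) =
      ∑' n : ℕ, LSeries.term A (c + t * Complex.I) (n + 1) := by
    intro t
    have hsum : Summable (LSeries.term A (c + t * Complex.I)) := by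
      refine (summable_nat_add_iff 1).1 (Summable.of_norm ?_)
      simpa only [hnorm] using hs
    rw [LSeries, hsum.tsum_eq_zero_add]
    simp
  have hcont : ∀ n : ℕ, Continuous fun t : ℝ => LSeries.term A (c + t * Complex.I) (n + 1) := by
    intro n
    simp_rw [hterm]
    fun_prop
  have hFint : ∀ n : ℕ, Integrable fun t : ℝ => LSeries.term A (c + t * Complex.I) (n + 1) * g t := by
    intro n
    refine hgi.bdd_mul (c := ‖LSeries.term A c (n + 1)‖) (hcont n).aestronglyMeasurable
      (Eventually.of_forall fun t => (hnorm n t).le)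
  have hFn : ∀ n : ℕ, ∫ t : ℝ, ‖LSeries.term A (c + t * Complex.I) (n + 1) * g t‖ =
      ‖LSeries.term A c (n + 1)‖ * ∫ t, ‖g t‖ := by
    intro n
    simp_rw [norm_mul, hnorm]
    rw [integral_const_mul]
  have key := hasSum_integral_of_summable_integral_norm (μ := volume) hFint (by
    simp_rw [hFn]
    exact hs.mul_right _)
  have htsum : ∀ t : ℝ, ∑' n : ℕ, LSeries.term A (c + t * Complex.I) (n + 1) * g t =
      LSeries A (c + t * Complex.I) * g t := fun t => by rw [tsum_mul_right, hL_eq]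
  simp_rw [htsum] at key
  refine ⟨?_, ?_⟩
  · refine hgi.bdd_mul (c := ∑' n : ℕ, ‖LSeries.term A c (n + 1)‖) ?_
      (Eventually.of_forall fun t => ?_)
    · have : Continuous fun t : ℝ => LSeries A (c + t * Complex.I) := by
        simp_rw [hL_eq]
        exact continuous_tsum hcont hs fun n t => (hnorm n t).le
      exact this.aestronglyMeasurable
    · rw [hL_eq]
      refine (norm_tsum_le_tsum_norm ?_).trans (le_of_eq ?_)
      · simpa only [hnorm] using hs
      · simp only [hnorm]
  · convert! key using 1
    funext n
    have him : |(L + Real.log (n + 1 : ℕ)).im| < Real.pi / 2 := by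
      rw [Complex.add_im, Complex.ofReal_im, add_zero]; exact hL
    have h1 := integral_Gamma_mul_exp hc him
    have h2 : Complex.exp (L + Real.log (n + 1 : ℕ)) = (n + 1 : ℕ) * Complex.exp L := by
      rw [Complex.exp_add, ← Complex.ofReal_exp, Real.exp_log (by positivity), mul_comm]
      simp
    rw [h2] at h1
    have h3 : ∀ t : ℝ, LSeries.term A (c + t * Complex.I) (n + 1) * g t = A (n + 1) *
        (Complex.Gamma (c + t * Complex.I) *
          Complex.exp (-(c + t * Complex.I) * (L + Real.log (n + 1 : ℕ)))) := by
      intro t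
      rw [hterm, hg, mul_add, Complex.exp_add]
      ring
    simp_rw [h3]
    rw [integral_const_mul, h1]
    ring

/-! ### Shifting vertical lines in half strips -/

/-- Cauchy's theorem on a rectangle whose top edge recedes to infinity. Only a half strip is used,
so that the poles of the integrand near the real axis are never met. The bottom edge survives as an
extra term. -/
lemma integral_shift_upper {Φ : ℂ → ℂ} {a b T : ℝ} (hab : a ≤ b)
    (hd : ∀ s : ℂ, a ≤ s.re → s.re ≤ b → T ≤ s.im → DifferentiableAt ℂ Φ s)
    (ha : IntegrableOn (fun t : ℝ => Φ (a + t * Complex.I)) (Set.Ioi T))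
    (hb : IntegrableOn (fun t : ℝ => Φ (b + t * Complex.I)) (Set.Ioi T))
    {g : ℝ → ℝ} (hg : Tendsto g atTop (𝓝 0))
    (hΦ : ∀ᶠ t : ℝ in atTop, ∀ x : ℝ, a ≤ x → x ≤ b → ‖Φ (x + t * Complex.I)‖ ≤ g t) :
    ∫ t in Set.Ioi T, Φ (b + t * Complex.I) = (∫ t in Set.Ioi T, Φ (a + t * Complex.I)) +
      Complex.I * ∫ x in a..b, Φ (x + T * Complex.I) := by
  have hrect : ∀ U : ℝ, T ≤ U → (∫ x : ℝ in a..b, Φ (x + T * Complex.I)) -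
      (∫ x : ℝ in a..b, Φ (x + U * Complex.I)) +
      Complex.I * (∫ y : ℝ in T..U, Φ (b + y * Complex.I)) -
      Complex.I * (∫ y : ℝ in T..U, Φ (a + y * Complex.I)) = 0 := by
    intro U hU
    have := Complex.integral_boundary_rect_eq_zero_of_differentiableOn Φ
      (a + T * Complex.I) (b + U * Complex.I) (fun s hs => by
        have h1 : s.re ∈ Set.uIcc a b := by simpa using hs.1
        have h2 : s.im ∈ Set.uIcc T U := by simpa using hs.2
        rw [Set.uIcc_of_le hab] at h1
        rw [Set.uIcc_of_le hU] at h2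
        exact (hd s h1.1 h1.2 h2.1).differentiableWithinAt)
    simpa using this
  have h1 := intervalIntegral_tendsto_integral_Ioi T hb tendsto_id
  have h2 := intervalIntegral_tendsto_integral_Ioi T ha tendsto_id
  have h3 : Tendsto (fun U : ℝ => ∫ x : ℝ in a..b, Φ (x + U * Complex.I)) atTop (𝓝 0) := by
    refine squeeze_zero_norm' (a := fun U => g U * |b - a|) ?_ (by simpa using hg.mul_const |b - a|)
    filter_upwards [hΦ] with U hU
    refine intervalIntegral.norm_integral_le_of_norm_le_const fun x hx => ?_
    rw [Set.uIoc_of_le hab] at hx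
    exact hU x hx.1.le hx.2
  have h4 := ((tendsto_const_nhds (x := ∫ x : ℝ in a..b, Φ (x + T * Complex.I))).sub h3).add
    ((h1.sub h2).const_mul Complex.I)
  have h5 := tendsto_nhds_unique (h4.congr' (f₂ := fun _ => 0) (by
    filter_upwards [eventually_ge_atTop T] with U hU
    rw [← hrect U hU]
    simp only [id]
    ring)) tendsto_const_nhds
  rw [sub_zero] at h5
  linear_combination (-Complex.I) * h5 + (∫ t in Set.Ioi T, Φ (b + t * Complex.I)) * Complex.I_sq -
    (∫ t in Set.Ioi T, Φ (a + t * Complex.I)) * Complex.I_sq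

/-- The reflection `s ↦ a + b - s` carries this to the upper half strip and exchanges the two
vertical lines. -/
lemma integral_shift_lower {Φ : ℂ → ℂ} {a b T : ℝ} (hab : a ≤ b)
    (hd : ∀ s : ℂ, a ≤ s.re → s.re ≤ b → s.im ≤ -T → DifferentiableAt ℂ Φ s)
    (ha : IntegrableOn (fun t : ℝ => Φ (a - t * Complex.I)) (Set.Ioi T))
    (hb : IntegrableOn (fun t : ℝ => Φ (b - t * Complex.I)) (Set.Ioi T))
    {g : ℝ → ℝ} (hg : Tendsto g atTop (𝓝 0))
    (hΦ : ∀ᶠ t : ℝ in atTop, ∀ x : ℝ, a ≤ x → x ≤ b → ‖Φ (x - t * Complex.I)‖ ≤ g t) :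
    ∫ t in Set.Ioi T, Φ (b - t * Complex.I) = (∫ t in Set.Ioi T, Φ (a - t * Complex.I)) -
      Complex.I * ∫ x in a..b, Φ (x - T * Complex.I) := by
  have e1 : ∀ t : ℝ, (a + b : ℂ) - (a + t * Complex.I) = b - t * Complex.I := fun t => by ring
  have e2 : ∀ t : ℝ, (a + b : ℂ) - (b + t * Complex.I) = a - t * Complex.I := fun t => by ring
  have key := integral_shift_upper (Φ := fun s => Φ (a + b - s)) (a := a) (b := b) (T := T) hab
    (fun s h1 h2 h3 => by
      have := hd (a + b - s) (by simp; linarith) (by simp; linarith) (by simp; linarith)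
      exact this.comp s (f := fun s : ℂ => (a + b - s : ℂ)) (by fun_prop))
    (by simpa only [e1] using hb) (by simpa only [e2] using ha) hg (by
      filter_upwards [hΦ] with t ht x hx1 hx2
      have := ht (a + b - x) (by linarith) (by linarith)
      convert! this using 3
      push_cast; ring)
  simp only [e1, e2] at key
  have h3 : ∫ x : ℝ in a..b, Φ (a + b - (x + T * Complex.I)) = ∫ x : ℝ in a..b, Φ (x - T * Complex.I) := by
    have := intervalIntegral.integral_comp_sub_left
      (fun x : ℝ => Φ (x - T * Complex.I)) (a + b) (a := a) (b := b)
    rw [show a + b - b = a by ring, show a + b - a = b by ring] at this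
    rw [← this]
    refine intervalIntegral.integral_congr fun x _ => ?_
    congr 1
    push_cast; ring
  rw [h3] at key
  rw [key]; ring

/-! ### The gamma factors of the functional equation -/

namespace GammaFactor

variable (γ : GammaFactor)

/-- The constant of the transformation formula. -/
noncomputable def kappa (ω : ℂ) (ε : ℝ) : ℂ :=
  γ.rootNumber ω * Complex.I *
    Complex.exp (Complex.I * Real.pi * ε * (∑ j, (γ.mu j - 1 / 2) + 1 / 2))

/-- The correction factor in the asymptotic form of the functional equation. -/
noncomputable def feQuotient (s : ℂ) : ℂ :=
  (stirlingQuotient 0 s * ∏ j, stirlingQuotient (γ.lam j + conj (γ.mu j)) (-γ.lam j * s)) *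
    (stirlingQuotient 1 (-1 * s) * ∏ j, stirlingQuotient (γ.mu j) (γ.lam j * s))⁻¹

lemma conj_eval (s : ℂ) : conj (γ.eval (conj (1 - s))) =
    (γ.Q : ℂ) ^ (1 - s) * ∏ j, Complex.Gamma (γ.lam j * (1 - s) + conj (γ.mu j)) := by
  rw [eval, map_mul, map_prod]
  congr 1
  · rw [Complex.cpow_conj _ _ (by
      rw [Complex.arg_ofReal_of_nonneg γ.Q_pos.le]; exact Real.pi_pos.ne), Complex.conj_conj,
      Complex.conj_ofReal]
  · refine Finset.prod_congr rfl fun j _ => ?_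
    rw [← Complex.Gamma_conj]
    simp

/-- The main terms of Stirling's formula cancel exactly, so that `γ` behaves like the single factor
`(2π)^(-s) Γ(s)` up to `feQuotient`. The parameter `ε` is the branch correction in `log (-s)`: it is
`1` below the real axis and `-1` above it. -/
theorem gamma_identity (hdeg : γ.degree = 2) (hcond : γ.conductor = 1) (hθ : γ.theta = 0) (ω : ℂ)
    {ε : ℝ} {s : ℂ} (hs : s ≠ 0)
    (hlog : Complex.log (-s) = Complex.log s + Complex.I * Real.pi * ε)
    (hne : stirlingQuotient 1 (-1 * s) * ∏ j, stirlingQuotient (γ.mu j) (γ.lam j * s) ≠ 0) :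
    Complex.Gamma s * Complex.exp (-s * (Real.log (2 * Real.pi) - Complex.I * (Real.pi / 2))) *
      (ω * conj (γ.eval (conj (1 - s)))) =
    γ.kappa ω ε * γ.feQuotient s * (Complex.Gamma (1 - s) *
      Complex.exp (-(1 - s) * (Real.log (2 * Real.pi) + Complex.I * (Real.pi / 2)))) *
      γ.eval s := by
  set r : ℂ := (Real.sqrt (2 * Real.pi) : ℂ)
  set L := Complex.log s with hL
  have hlam0 : ∀ j, (γ.lam j : ℂ) ≠ 0 := fun j => by exact_mod_cast (γ.lam_pos j).ne'
  have hlam : ∑ j, (γ.lam j : ℂ) = 1 := by exact_mod_cast γ.sum_lam hdeg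
  have hmu : ∑ j, (conj (γ.mu j) - γ.mu j) = 0 := by
    have : ∀ j, conj (γ.mu j) - γ.mu j = ((γ.mu j).im : ℂ) * (-2 * Complex.I) := fun j => by
      rw [← neg_sub, Complex.sub_conj]; push_cast; ring
    rw [Finset.sum_congr rfl fun j _ => this j, ← Finset.sum_mul]
    have h0 : ∑ j, ((γ.mu j).im : ℂ) = 0 := by exact_mod_cast γ.sum_mu_im hdeg hθ
    rw [h0, zero_mul]
  have hlogc : (Real.log γ.Q : ℂ) + ∑ j, (γ.lam j : ℂ) * Real.log (γ.lam j) =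
      -Real.log (2 * Real.pi) := by exact_mod_cast γ.log_conductor hdeg hcond
  have e0 : Complex.Gamma s = r * Complex.exp ((s - 1 / 2) * L - s) * stirlingQuotient 0 s := by
    simpa only [add_zero] using Gamma_eq_stirlingQuotient 0 s
  have e1 : Complex.Gamma (1 - s) = r * Complex.exp ((-s + 1 / 2) * (L + Complex.I * Real.pi * ε) + s) *
      stirlingQuotient 1 (-1 * s) := by
    have := Gamma_eq_stirlingQuotient 1 (-s)
    rw [hlog, show -s + 1 = 1 - s by ring] at this
    rw [this, show (-1 : ℂ) * s = -s by ring]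
    congr 3
    ring
  have e2 : ∀ j, Complex.Gamma (γ.lam j * (1 - s) + conj (γ.mu j)) = r *
      Complex.exp ((-γ.lam j * s + (γ.lam j + conj (γ.mu j)) - 1 / 2) *
        (Real.log (γ.lam j) + (L + Complex.I * Real.pi * ε)) + γ.lam j * s) *
      stirlingQuotient (γ.lam j + conj (γ.mu j)) (-γ.lam j * s) := by
    intro j
    have := Gamma_eq_stirlingQuotient (γ.lam j + conj (γ.mu j)) (γ.lam j * -s)
    rw [γ.log_lam_mul j (neg_ne_zero.2 hs), hlog] at this
    rw [show (γ.lam j : ℂ) * (1 - s) + conj (γ.mu j) =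
      γ.lam j * -s + (γ.lam j + conj (γ.mu j)) by ring, this,
      show (-γ.lam j : ℂ) * s = γ.lam j * -s by ring]
    congr 3
    ring
  have e3 : ∀ j, Complex.Gamma (γ.lam j * s + γ.mu j) = r *
      Complex.exp ((γ.lam j * s + γ.mu j - 1 / 2) * (Real.log (γ.lam j) + L) - γ.lam j * s) *
      stirlingQuotient (γ.mu j) (γ.lam j * s) := by
    intro j
    have := Gamma_eq_stirlingQuotient (γ.mu j) (γ.lam j * s)
    rwa [γ.log_lam_mul j hs] at this
  have hQ : ∀ x : ℂ, (γ.Q : ℂ) ^ x = Complex.exp (x * Real.log γ.Q) := fun x => by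
    rw [Complex.cpow_def_of_ne_zero (by exact_mod_cast γ.Q_pos.ne'),
      ← Complex.ofReal_log γ.Q_pos.le, mul_comm]
  have hI : Complex.I = Complex.exp (Complex.I * (Real.pi / 2)) := by
    rw [mul_comm, Complex.exp_pi_div_two_mul_I]
  rw [γ.conj_eval, eval, e0, e1, Finset.prod_congr rfl fun j _ => e2 j,
    Finset.prod_congr rfl fun j _ => e3 j]
  simp only [Finset.prod_mul_distrib, ← Complex.exp_sum, hQ]
  rw [kappa, γ.rootNumber_eq, feQuotient]
  set N1 := ∏ j, stirlingQuotient (γ.lam j + conj (γ.mu j)) (-γ.lam j * s)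
  set N2 := ∏ j, stirlingQuotient (γ.mu j) (γ.lam j * s)
  have s1 : ∑ j, ((-γ.lam j * s + (γ.lam j + conj (γ.mu j)) - 1 / 2) *
      (Real.log (γ.lam j) + (L + Complex.I * Real.pi * ε)) + γ.lam j * s) =
      (1 - s) * ∑ j, (γ.lam j : ℂ) * Real.log (γ.lam j) +
      ∑ j, (conj (γ.mu j) - 1 / 2) * Real.log (γ.lam j) +
      (-s + 1 + ∑ j, (γ.mu j - 1 / 2)) * (L + Complex.I * Real.pi * ε) + s := by
    have h1 : ∑ j, (conj (γ.mu j) - 1 / 2) = ∑ j, (γ.mu j - 1 / 2) := by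
      rw [← sub_eq_zero, ← Finset.sum_sub_distrib, ← hmu]
      exact Finset.sum_congr rfl fun j _ => by ring
    have h2 : ∀ j, ((-γ.lam j * s + (γ.lam j + conj (γ.mu j)) - 1 / 2) *
      (Real.log (γ.lam j) + (L + Complex.I * Real.pi * ε)) + γ.lam j * s) =
      (1 - s) * ((γ.lam j : ℂ) * Real.log (γ.lam j)) +
      (conj (γ.mu j) - 1 / 2) * Real.log (γ.lam j) +
      γ.lam j * ((-s + 1) * (L + Complex.I * Real.pi * ε) + s) +
      (conj (γ.mu j) - 1 / 2) * (L + Complex.I * Real.pi * ε) := fun j => by ring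
    rw [Finset.sum_congr rfl fun j _ => h2 j, Finset.sum_add_distrib, Finset.sum_add_distrib,
      Finset.sum_add_distrib, ← Finset.mul_sum, ← Finset.sum_mul, ← Finset.sum_mul, hlam, h1]
    ring
  have s2 : ∑ j, ((γ.lam j * s + γ.mu j - 1 / 2) * (Real.log (γ.lam j) + L) - γ.lam j * s) =
      s * ∑ j, (γ.lam j : ℂ) * Real.log (γ.lam j) +
      ∑ j, (γ.mu j - 1 / 2) * Real.log (γ.lam j) +
      (s + ∑ j, (γ.mu j - 1 / 2)) * L - s := by
    have h2 : ∀ j, ((γ.lam j * s + γ.mu j - 1 / 2) * (Real.log (γ.lam j) + L) - γ.lam j * s) =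
      s * ((γ.lam j : ℂ) * Real.log (γ.lam j)) + (γ.mu j - 1 / 2) * Real.log (γ.lam j) +
      γ.lam j * (s * L - s) + (γ.mu j - 1 / 2) * L := fun j => by ring
    rw [Finset.sum_congr rfl fun j _ => h2 j, Finset.sum_add_distrib, Finset.sum_add_distrib,
      Finset.sum_add_distrib, ← Finset.mul_sum, ← Finset.sum_mul, ← Finset.sum_mul, hlam]
    ring
  have s3 : ∑ j, (conj (γ.mu j) - γ.mu j) * Real.log (γ.lam j) =
      ∑ j, (conj (γ.mu j) - 1 / 2) * Real.log (γ.lam j) -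
      ∑ j, (γ.mu j - 1 / 2) * Real.log (γ.lam j) := by
    rw [← Finset.sum_sub_distrib]
    exact Finset.sum_congr rfl fun j _ => by ring
  rw [s1, s2, s3]
  set M := ∑ j, (γ.mu j - 1 / 2)
  set S := ∑ j, (γ.lam j : ℂ) * Real.log (γ.lam j)
  set S1 := ∑ j, (conj (γ.mu j) - 1 / 2) * Real.log (γ.lam j)
  set S2 := ∑ j, (γ.mu j - 1 / 2) * Real.log (γ.lam j)
  set lQ : ℂ := (Real.log γ.Q : ℂ)
  set lp : ℂ := (Real.log (2 * Real.pi) : ℂ)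
  have key : Complex.exp ((s - 1 / 2) * L - s) *
      Complex.exp (-s * (lp - Complex.I * (Real.pi / 2))) * Complex.exp ((1 - s) * lQ) *
      Complex.exp ((1 - s) * S + S1 + (-s + 1 + M) * (L + Complex.I * Real.pi * ε) + s) =
      Complex.exp (S1 - S2) * Complex.I * Complex.exp (Complex.I * Real.pi * ε * (M + 1 / 2)) *
      Complex.exp ((-s + 1 / 2) * (L + Complex.I * Real.pi * ε) + s) *
      Complex.exp (-(1 - s) * (lp + Complex.I * (Real.pi / 2))) * Complex.exp (s * lQ) *
      Complex.exp (s * S + S2 + (s + M) * L - s) := by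
    have : Complex.exp (S1 - S2) * Complex.I = Complex.exp (S1 - S2 + Complex.I * (Real.pi / 2)) := by
      rw [Complex.exp_add, ← hI]
    rw [this]
    simp only [← Complex.exp_add]
    congr 1
    linear_combination (1 - 2 * s) * hlogc
  generalize Complex.exp ((s - 1 / 2) * L - s) = E1 at key ⊢
  generalize Complex.exp (-s * (lp - Complex.I * (Real.pi / 2))) = E2 at key ⊢
  generalize Complex.exp ((1 - s) * lQ) = E3 at key ⊢
  generalize Complex.exp ((1 - s) * S + S1 + (-s + 1 + M) * (L + Complex.I * Real.pi * ε) + s) = E4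
    at key ⊢
  generalize Complex.exp (S1 - S2) = E5 at key ⊢
  generalize Complex.exp (Complex.I * Real.pi * ε * (M + 1 / 2)) = E6 at key ⊢
  generalize Complex.exp ((-s + 1 / 2) * (L + Complex.I * Real.pi * ε) + s) = E7 at key ⊢
  generalize Complex.exp (-(1 - s) * (lp + Complex.I * (Real.pi / 2))) = E8 at key ⊢
  generalize Complex.exp (s * lQ) = E9 at key ⊢
  generalize Complex.exp (s * S + S2 + (s + M) * L - s) = E10 at key ⊢
  have hne1 := left_ne_zero_of_mul hne
  have hne2 := right_ne_zero_of_mul hne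
  generalize stirlingQuotient 1 (-1 * s) = X1 at hne1 ⊢
  generalize stirlingQuotient 0 s = X0
  clear_value N2 N1 r
  generalize (∏ _j : Fin γ.r, r) = R
  field_simp
  linear_combination (r * X0 * ω * R * N1) * key

/-- Only the existence of the coefficient is needed later. Its value never enters. -/
lemma hasJet_feQuotient (A B : ℝ) : ∃ c : ℂ, HasJet (stripAtInf A B) γ.feQuotient c := by
  have hl := tendsto_inv_stripAtInf A B
  have hπ : 0 < Real.pi / 4 := by positivity
  have h0 := (hasJet_stirlingQuotient 0 hπ).comp_mul (m := 1)
      (by simpa using tendsto_stripAtInf_sectorAtInf A B)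
  simp only [one_mul] at h0
  have h1 := (hasJet_stirlingQuotient 1 hπ).comp_mul (m := -1)
    (by simpa using tendsto_neg_mul_stripAtInf_sectorAtInf (A := A) (B := B) one_pos)
  have h2 := fun j => (hasJet_stirlingQuotient (γ.lam j + conj (γ.mu j)) hπ).comp_mul
    (tendsto_neg_mul_stripAtInf_sectorAtInf (A := A) (B := B) (γ.lam_pos j))
  have h3 := fun j => (hasJet_stirlingQuotient (γ.mu j) hπ).comp_mul
    (tendsto_mul_stripAtInf_sectorAtInf (A := A) (B := B) (γ.lam_pos j))
  exact ⟨_, (h0.mul hl (HasJet.prod hl _ fun j _ => h2 j)).mul hl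
    ((h1.mul hl (HasJet.prod hl _ fun j _ => h3 j)).inv hl)⟩

lemma eventually_feQuotient_denom_ne_zero (A B : ℝ) : ∀ᶠ s in stripAtInf A B,
    stirlingQuotient 1 (-1 * s) * ∏ j, stirlingQuotient (γ.mu j) (γ.lam j * s) ≠ 0 := by
  have hl := tendsto_inv_stripAtInf A B
  have hπ : 0 < Real.pi / 4 := by positivity
  have h1 := (hasJet_stirlingQuotient 1 hπ).comp_mul (m := -1)
    (by simpa using tendsto_neg_mul_stripAtInf_sectorAtInf (A := A) (B := B) one_pos)
  have h3 := fun j => (hasJet_stirlingQuotient (γ.mu j) hπ).comp_mul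
    (tendsto_mul_stripAtInf_sectorAtInf (A := A) (B := B) (γ.lam_pos j))
  exact ((h1.mul hl (HasJet.prod hl _ fun j _ => h3 j)).tendsto hl).eventually_ne one_ne_zero

end GammaFactor

/-! ### Dirichlet series -/

lemma norm_LSeries_le {a : ℕ → ℂ} {c : ℝ} (h : LSeriesSummable a c) :
    ∃ C : ℝ, 0 ≤ C ∧ ∀ s : ℂ, c ≤ s.re → ‖LSeries a s‖ ≤ C := by
  refine ⟨∑' n, ‖LSeries.term a c n‖, tsum_nonneg fun n => norm_nonneg _, fun s hs => ?_⟩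
  refine tsum_of_norm_bounded h.norm.hasSum fun n => ?_
  exact LSeries.norm_term_le_of_re_le_re a (by simpa using hs) n

lemma conj_LSeries_conj (a : ℕ → ℂ) (s : ℂ) :
    conj (LSeries a (conj s)) = LSeries (fun n => conj (a n)) s := by
  rw [LSeries, LSeries, Complex.conj_tsum]
  refine tsum_congr fun n => ?_
  rcases eq_or_ne n 0 with rfl | hn
  · simp
  rw [LSeries.term_of_ne_zero hn, LSeries.term_of_ne_zero hn, map_div₀, Complex.cpow_conj _ _ (by
    rw [Complex.natCast_arg]; exact Real.pi_pos.ne), Complex.conj_conj, Complex.conj_natCast]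

lemma lseriesSummable_conj {a : ℕ → ℂ} {s : ℂ} (h : LSeriesSummable a s) :
    LSeriesSummable (fun n => conj (a n)) s := by
  refine summable_norm_iff.1 (h.norm.congr fun n => ?_)
  simp [LSeries.norm_term_eq]

namespace GammaFactor

variable (γ : GammaFactor)

/-- The poles of the `j`-th Gamma factor all lie on the horizontal line `Im s = -Im μ_j / λ_j`. -/
lemma exists_regularAt : ∃ T : ℝ, ∀ s : ℂ, T ≤ |s.im| → γ.RegularAt s := by
  refine ⟨1 + ∑ j, |(γ.mu j).im| / γ.lam j, fun s hs j k h => ?_⟩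
  have h1 : γ.lam j * s.im + (γ.mu j).im = 0 := by simpa using congrArg Complex.im h
  have h2 : |s.im| = |(γ.mu j).im| / γ.lam j := by
    rw [eq_div_iff (γ.lam_pos j).ne', ← abs_neg (γ.mu j).im,
      show -(γ.mu j).im = γ.lam j * s.im by linarith, abs_mul, abs_of_pos (γ.lam_pos j), mul_comm]
  have h3 := Finset.single_le_sum (f := fun j => |(γ.mu j).im| / γ.lam j)
    (fun j _ => div_nonneg (abs_nonneg _) (γ.lam_pos j).le) (Finset.mem_univ j)
  linarith

lemma eval_ne_zero {s : ℂ} (h : γ.RegularAt s) : γ.eval s ≠ 0 := by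
  refine mul_ne_zero ?_ (Finset.prod_ne_zero_iff.2 fun j _ => Complex.Gamma_ne_zero (h j))
  rw [Ne, Complex.cpow_eq_zero_iff]
  exact fun h => γ.Q_pos.ne' (by exact_mod_cast h.1)

end GammaFactor

lemma log_neg_of_im_neg {s : ℂ} (h : s.im < 0) :
    Complex.log (-s) = Complex.log s + Complex.I * Real.pi * (1 : ℝ) := by
  rw [Complex.log, Complex.log, norm_neg, Complex.arg_neg_eq_arg_add_pi_of_im_neg h]
  push_cast; ring

lemma log_neg_of_im_pos {s : ℂ} (h : 0 < s.im) :
    Complex.log (-s) = Complex.log s + Complex.I * Real.pi * (-1 : ℝ) := by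
  rw [Complex.log, Complex.log, norm_neg, Complex.arg_neg_eq_arg_sub_pi_of_im_pos h]
  push_cast; ring

lemma norm_sin_le_exp (z : ℂ) : ‖Complex.sin z‖ ≤ Real.exp |z.im| := by
  rw [Complex.sin, norm_div, norm_mul, Complex.norm_I, mul_one, Complex.norm_ofNat,
    div_le_iff₀ two_pos]
  refine (norm_sub_le _ _).trans ?_
  rw [Complex.norm_exp, Complex.norm_exp]
  have h1 : (-z * Complex.I).re = z.im := by simp
  have h2 : (z * Complex.I).re = -z.im := by simp
  rw [h1, h2, mul_two]
  gcongr
  · exact le_abs_self _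
  · exact neg_le_abs _

/-! ### The asymptotic functional equation and growth in vertical strips -/

namespace IsExtendedSelberg

variable {F : ℂ → ℂ} {a : ℕ → ℂ} {γ : GammaFactor} {ω : ℂ}

lemma differentiableAt (hF : IsExtendedSelberg F a γ ω) {s : ℂ} (hs : s ≠ 1) :
    DifferentiableAt ℂ F s := by
  obtain ⟨m, hm, -⟩ := hF.continuation
  have h1 : DifferentiableAt ℂ (fun s => (s - 1) ^ m * F s / (s - 1) ^ m) s :=
    (hm s).div (by fun_prop) (pow_ne_zero _ (sub_ne_zero.2 hs))
  refine h1.congr_of_eventuallyEq ?_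
  filter_upwards [isOpen_ne.mem_nhds hs] with w hw
  rw [mul_div_cancel_left₀ _ (pow_ne_zero _ (sub_ne_zero.2 hw))]

theorem exists_asymptotic_functional_equation (hF : IsExtendedSelberg F a γ ω)
    (hdeg : γ.degree = 2) (hcond : γ.conductor = 1) (hθ : γ.theta = 0) (A B : ℝ) :
    ∃ T : ℝ, 1 ≤ T ∧ ∀ ε : ℝ, ∀ s : ℂ, T ≤ |s.im| → A ≤ s.re → s.re ≤ B →
      Complex.log (-s) = Complex.log s + Complex.I * Real.pi * ε →
      F s * (Complex.Gamma s *
        Complex.exp (-s * (Real.log (2 * Real.pi) - Complex.I * (Real.pi / 2)))) =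
      γ.kappa ω ε * γ.feQuotient s * (Complex.Gamma (1 - s) *
        Complex.exp (-(1 - s) * (Real.log (2 * Real.pi) + Complex.I * (Real.pi / 2)))) *
        conj (F (conj (1 - s))) := by
  obtain ⟨T₁, h₁⟩ := γ.exists_regularAt
  obtain ⟨T₂, h₂⟩ := eventually_stripAtInf.1 (γ.eventually_feQuotient_denom_ne_zero A B)
  refine ⟨max 1 (max T₁ T₂), le_max_left _ _, fun ε s hs hA hB hlog => ?_⟩
  have him : 1 ≤ |s.im| := (le_max_left _ _).trans hs
  have hr := h₁ s (((le_max_left _ _).trans (le_max_right _ _)).trans hs)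
  have hr' : γ.RegularAt (conj (1 - s)) :=
    h₁ _ (by simpa using ((le_max_left _ _).trans (le_max_right _ _)).trans hs)
  have hs0 : s ≠ 0 := by rintro rfl; norm_num at him
  have hs1 : s ≠ 1 := by rintro rfl; norm_num at him
  have hfe := hF.functional_equation s hs0 hs1 hr hr'
  have hid := γ.gamma_identity hdeg hcond hθ ω hs0 hlog
    (h₂ s (((le_max_right _ _).trans (le_max_right _ _)).trans hs) hA hB)
  refine mul_right_cancel₀ (γ.eval_ne_zero hr) ?_
  linear_combination (Complex.Gamma s * Complex.exp (-s * (Real.log (2 * Real.pi) -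
    Complex.I * (Real.pi / 2)))) * hfe + conj (F (conj (1 - s))) * hid

lemma conj_eq_LSeries (hF : IsExtendedSelberg F a γ ω) {p : ℂ} (hp : 1 < p.re) :
    conj (F (conj p)) = LSeries (fun n => conj (a n)) p := by
  rw [hF.eq_LSeries _ (by simpa using hp), conj_LSeries_conj]

/-- The reflection formula for `Γ` turns the asymptotic functional equation into a formula for
`F(s)` containing `Γ(1-s)² sin(πs)`. The exponentials `e^(-π|t|)` and `e^(π|t|)` cancel and leave
the power `|t|^(3/2)`, bounded here by `t²`. -/
lemma exists_norm_le_left (hF : IsExtendedSelberg F a γ ω)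
    (hdeg : γ.degree = 2) (hcond : γ.conductor = 1) (hθ : γ.theta = 0) :
    ∃ C T : ℝ, 0 ≤ C ∧ 1 ≤ T ∧ ∀ s : ℂ, T ≤ |s.im| → s.re = -1 / 4 → ‖F s‖ ≤ C * s.im ^ 2 := by
  obtain ⟨T₁, hT₁, h₁⟩ := hF.exists_asymptotic_functional_equation hdeg hcond hθ (-1 / 4) (-1 / 4)
  obtain ⟨G, T₂, hG, hT₂, h₂⟩ := exists_norm_Gamma_le (5 / 4) (5 / 4)
  obtain ⟨c, hc⟩ := γ.hasJet_feQuotient (-1 / 4) (-1 / 4)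
  obtain ⟨T₃, h₃⟩ := eventually_stripAtInf.1
    (((hc.tendsto (tendsto_inv_stripAtInf _ _)).norm).eventually_le_const (u := 2) (by simp))
  obtain ⟨D, hD, hD'⟩ := norm_LSeries_le (lseriesSummable_conj (hF.summable ((5 / 4 : ℝ) : ℂ)
    (by rw [Complex.ofReal_re]; norm_num)))
  set K : ℝ := ‖γ.kappa ω 1‖ + ‖γ.kappa ω (-1)‖
  refine ⟨K * 2 * G ^ 2 * D, max T₁ (max T₂ T₃), by positivity,
    hT₁.trans (le_max_left _ _), fun s hs hre => ?_⟩
  have hs1 : T₁ ≤ |s.im| := (le_max_left _ _).trans hs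
  have hs2 : T₂ ≤ |s.im| := ((le_max_left _ _).trans (le_max_right _ _)).trans hs
  have hs3 : T₃ ≤ |s.im| := ((le_max_right _ _).trans (le_max_right _ _)).trans hs
  have him : 1 ≤ |s.im| := hT₁.trans hs1
  have him0 : s.im ≠ 0 := by rintro h; rw [h] at him; norm_num at him
  obtain ⟨ε, hlog, hκ⟩ : ∃ ε : ℝ, Complex.log (-s) = Complex.log s + Complex.I * Real.pi * ε ∧
      ‖γ.kappa ω ε‖ ≤ K := by
    rcases him0.lt_or_gt with h | h
    · exact ⟨1, log_neg_of_im_neg h, le_add_of_nonneg_right (norm_nonneg _)⟩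
    · exact ⟨-1, log_neg_of_im_pos h, le_add_of_nonneg_left (norm_nonneg _)⟩
  have hfe := h₁ ε s hs1 hre.ge hre.le hlog
  rw [hF.conj_eq_LSeries (by simp [hre]; norm_num)] at hfe
  have hsin : Complex.sin (Real.pi * s) ≠ 0 := by
    rw [Complex.sin_ne_zero_iff]
    intro k hk
    rw [mul_comm] at hk
    have := mul_right_cancel₀ (by exact_mod_cast Real.pi_pos.ne' : (Real.pi : ℂ) ≠ 0) hk
    exact him0 (by rw [this]; simp)
  have hΓ := Complex.Gamma_mul_Gamma_one_sub s
  rw [eq_div_iff hsin] at hΓ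
  have hexp : Complex.exp (-(1 - s) * (Real.log (2 * Real.pi) + Complex.I * (Real.pi / 2))) =
      Complex.exp ((2 * s - 1) * Real.log (2 * Real.pi) - Complex.I * (Real.pi / 2)) *
      Complex.exp (-s * (Real.log (2 * Real.pi) - Complex.I * (Real.pi / 2))) := by
    rw [← Complex.exp_add]; congr 1; ring
  rw [hexp] at hfe
  have hkey : F s * Real.pi = γ.kappa ω ε * γ.feQuotient s * Complex.Gamma (1 - s) ^ 2 *
      Complex.exp ((2 * s - 1) * Real.log (2 * Real.pi) - Complex.I * (Real.pi / 2)) *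
      LSeries (fun n => conj (a n)) (1 - s) * Complex.sin (Real.pi * s) := by
    refine mul_right_cancel₀ (Complex.exp_ne_zero
      (-s * (Real.log (2 * Real.pi) - Complex.I * (Real.pi / 2)))) ?_
    linear_combination Complex.Gamma (1 - s) * Complex.sin (Real.pi * s) * hfe -
      F s * Complex.exp (-s * (Real.log (2 * Real.pi) - Complex.I * (Real.pi / 2))) * hΓ
  have hπ1 : (1 : ℝ) ≤ Real.pi := by linarith [Real.pi_gt_three]
  have b1 : ‖F s‖ ≤ ‖F s * Real.pi‖ := by
    rw [norm_mul, Complex.norm_real, Real.norm_of_nonneg Real.pi_pos.le]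
    exact le_mul_of_one_le_right (norm_nonneg _) hπ1
  have b2 : ‖Complex.Gamma (1 - s)‖ ≤
      G * |s.im| ^ (3 / 4 : ℝ) * Real.exp (-(Real.pi / 2 * |s.im|)) := by
    have hr : (1 - s).re = 5 / 4 := by rw [Complex.sub_re, hre]; norm_num
    have hi : |(1 - s).im| = |s.im| := by simp
    have := h₂ (1 - s) (by rw [hi]; exact hs2) hr.ge hr.le
    rwa [hr, hi, show (5 / 4 - 1 / 2 : ℝ) = 3 / 4 by norm_num] at this
  have b3 : ‖Complex.exp ((2 * s - 1) * Real.log (2 * Real.pi) - Complex.I * (Real.pi / 2))‖ ≤ 1 := by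
    rw [Complex.norm_exp, Real.exp_le_one_iff]
    have : ((2 * s - 1) * Real.log (2 * Real.pi) - Complex.I * (Real.pi / 2)).re =
        (2 * s.re - 1) * Real.log (2 * Real.pi) := by
      have e : Complex.I * (Real.pi / 2) = (Real.pi / 2 : ℝ) * Complex.I := by push_cast; ring
      rw [Complex.sub_re, Complex.re_mul_ofReal, e, Complex.re_ofReal_mul, Complex.I_re]
      simp
    rw [this, hre]
    have := Real.log_nonneg (x := 2 * Real.pi) (by linarith)
    nlinarith
  have b4 : ‖Complex.sin (Real.pi * s)‖ ≤ Real.exp (Real.pi * |s.im|) := by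
    refine (norm_sin_le_exp _).trans_eq ?_
    rw [Complex.im_ofReal_mul, abs_mul, abs_of_pos Real.pi_pos]
  have b5 : ‖LSeries (fun n => conj (a n)) (1 - s)‖ ≤ D :=
    hD' _ (by rw [Complex.sub_re, hre]; norm_num)
  refine b1.trans ?_
  rw [hkey]
  simp only [norm_mul, norm_pow]
  calc _ ≤ K * 2 * (G * |s.im| ^ (3 / 4 : ℝ) * Real.exp (-(Real.pi / 2 * |s.im|))) ^ 2 * 1 * D *
        Real.exp (Real.pi * |s.im|) := by
        gcongr
        exact h₃ s hs3 hre.ge hre.le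
    _ = K * 2 * G ^ 2 * D * (|s.im| ^ (3 / 4 : ℝ)) ^ 2 *
        (Real.exp (-(Real.pi / 2 * |s.im|)) ^ 2 * Real.exp (Real.pi * |s.im|)) := by ring
    _ = K * 2 * G ^ 2 * D * (|s.im| ^ (3 / 4 : ℝ)) ^ 2 := by
        rw [sq (Real.exp _), ← Real.exp_add, ← Real.exp_add]
        ring_nf
        simp
    _ ≤ K * 2 * G ^ 2 * D * s.im ^ 2 := by
        rw [← sq_abs s.im]
        gcongr
        calc |s.im| ^ (3 / 4 : ℝ) ≤ |s.im| ^ (1 : ℝ) :=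
              Real.rpow_le_rpow_of_exponent_le him (by norm_num)
          _ = |s.im| := Real.rpow_one _

/-- Phragmén–Lindelöf between `Re s = -1/4`, where the functional equation gives polynomial growth,
and `Re s = 5/4`, where the Dirichlet series is bounded. Finite order provides the a priori bound.
-/
theorem exists_norm_le_strip (hF : IsExtendedSelberg F a γ ω)
    (hdeg : γ.degree = 2) (hcond : γ.conductor = 1) (hθ : γ.theta = 0) :
    ∃ (C : ℝ) (N : ℕ), 0 ≤ C ∧ ∀ s : ℂ, 1 ≤ |s.im| → -1 / 4 ≤ s.re → s.re ≤ 5 / 4 →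
      ‖F s‖ ≤ C * |s.im| ^ N := by
  obtain ⟨C₁, T, hC₁, hT, hleft⟩ := hF.exists_norm_le_left hdeg hcond hθ
  obtain ⟨D, hD, hD'⟩ := norm_LSeries_le (hF.summable ((5 / 4 : ℝ) : ℂ)
    (by rw [Complex.ofReal_re]; norm_num))
  obtain ⟨m, hm, ρ, C₂, hord⟩ := hF.continuation
  set E : ℂ → ℂ := fun s => (s - 1) ^ m * F s with hE
  -- The power `m` balances `(s - 1)^m`, and two more powers absorb the quadratic growth on the left
  -- edge. The zero `-2` of the denominator lies outside the strip.
  set g : ℂ → ℂ := fun s => E s / (s + 2) ^ (m + 2) with hg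
  have hre2 : ∀ s : ℂ, -1 / 4 ≤ s.re → 1 ≤ ‖s + 2‖ := fun s hs => by
    refine le_trans ?_ (Complex.abs_re_le_norm _)
    rw [Complex.add_re, show (2 : ℂ).re = 2 from rfl, abs_of_nonneg] <;> linarith
  have hcmp : ∀ s : ℂ, -1 / 4 ≤ s.re → ‖s - 1‖ ≤ ‖s + 2‖ := fun s hs => by
    rw [← sq_le_sq₀ (norm_nonneg _) (norm_nonneg _), Complex.sq_norm, Complex.sq_norm,
      Complex.normSq_apply, Complex.normSq_apply]
    simp
    nlinarith
  have hgn : ∀ s : ℂ, -1 / 4 ≤ s.re → ∀ K : ℝ, ‖F s‖ ≤ K * ‖s + 2‖ ^ 2 → ‖g s‖ ≤ K := by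
    intro s hs K hK
    have h1 := hre2 s hs
    have h0 : 0 < ‖s + 2‖ := by linarith
    rw [hg, hE]
    simp only [norm_div, norm_mul, norm_pow]
    rw [div_le_iff₀ (by positivity)]
    calc ‖s - 1‖ ^ m * ‖F s‖ ≤ ‖s + 2‖ ^ m * (K * ‖s + 2‖ ^ 2) := by
          gcongr
          exact hcmp s hs
      _ = K * ‖s + 2‖ ^ (m + 2) := by ring
  obtain ⟨M, hM⟩ := ((isCompact_Icc (a := -T) (b := T)).image (f := fun t : ℝ =>
    E (((-1 / 4 : ℝ) : ℂ) + t * Complex.I)) (hm.continuous.comp (by fun_prop))).isBounded.exists_norm_le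
  set K := max D (max C₁ M)
  have hdc : DiffContOnCl ℂ g (Complex.re ⁻¹' Set.Ioo (-1 / 4) (5 / 4)) := by
    refine DifferentiableOn.diffContOnCl fun s hs => DifferentiableAt.differentiableWithinAt ?_
    have hs' : s ∈ Complex.re ⁻¹' Set.Icc (-1 / 4) (5 / 4) :=
      closure_minimal (Set.preimage_mono Set.Ioo_subset_Icc_self)
        (isClosed_Icc.preimage Complex.continuous_re) hs
    have h1 := hre2 s hs'.1
    refine (hm s).div (by fun_prop) (pow_ne_zero _ fun h => ?_)
    rw [h] at h1
    norm_num at h1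
  have hgr : g =O[comap (abs ∘ Complex.im) atTop ⊓ 𝓟 (Complex.re ⁻¹' Set.Ioo (-1 / 4) (5 / 4))]
      fun z => Real.exp (1 * Real.exp (1 * |z.im|)) := by
    -- A bound `exp (‖s‖^ρ)` is dominated by `exp (exp |Im s|)`, since a power is dominated by an
    -- exponential.
    set k : ℕ := ⌈|ρ|⌉₊
    have h1 : ∀ᶠ t : ℝ in atTop, (3 * t) ^ k ≤ Real.exp (1 * t) := by
      have := (isLittleO_pow_exp_pos_mul_atTop k one_pos).const_mul_left (3 ^ k)
      filter_upwards [this.bound one_pos, eventually_ge_atTop 0] with t ht h0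
      rw [mul_pow]
      simpa [abs_of_nonneg h0] using ht
    refine IsBigO.of_bound |C₂| ?_
    have h2 : ∀ᶠ z : ℂ in comap (abs ∘ Complex.im) atTop,
        (3 * |z.im|) ^ k ≤ Real.exp (1 * |z.im|) ∧ 2 ≤ |z.im| :=
      tendsto_comap.eventually (h1.and (eventually_ge_atTop 2))
    filter_upwards [h2.filter_mono inf_le_left, mem_inf_of_right (mem_principal_self _)]
      with s hs hs'
    have hn1 : 1 ≤ ‖s‖ := le_trans (by linarith) ((hs.2).trans (Complex.abs_im_le_norm s))
    have hn2 : ‖s‖ ≤ 3 * |s.im| := by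
      refine (Complex.norm_le_abs_re_add_abs_im s).trans ?_
      have : |s.re| ≤ 2 := abs_le.2 ⟨by linarith [hs'.1], by linarith [hs'.2]⟩
      linarith
    have hpow : ‖s‖ ^ ρ ≤ (3 * |s.im|) ^ k := by
      calc ‖s‖ ^ ρ ≤ ‖s‖ ^ (k : ℝ) :=
            Real.rpow_le_rpow_of_exponent_le hn1 ((le_abs_self _).trans (Nat.le_ceil _))
        _ = ‖s‖ ^ k := Real.rpow_natCast _ _
        _ ≤ _ := by gcongr
    have hEs : ‖g s‖ ≤ ‖E s‖ := by
      rw [hg]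
      simp only [norm_div, norm_pow]
      exact div_le_self (norm_nonneg _) (one_le_pow₀ (hre2 s hs'.1.le))
    refine hEs.trans ((hord s).trans ?_)
    rw [Real.norm_of_nonneg (Real.exp_pos _).le, one_mul]
    calc C₂ * Real.exp (‖s‖ ^ ρ) ≤ |C₂| * Real.exp (‖s‖ ^ ρ) := by
          gcongr; exact le_abs_self _
      _ ≤ _ := by gcongr; exact hpow.trans hs.1
  have hbound : ∀ s : ℂ, -1 / 4 ≤ s.re → s.re ≤ 5 / 4 → ‖g s‖ ≤ K := by
    intro s h1 h2
    refine PhragmenLindelof.vertical_strip hdc ⟨1, ?_, 1, hgr⟩ (fun z hz => ?_) (fun z hz => ?_)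
      h1 h2
    -- The strip has width `3/2`, and the rate 1 in the double exponential is below `π / (3/2)`.
    · rw [lt_div_iff₀ (by norm_num)]
      linarith [Real.pi_gt_three]
    · rcases le_or_gt T |z.im| with h | h
      · refine (hgn z hz.ge C₁ ((hleft z h hz).trans ?_)).trans
          ((le_max_left _ _).trans (le_max_right _ _))
        have := Complex.abs_im_le_norm (z + 2)
        rw [← sq_abs z.im]
        gcongr
        simpa using this
      · have h3 := hM (E z) ⟨z.im, abs_le.1 h.le, by
          show E _ = E z
          rw [← hz, Complex.re_add_im z]⟩
        refine le_trans ?_ (h3.trans ((le_max_right _ _).trans (le_max_right _ _)))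
        rw [hg]
        simp only [norm_div, norm_pow]
        exact div_le_self (norm_nonneg _) (one_le_pow₀ (hre2 z hz.ge))
    · refine (hgn z (by rw [hz]; norm_num) D ?_).trans (le_max_left _ _)
      rw [hF.eq_LSeries z (by rw [hz]; norm_num)]
      exact (hD' z hz.ge).trans (le_mul_of_one_le_right hD
        (one_le_pow₀ (hre2 z (by rw [hz]; norm_num))))
  have hK : 0 ≤ K := hD.trans (le_max_left _ _)
  refine ⟨K * 5 ^ (m + 2), m + 2, by positivity, fun s hs h1 h2 => ?_⟩
  have h3 := hbound s h1 h2
  have h4 : 1 ≤ ‖s - 1‖ := hs.trans (by simpa using Complex.abs_im_le_norm (s - 1))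
  have h5 := hre2 s h1
  have h6 : 0 < ‖s + 2‖ := by linarith
  rw [hg, hE] at h3
  simp only [norm_div, norm_mul, norm_pow] at h3
  rw [div_le_iff₀ (by positivity)] at h3
  have h7 : ‖s + 2‖ ≤ 5 * |s.im| := by
    refine (Complex.norm_le_abs_re_add_abs_im _).trans ?_
    have : |(s + 2).re| ≤ 13 / 4 := abs_le.2 ⟨by simp; linarith, by simp; linarith⟩
    have h8 : (s + 2).im = s.im := by simp
    rw [h8]
    linarith
  calc ‖F s‖ ≤ ‖s - 1‖ ^ m * ‖F s‖ := le_mul_of_one_le_left (norm_nonneg _) (one_le_pow₀ h4)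
    _ ≤ K * ‖s + 2‖ ^ (m + 2) := h3
    _ ≤ K * (5 * |s.im|) ^ (m + 2) := by gcongr
    _ = _ := by ring

end IsExtendedSelberg

/-! ### Splitting the Mellin integral -/

/-- The Fourier series `∑ a(n) e(n z)` over `n ≥ 1`. -/
noncomputable def qSeries (a : ℕ → ℂ) (z : ℂ) : ℂ :=
  ∑' n : ℕ, a (n + 1) * Complex.exp (2 * Real.pi * Complex.I * (n + 1 : ℕ) * z)

/-- The integrand `F(s) Γ(s) exp(-s L)`. -/
noncomputable def mellinKernel (F : ℂ → ℂ) (L s : ℂ) : ℂ :=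
  F s * (Complex.Gamma s * Complex.exp (-s * L))

/-- The contribution of the bounded part of the contour. -/
noncomputable def boundaryTerm (F : ℂ → ℂ) (T : ℝ) (L : ℂ) : ℂ :=
  Complex.I * (∫ x : ℝ in (-1 / 4)..(5 / 4), mellinKernel F L (x + T * Complex.I)) +
    (∫ t : ℝ in (-T)..T, mellinKernel F L ((5 / 4 : ℝ) + t * Complex.I)) -
    Complex.I * ∫ x : ℝ in (-1 / 4)..(5 / 4), mellinKernel F L (x - T * Complex.I)

/-- The properties of `F` and of its dual Dirichlet series `∑ b(n) n ^ (-s)` that yield the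
transformation behaviour of the Fourier series. -/
structure HasReflection (F : ℂ → ℂ) (a b : ℕ → ℂ) (κ : ℂ) (T : ℝ) : Prop where
  one_le : 1 ≤ T
  summable_left : LSeriesSummable a ((5 / 4 : ℝ) : ℂ)
  summable_right : LSeriesSummable b ((5 / 4 : ℝ) : ℂ)
  differentiableAt : ∀ s : ℂ, s ≠ 1 → DifferentiableAt ℂ F s
  eq_LSeries : ∀ t : ℝ, F ((5 / 4 : ℝ) + t * Complex.I) = LSeries a ((5 / 4 : ℝ) + t * Complex.I)
  growth : ∃ (C : ℝ) (N : ℕ), 0 ≤ C ∧ ∀ s : ℂ, T ≤ |s.im| → -1 / 4 ≤ s.re → s.re ≤ 5 / 4 →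
    ‖F s * Complex.Gamma s‖ ≤ C * |s.im| ^ N * Real.exp (-(Real.pi / 2 * |s.im|))
  reflect : ∃ (c : ℂ) (C : ℝ), 0 ≤ C ∧ ∀ (t : ℝ) (p : ℂ), T ≤ t →
    p = (5 / 4 : ℝ) + t * Complex.I →
    ‖mellinKernel F (Real.log (2 * Real.pi) - Complex.I * (Real.pi / 2)) (1 - p) -
      κ * (1 - c / (p - 1)) *
        mellinKernel (LSeries b) (Real.log (2 * Real.pi) + Complex.I * (Real.pi / 2)) p‖ ≤
      C * t ^ (-(5 / 4) : ℝ)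

lemma exists_pow_mul_exp_le (n : ℕ) {δ : ℝ} (hδ : 0 < δ) : ∃ C : ℝ, 0 ≤ C ∧ ∀ t : ℝ, 0 ≤ t →
    t ^ n * Real.exp (-(δ * t)) ≤ C * Real.exp (-(δ / 2 * t)) := by
  refine ⟨n.factorial * (2 / δ) ^ n, by positivity, fun t ht => ?_⟩
  have h1 := Real.pow_div_factorial_le_exp (δ / 2 * t) (by positivity) n
  rw [div_le_iff₀ (by positivity)] at h1
  have h2 : t ^ n = (2 / δ) ^ n * (δ / 2 * t) ^ n := by
    rw [← mul_pow]; congr 1; field_simp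
  have h3 : Real.exp (-(δ * t)) = Real.exp (-(δ / 2 * t)) * Real.exp (-(δ / 2 * t)) := by
    rw [← Real.exp_add]; ring_nf
  have h4 : Real.exp (δ / 2 * t) * Real.exp (-(δ / 2 * t)) = 1 := by
    rw [← Real.exp_add]; simp
  rw [h2, h3]
  calc (2 / δ) ^ n * (δ / 2 * t) ^ n * (Real.exp (-(δ / 2 * t)) * Real.exp (-(δ / 2 * t)))
      ≤ (2 / δ) ^ n * (Real.exp (δ / 2 * t) * n.factorial) *
        (Real.exp (-(δ / 2 * t)) * Real.exp (-(δ / 2 * t))) := by gcongr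
    _ = n.factorial * (2 / δ) ^ n * (Real.exp (δ / 2 * t) * Real.exp (-(δ / 2 * t))) *
        Real.exp (-(δ / 2 * t)) := by ring
    _ = _ := by rw [h4, mul_one]

lemma norm_exp_neg_mul (s L : ℂ) :
    ‖Complex.exp (-s * L)‖ = Real.exp (-(s.re * L.re) + s.im * L.im) := by
  rw [Complex.norm_exp]; simp; ring

lemma integral_eq_add_Ioi {g : ℝ → ℂ} (hg : Integrable g) (T : ℝ) :
    ∫ t, g t = (∫ t in (-T)..T, g t) + (∫ t in Set.Ioi T, g t) + ∫ t in Set.Ioi T, g (-t) := by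
  rw [integral_comp_neg_Ioi, ← intervalIntegral.integral_Iic_add_Ioi (b := T) hg.integrableOn hg.integrableOn,
    ← intervalIntegral.integral_Iic_sub_Iic (a := -T) (b := T) hg.integrableOn hg.integrableOn]
  ring

lemma integrableOn_exp_neg_mul_Ioi {δ : ℝ} (hδ : 0 < δ) (T : ℝ) :
    IntegrableOn (fun t : ℝ => Real.exp (-(δ * t))) (Set.Ioi T) := by
  simpa [neg_mul] using integrableOn_exp_mul_Ioi (neg_lt_zero.2 hδ) T

namespace HasReflection

variable {F : ℂ → ℂ} {a b : ℕ → ℂ} {κ : ℂ} {T : ℝ}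

lemma differentiableAt_mellinKernel (h : HasReflection F a b κ T) (L : ℂ) {s : ℂ}
    (hs : s.im ≠ 0) : DifferentiableAt ℂ (mellinKernel F L) s := by
  have h1 : s ≠ 1 := by rintro rfl; simp at hs
  have h2 : ∀ m : ℕ, s ≠ -m := by rintro m rfl; simp at hs
  exact (h.differentiableAt s h1).mul ((Complex.differentiableAt_Gamma s h2).mul (by fun_prop))

/-- `F Γ` decays with rate `π/2` up to polynomial factors, while `exp (-sL)` grows at most with rate
`|Im L|`. Half of the difference absorbs the polynomial. -/
lemma exists_norm_mellinKernel_le (h : HasReflection F a b κ T) {L : ℂ}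
    (hL : |L.im| < Real.pi / 2) : ∃ C δ : ℝ, 0 < δ ∧ ∀ s : ℂ, T ≤ |s.im| → -1 / 4 ≤ s.re →
      s.re ≤ 5 / 4 → ‖mellinKernel F L s‖ ≤ C * Real.exp (-(δ * |s.im|)) := by
  obtain ⟨C, N, hC, hg⟩ := h.growth
  have hδ : 0 < Real.pi / 2 - |L.im| := by linarith
  obtain ⟨D, hD, hD'⟩ := exists_pow_mul_exp_le N hδ
  refine ⟨C * D * Real.exp (2 * |L.re|), (Real.pi / 2 - |L.im|) / 2, by linarith,
    fun s hs h1 h2 => ?_⟩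
  rw [mellinKernel, ← mul_assoc, norm_mul, norm_exp_neg_mul]
  have h3 : -(s.re * L.re) ≤ 2 * |L.re| := by
    refine (neg_le_abs _).trans ?_
    rw [abs_mul]
    gcongr
    exact abs_le.2 ⟨by linarith, by linarith⟩
  have h4 : s.im * L.im ≤ |s.im| * |L.im| := (le_abs_self _).trans (abs_mul _ _).le
  calc _ ≤ (C * |s.im| ^ N * Real.exp (-(Real.pi / 2 * |s.im|))) *
        Real.exp (2 * |L.re| + |s.im| * |L.im|) := by
        gcongr; exact hg s hs h1 h2
    _ = C * Real.exp (2 * |L.re|) *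
        (|s.im| ^ N * Real.exp (-((Real.pi / 2 - |L.im|) * |s.im|))) := by
        have : Real.exp (-((Real.pi / 2 - |L.im|) * |s.im|)) =
          Real.exp (-(Real.pi / 2 * |s.im|)) * Real.exp (|s.im| * |L.im|) := by
          rw [← Real.exp_add]; ring_nf
        rw [Real.exp_add, this]; ring
    _ ≤ C * Real.exp (2 * |L.re|) *
        (D * Real.exp (-((Real.pi / 2 - |L.im|) / 2 * |s.im|))) :=
        mul_le_mul_of_nonneg_left (hD' _ (abs_nonneg _)) (by positivity)
    _ = _ := by ring

lemma integrableOn_upper (h : HasReflection F a b κ T) {L : ℂ} (hL : |L.im| < Real.pi / 2) {x : ℝ}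
    (h1 : -1 / 4 ≤ x) (h2 : x ≤ 5 / 4) :
    IntegrableOn (fun t : ℝ => mellinKernel F L (x + t * Complex.I)) (Set.Ioi T) := by
  obtain ⟨C, δ, hδ, hb⟩ := h.exists_norm_mellinKernel_le hL
  have hT := h.one_le
  refine Integrable.mono' ((integrableOn_exp_neg_mul_Ioi hδ T).const_mul C) ?_ ?_
  · refine ContinuousOn.aestronglyMeasurable (fun t ht => ?_) measurableSet_Ioi
    have ht' : T < t := ht
    have : ContinuousAt (mellinKernel F L) (x + t * Complex.I) :=
      (h.differentiableAt_mellinKernel L (by simp; linarith)).continuousAt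
    exact (ContinuousAt.comp (f := fun t : ℝ => (x + t * Complex.I : ℂ)) this
      (by fun_prop)).continuousWithinAt
  · filter_upwards [ae_restrict_mem measurableSet_Ioi] with t ht
    have ht' : T < t := ht
    have := hb (x + t * Complex.I) (by simpa using ht'.le.trans (le_abs_self t)) (by simpa using h1)
      (by simpa using h2)
    simpa [abs_of_pos (show 0 < t by linarith)] using this

lemma integrableOn_lower (h : HasReflection F a b κ T) {L : ℂ} (hL : |L.im| < Real.pi / 2) {x : ℝ}
    (h1 : -1 / 4 ≤ x) (h2 : x ≤ 5 / 4) :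
    IntegrableOn (fun t : ℝ => mellinKernel F L (x - t * Complex.I)) (Set.Ioi T) := by
  obtain ⟨C, δ, hδ, hb⟩ := h.exists_norm_mellinKernel_le hL
  have hT := h.one_le
  refine Integrable.mono' ((integrableOn_exp_neg_mul_Ioi hδ T).const_mul C) ?_ ?_
  · refine ContinuousOn.aestronglyMeasurable (fun t ht => ?_) measurableSet_Ioi
    have ht' : T < t := ht
    have : ContinuousAt (mellinKernel F L) (x - t * Complex.I) :=
      (h.differentiableAt_mellinKernel L (by simp; linarith)).continuousAt
    exact (ContinuousAt.comp (f := fun t : ℝ => (x - t * Complex.I : ℂ)) this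
      (by fun_prop)).continuousWithinAt
  · filter_upwards [ae_restrict_mem measurableSet_Ioi] with t ht
    have ht' : T < t := ht
    have := hb (x - t * Complex.I) (by simpa using ht'.le.trans (le_abs_self t)) (by simpa using h1)
      (by simpa using h2)
    simpa [abs_of_pos (show 0 < t by linarith)] using this

/-- The line `Re s = 5/4` is moved to `Re s = -1/4` only where `|Im s| > T`. The possible poles at
`s = 1` and `s = 0` are bypassed, and their effect stays inside `boundaryTerm`. -/
theorem integral_eq_boundaryTerm_add (h : HasReflection F a b κ T) {L : ℂ}
    (hL : |L.im| < Real.pi / 2) :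
    ∫ t : ℝ, mellinKernel (LSeries a) L ((5 / 4 : ℝ) + t * Complex.I) = boundaryTerm F T L +
      (∫ t : ℝ in Set.Ioi T, mellinKernel F L ((-1 / 4 : ℝ) + t * Complex.I)) +
      ∫ t : ℝ in Set.Ioi T, mellinKernel F L ((-1 / 4 : ℝ) - t * Complex.I) := by
  have hT := h.one_le
  obtain ⟨C, δ, hδ, hb⟩ := h.exists_norm_mellinKernel_le hL
  have hi : Integrable fun t : ℝ => mellinKernel F L ((5 / 4 : ℝ) + t * Complex.I) := by
    have := (hasSum_integral_LSeries_mul_Gamma (by norm_num) h.summable_left hL).1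
    refine this.congr (Eventually.of_forall fun t => ?_)
    simp only [mellinKernel, h.eq_LSeries]
  have e1 : ∫ t : ℝ, mellinKernel (LSeries a) L ((5 / 4 : ℝ) + t * Complex.I) =
      ∫ t : ℝ, mellinKernel F L ((5 / 4 : ℝ) + t * Complex.I) := by
    refine integral_congr_ae (Eventually.of_forall fun t => ?_)
    simp only [mellinKernel, h.eq_LSeries]
  have e2 : ∀ t : ℝ, ((5 / 4 : ℝ) : ℂ) + ((-t : ℝ) : ℂ) * Complex.I =
      ((5 / 4 : ℝ) : ℂ) - t * Complex.I := fun t => by push_cast; ring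
  have hlim : Tendsto (fun t : ℝ => C * Real.exp (-(δ * t))) atTop (𝓝 0) := by
    rw [← mul_zero C]
    exact (Real.tendsto_exp_neg_atTop_nhds_zero.comp (tendsto_id.const_mul_atTop hδ)).const_mul C
  have hab : (-1 / 4 : ℝ) ≤ 5 / 4 := by norm_num
  have u := integral_shift_upper (Φ := mellinKernel F L) hab
    (fun s _ _ h3 => h.differentiableAt_mellinKernel L (by linarith : 0 < s.im).ne')
    (h.integrableOn_upper hL le_rfl hab) (h.integrableOn_upper hL hab le_rfl) hlim (by
      filter_upwards [eventually_ge_atTop T] with t ht x hx1 hx2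
      have := hb (x + t * Complex.I) (by simpa using ht.trans (le_abs_self t))
        (by simpa using hx1) (by simpa using hx2)
      simpa [abs_of_pos (show 0 < t by linarith)] using this)
  have l := integral_shift_lower (Φ := mellinKernel F L) hab
    (fun s _ _ h3 => h.differentiableAt_mellinKernel L (by linarith : s.im < 0).ne)
    (h.integrableOn_lower hL le_rfl hab) (h.integrableOn_lower hL hab le_rfl) hlim (by
      filter_upwards [eventually_ge_atTop T] with t ht x hx1 hx2
      have := hb (x - t * Complex.I) (by simpa using ht.trans (le_abs_self t))
        (by simpa using hx1) (by simpa using hx2)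
      simpa [abs_of_pos (show 0 < t by linarith)] using this)
  rw [e1, integral_eq_add_Ioi hi T]
  simp only [e2]
  rw [u, l, boundaryTerm]
  ring

/-- Bound for the upper part of the shifted line. -/
lemma exists_norm_integral_upper_le (h : HasReflection F a b κ T) : ∃ C : ℝ, 0 ≤ C ∧
    ∀ L : ℂ, -(Real.pi / 2) < L.im → L.im ≤ 0 →
      ‖∫ t : ℝ in Set.Ioi T, mellinKernel F L ((-1 / 4 : ℝ) + t * Complex.I)‖ ≤
        C * Real.exp (1 / 4 * L.re) := by
  obtain ⟨C, N, hC, hg⟩ := h.growth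
  have hT := h.one_le
  obtain ⟨D, hD, hD'⟩ := exists_pow_mul_exp_le N (show 0 < Real.pi / 2 by positivity)
  set J := ∫ t in Set.Ioi T, Real.exp (-(Real.pi / 2 / 2 * t))
  have hJ : 0 ≤ J := setIntegral_nonneg measurableSet_Ioi fun t _ => (Real.exp_pos _).le
  refine ⟨C * D * J, by positivity, fun L h1 h2 => ?_⟩
  have hmain := norm_integral_le_of_norm_le (μ := volume.restrict (Set.Ioi T))
    (f := fun t : ℝ => mellinKernel F L ((-1 / 4 : ℝ) + t * Complex.I))
    (g := fun t => C * D * Real.exp (1 / 4 * L.re) * Real.exp (-(Real.pi / 2 / 2 * t)))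
    ((integrableOn_exp_neg_mul_Ioi (by positivity) T).const_mul _) (by
      filter_upwards [ae_restrict_mem measurableSet_Ioi] with t ht
      have ht' : T < t := ht
      have ht0 : 0 < t := by linarith
      have := hg ((-1 / 4 : ℝ) + t * Complex.I) (by simpa using ht'.le.trans (le_abs_self t))
        (by simp) (by simp; norm_num)
      rw [mellinKernel, ← mul_assoc, norm_mul, norm_exp_neg_mul]
      have him : (((-1 / 4 : ℝ) : ℂ) + t * Complex.I).im = t := by simp
      have hre : (((-1 / 4 : ℝ) : ℂ) + t * Complex.I).re = -1 / 4 := by simp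
      rw [him, abs_of_pos ht0] at this
      rw [him, hre]
      have h3 : -(-1 / 4 * L.re) + t * L.im ≤ 1 / 4 * L.re := by
        nlinarith [mul_nonneg ht0.le (neg_nonneg.2 h2)]
      calc _ ≤ C * t ^ N * Real.exp (-(Real.pi / 2 * t)) * Real.exp (1 / 4 * L.re) := by gcongr
        _ = C * Real.exp (1 / 4 * L.re) * (t ^ N * Real.exp (-(Real.pi / 2 * t))) := by ring
        _ ≤ C * Real.exp (1 / 4 * L.re) * (D * Real.exp (-(Real.pi / 2 / 2 * t))) :=
          mul_le_mul_of_nonneg_left (hD' t ht0.le) (by positivity)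
        _ = _ := by ring)
  refine hmain.trans_eq ?_
  rw [integral_const_mul]
  ring

end HasReflection

/-! ### Transformation behaviour of the Fourier series -/

lemma tsum_exp_eq_qSeries (A : ℕ → ℂ) {L z : ℂ} (h : Complex.exp L = -(2 * Real.pi * Complex.I * z)) :
    ∑' n : ℕ, A (n + 1) * Complex.exp (-((n + 1 : ℕ) * Complex.exp L)) = qSeries A z := by
  refine tsum_congr fun n => ?_
  rw [h]; congr 2; ring

/-- The integral over the whole line is `2π` times the exponential sum. The missing part `t ≤ T` is
bounded uniformly in `L`, because `Im L ≥ 0` gives `exp (t Im L) ≤ exp (Tπ/2)` there. -/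
lemma exists_norm_integral_Ioi_sub_le {A : ℕ → ℂ} {c : ℝ} (hc : 0 < c) (hA : LSeriesSummable A c)
    {T : ℝ} (hT : 0 ≤ T) : ∃ K : ℝ, 0 ≤ K ∧ ∀ L : ℂ, 0 ≤ L.im → L.im < Real.pi / 2 →
      IntegrableOn (fun t : ℝ => mellinKernel (LSeries A) L (c + t * Complex.I)) (Set.Ioi T) ∧
      ‖(∫ t : ℝ in Set.Ioi T, mellinKernel (LSeries A) L (c + t * Complex.I)) -
        2 * Real.pi * ∑' n : ℕ, A (n + 1) * Complex.exp (-((n + 1 : ℕ) * Complex.exp L))‖ ≤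
        K * Real.exp (-(c * L.re)) := by
  obtain ⟨G, hG, hG'⟩ := norm_Gamma_vertical_le hc (η := 1) (by linarith [Real.pi_gt_three])
  obtain ⟨D, hD, hD'⟩ := norm_LSeries_le hA
  set J := ∫ t in Set.Iic T, Real.exp (-(1 * |t|))
  have hJ : 0 ≤ J := setIntegral_nonneg measurableSet_Iic fun t _ => (Real.exp_pos _).le
  refine ⟨D * G * Real.exp (T * (Real.pi / 2)) * J, by positivity, fun L h1 h2 => ?_⟩
  obtain ⟨hi, hs⟩ := hasSum_integral_LSeries_mul_Gamma hc hA (L := L) (by rwa [abs_of_nonneg h1])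
  refine ⟨hi.integrableOn, ?_⟩
  have e1 : (∫ t : ℝ in Set.Ioi T, mellinKernel (LSeries A) L (c + t * Complex.I)) -
      2 * Real.pi * ∑' n : ℕ, A (n + 1) * Complex.exp (-((n + 1 : ℕ) * Complex.exp L)) =
      -∫ t : ℝ in Set.Iic T, mellinKernel (LSeries A) L (c + t * Complex.I) := by
    rw [← tsum_mul_left, hs.tsum_eq,
      ← intervalIntegral.integral_Iic_add_Ioi (b := T) hi.integrableOn hi.integrableOn]
    simp only [mellinKernel]
    ring
  rw [e1, norm_neg]
  refine (norm_integral_le_of_norm_le (μ := volume.restrict (Set.Iic T))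
    (g := fun t => D * G * Real.exp (T * (Real.pi / 2)) * Real.exp (-(c * L.re)) *
      Real.exp (-(1 * |t|)))
    ((integrable_exp_neg_mul_abs one_pos).integrableOn.const_mul _) ?_).trans_eq ?_
  · filter_upwards [ae_restrict_mem measurableSet_Iic] with t ht
    have ht' : t ≤ T := ht
    rw [mellinKernel, norm_mul, norm_mul, norm_exp_neg_mul]
    have him : ((c : ℂ) + t * Complex.I).im = t := by simp
    have hre : ((c : ℂ) + t * Complex.I).re = c := by simp
    rw [him, hre, Real.exp_add]
    have h3 : t * L.im ≤ T * (Real.pi / 2) := by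
      calc t * L.im ≤ T * L.im := by gcongr
        _ ≤ _ := by gcongr
    calc _ ≤ D * (G * Real.exp (-(1 * |t|)) * (Real.exp (-(c * L.re)) *
          Real.exp (T * (Real.pi / 2)))) := by
          gcongr
          · exact hD' _ hre.ge
          · exact hG' t
      _ = _ := by ring
  · rw [integral_const_mul]
    ring

lemma term_div_eq (b : ℕ → ℂ) (s : ℂ) :
    LSeries.term (fun n => b n / n) s = LSeries.term b (s + 1) := by
  funext n
  rcases eq_or_ne n 0 with rfl | hn
  · simp
  have hn' : (n : ℂ) ≠ 0 := by exact_mod_cast hn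
  rw [LSeries.term_of_ne_zero hn, LSeries.term_of_ne_zero hn, Complex.cpow_add _ _ hn',
    Complex.cpow_one, div_div, mul_comm (n : ℂ)]

lemma LSeries_div_eq (b : ℕ → ℂ) (s : ℂ) :
    LSeries (fun n => b n / n) s = LSeries b (s + 1) := by
  rw [LSeries, term_div_eq, LSeries]

lemma rpow_quarter_mul_exp_le_one {x : ℝ} (hx : 0 < x) : x ^ (1 / 4 : ℝ) * Real.exp (-x) ≤ 1 := by
  rw [Real.exp_neg, ← div_eq_mul_inv, div_le_one (Real.exp_pos _)]
  rcases le_total x 1 with h | h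
  · exact (Real.rpow_le_one hx.le h (by norm_num)).trans (Real.one_le_exp hx.le)
  · calc x ^ (1 / 4 : ℝ) ≤ x ^ (1 : ℝ) := Real.rpow_le_rpow_of_exponent_le h (by norm_num)
      _ = x := Real.rpow_one x
      _ ≤ Real.exp x := by linarith [Real.add_one_le_exp x]

/-- From `x^(1/4) e^(-x) ≤ 1` each exponential is at most `(n Im z)^(-1/4)`. With the weight `1/n`
this leaves the convergent series `∑ |b(n)| n^(-5/4)`. -/
lemma exists_norm_qSeries_div_le {b : ℕ → ℂ} (hb : LSeriesSummable b ((5 / 4 : ℝ) : ℂ)) :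
    ∃ K : ℝ, 0 ≤ K ∧ ∀ z : ℂ, 0 < z.im →
      ‖qSeries (fun n => b n / n) z‖ ≤ K * z.im ^ (-(1 / 4) : ℝ) := by
  have hs := hb.norm.comp_injective (add_left_injective 1)
  refine ⟨∑' n : ℕ, ‖LSeries.term b ((5 / 4 : ℝ) : ℂ) (n + 1)‖,
    tsum_nonneg fun n => norm_nonneg _, fun z hz => ?_⟩
  refine tsum_of_norm_bounded (hs.hasSum.mul_right _) fun n => ?_
  have hn : (0 : ℝ) < (n + 1 : ℕ) := by positivity
  simp only [Function.comp]
  rw [LSeries.norm_term_eq, if_neg (Nat.succ_ne_zero n), Complex.ofReal_re, norm_mul, norm_div,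
    Complex.norm_natCast, Complex.norm_exp]
  have hre : (2 * Real.pi * Complex.I * (n + 1 : ℕ) * z).re = -((n + 1 : ℕ) * (2 * Real.pi * z.im)) := by
    have : (2 * Real.pi * Complex.I * (n + 1 : ℕ) * z : ℂ) =
        ((2 * Real.pi * (n + 1 : ℕ) : ℝ) : ℂ) * (Complex.I * z) := by push_cast; ring
    rw [this, Complex.re_ofReal_mul]
    simp
    ring
  rw [hre]
  set m : ℝ := ((n + 1 : ℕ) : ℝ)
  set x := m * (2 * Real.pi * z.im) with hx
  have hx0 : 0 < x := by positivity
  have h1 := rpow_quarter_mul_exp_le_one hx0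
  have h2 : (m * z.im) ^ (1 / 4 : ℝ) ≤ x ^ (1 / 4 : ℝ) := by
    refine Real.rpow_le_rpow (by positivity) ?_ (by norm_num)
    rw [hx]
    gcongr
    nlinarith [Real.pi_gt_three]
  have h3 : m ^ (1 / 4 : ℝ) * z.im ^ (1 / 4 : ℝ) * Real.exp (-x) ≤ 1 := by
    rw [← Real.mul_rpow hn.le hz.le]
    exact (mul_le_mul_of_nonneg_right h2 (Real.exp_pos _).le).trans h1
  have h4 : m ^ (5 / 4 : ℝ) = m * m ^ (1 / 4 : ℝ) := by
    rw [show (5 / 4 : ℝ) = 1 + 1 / 4 by norm_num, Real.rpow_add hn, Real.rpow_one]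
  have h5 : 0 < m ^ (1 / 4 : ℝ) := Real.rpow_pos_of_pos hn _
  have h6 : 0 < z.im ^ (1 / 4 : ℝ) := Real.rpow_pos_of_pos hz _
  rw [h4, Real.rpow_neg hz.le]
  have h7 : Real.exp (-x) ≤ (m ^ (1 / 4 : ℝ))⁻¹ * (z.im ^ (1 / 4 : ℝ))⁻¹ := by
    rw [← mul_inv, ← one_div, le_div_iff₀ (by positivity), mul_comm]
    exact h3
  calc ‖b (n + 1)‖ / m * Real.exp (-x) ≤
        ‖b (n + 1)‖ / m * ((m ^ (1 / 4 : ℝ))⁻¹ * (z.im ^ (1 / 4 : ℝ))⁻¹) := by gcongr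
    _ = _ := by rw [← div_div, div_eq_mul_inv (‖b (n + 1)‖ / m) (m ^ (1 / 4 : ℝ))]; ring

/-- The parameter of the Mellin transform that belongs to the point `z`. -/
noncomputable def mellinParam (z : ℂ) : ℂ :=
  Real.log (2 * Real.pi) - Complex.I * (Real.pi / 2) + Complex.log z

namespace HasReflection

variable {F : ℂ → ℂ} {a b : ℕ → ℂ} {κ : ℂ} {T : ℝ}

/-- Since `Γ(p) / (p - 1) = Γ(p - 1)`, the correction term `c / (p - 1)` is again a Mellin kernel,
for the series with coefficients `b(n)/n` at `p - 1`. The point `z` enters the remaining error only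
through `exp ((p - 1) log z)`. -/
lemma mellinKernel_reflect {z : ℂ} (hz : z ≠ 0) (p c : ℂ) (hp : p ≠ 1) :
    mellinKernel F (mellinParam z) (1 - p) -
      κ * z⁻¹ * (mellinKernel (LSeries b) (Real.log (2 * Real.pi) + Complex.I * (Real.pi / 2) -
          Complex.log z) p -
        c * Complex.exp (-(Real.log (2 * Real.pi) + Complex.I * (Real.pi / 2) - Complex.log z)) *
          mellinKernel (LSeries fun n => b n / n) (Real.log (2 * Real.pi) +
            Complex.I * (Real.pi / 2) - Complex.log z) (p - 1)) =
    (mellinKernel F (Real.log (2 * Real.pi) - Complex.I * (Real.pi / 2)) (1 - p) -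
      κ * (1 - c / (p - 1)) *
        mellinKernel (LSeries b) (Real.log (2 * Real.pi) + Complex.I * (Real.pi / 2)) p) *
      Complex.exp ((p - 1) * Complex.log z) := by
  have hp' : p - 1 ≠ 0 := sub_ne_zero.2 hp
  have hΓ : Complex.Gamma p = (p - 1) * Complex.Gamma (p - 1) := by
    have := Complex.Gamma_add_one (p - 1) hp'
    rwa [sub_add_cancel] at this
  simp only [mellinKernel, mellinParam, LSeries_div_eq, sub_add_cancel]
  set l := Complex.log z with hl
  have hzl : z = Complex.exp l := (Complex.exp_log hz).symm
  set A : ℂ := ((Real.log (2 * Real.pi) : ℝ) : ℂ)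
  set P := Complex.I * ((Real.pi : ℂ) / 2)
  rw [hzl, ← Complex.exp_neg, hΓ]
  have x1 : Complex.exp (-(1 - p) * (A - P + l)) = Complex.exp (-(1 - p) * (A - P)) *
      Complex.exp ((p - 1) * l) := by rw [← Complex.exp_add]; ring_nf
  have x2 : Complex.exp (-p * (A + P - l)) = Complex.exp (-p * (A + P)) *
      (Complex.exp ((p - 1) * l) * Complex.exp l) := by
    rw [← Complex.exp_add, ← Complex.exp_add]; ring_nf
  have x3 : Complex.exp (-(A + P - l)) * Complex.exp (-(p - 1) * (A + P - l)) =
      Complex.exp (-p * (A + P)) * (Complex.exp ((p - 1) * l) * Complex.exp l) := by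
    rw [← Complex.exp_add, ← Complex.exp_add, ← Complex.exp_add]; ring_nf
  have x4 : Complex.exp (-l) * Complex.exp l = 1 := by rw [← Complex.exp_add]; simp
  rw [x1, x2]
  generalize Complex.exp (-(A + P - l)) = e1 at *
  generalize Complex.exp (-(p - 1) * (A + P - l)) = e2 at *
  generalize Complex.exp (-p * (A + P)) = e3 at *
  generalize Complex.exp ((p - 1) * l) = e4 at *
  generalize Complex.exp (-l) = e5 at *
  generalize Complex.exp l = e6 at *
  field_simp
  linear_combination (κ * e5 * c * LSeries b p * Complex.Gamma (p - 1)) * x3 +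
    (-κ * LSeries b p * (p - 1) * Complex.Gamma (p - 1) * e3 * e4 +
      κ * c * LSeries b p * Complex.Gamma (p - 1) * e3 * e4) * x4

set_option maxHeartbeats 1000000 in
/-- The transformation behaviour of the Fourier series under `z ↦ -1 / z`. -/
theorem exists_norm_qSeries_sub_le (h : HasReflection F a b κ T) : ∃ K : ℝ, 0 ≤ K ∧
    ∀ z : ℂ, 0 < z.re → 0 < z.im → ‖z‖ ≤ 2 →
      ‖2 * Real.pi * qSeries a z - κ * z⁻¹ * (2 * Real.pi * qSeries b (-1 / z)) -
        boundaryTerm F T (mellinParam z)‖ ≤ K * (1 + (-1 / z).im ^ (-(1 / 4) : ℝ)) := by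
  have hT := h.one_le
  obtain ⟨c, C, hC, hr⟩ := h.reflect
  obtain ⟨U, hU, hU'⟩ := h.exists_norm_integral_upper_le
  have hb' : LSeriesSummable (fun n => b n / n) ((1 / 4 : ℝ) : ℂ) := by
    have := h.summable_right
    unfold LSeriesSummable at this ⊢
    rw [term_div_eq]
    convert this using 2
    push_cast; norm_num
  obtain ⟨K₁, hK₁, h₁⟩ := exists_norm_integral_Ioi_sub_le (by norm_num) h.summable_right
    (zero_le_one.trans hT)
  obtain ⟨K₂, hK₂, h₂⟩ := exists_norm_integral_Ioi_sub_le (by norm_num) hb' (zero_le_one.trans hT)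
  obtain ⟨K₃, hK₃, h₃⟩ := exists_norm_qSeries_div_le h.summable_right
  set J := ∫ t in Set.Ioi T, t ^ (-(5 / 4) : ℝ)
  have hJi : IntegrableOn (fun t : ℝ => t ^ (-(5 / 4) : ℝ)) (Set.Ioi T) :=
    integrableOn_Ioi_rpow_of_lt (by norm_num) (by linarith)
  have hJ : 0 ≤ J := setIntegral_nonneg measurableSet_Ioi fun t ht =>
    Real.rpow_nonneg (by have : T < t := ht; linarith) _
  -- `‖z‖ ≤ 2` gives `log ‖z‖ ≤ 1`, so `E` bounds `‖z‖^(1/4)` and `E'` bounds `(2π‖z‖)^(1/4)`.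
  set E := Real.exp (1 / 4)
  set E' := Real.exp (1 / 4 * (Real.log (2 * Real.pi) + 1))
  set κ' := ‖κ‖
  refine ⟨U * E' + C * E * J + κ' * (K₁ * E) + κ' * ‖c‖ * (K₂ * E) +
    κ' * ‖c‖ * (2 * Real.pi * K₃), by positivity, fun z hz1 hz2 hz3 => ?_⟩
  have hz : z ≠ 0 := by rintro rfl; simp at hz1
  have hlogre : (Complex.log z).re = Real.log ‖z‖ := Complex.log_re z
  have hnz : 0 < ‖z‖ := norm_pos_iff.2 hz
  have hlog1 : Real.log ‖z‖ ≤ 1 := by linarith [Real.log_le_sub_one_of_pos hnz]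
  have hlog2 : 0 ≤ Real.log (2 * Real.pi) := Real.log_nonneg (by linarith [Real.pi_gt_three])
  have harg1 : 0 < (Complex.log z).im := by
    rw [Complex.log_im]
    exact lt_of_le_of_ne (Complex.arg_nonneg_iff.2 hz2.le) fun h => by
      have := (Complex.arg_eq_zero_iff).1 h.symm
      exact hz2.ne' this.2
  have harg2 : (Complex.log z).im < Real.pi / 2 := by
    rw [Complex.log_im]
    exact (abs_lt.1 (Complex.abs_arg_lt_pi_div_two_iff.2 (Or.inl hz1))).2
  have eP : Complex.I * ((Real.pi : ℂ) / 2) = ((Real.pi / 2 : ℝ) : ℂ) * Complex.I := by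
    push_cast; ring
  set L := mellinParam z with hL
  set L' : ℂ := Real.log (2 * Real.pi) + Complex.I * (Real.pi / 2) - Complex.log z with hL'
  have hLre : L.re = Real.log (2 * Real.pi) + Real.log ‖z‖ := by
    rw [hL, mellinParam, eP, Complex.add_re, Complex.sub_re, hlogre, Complex.re_ofReal_mul]
    simp
  have hLim : L.im = (Complex.log z).im - Real.pi / 2 := by
    rw [hL, mellinParam, eP, Complex.add_im, Complex.sub_im, Complex.im_ofReal_mul,
      Complex.ofReal_im, Complex.I_im]
    ring
  have hLre' : L'.re = Real.log (2 * Real.pi) - Real.log ‖z‖ := by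
    rw [hL', eP, Complex.sub_re, Complex.add_re, hlogre, Complex.re_ofReal_mul]
    simp
  have hLim' : L'.im = Real.pi / 2 - (Complex.log z).im := by
    rw [hL', eP, Complex.sub_im, Complex.add_im, Complex.im_ofReal_mul,
      Complex.ofReal_im, Complex.I_im]
    ring
  have hexpI : Complex.exp (Complex.I * ((Real.pi : ℂ) / 2)) = Complex.I := by
    rw [mul_comm, Complex.exp_pi_div_two_mul_I]
  have hexp2 : Complex.exp (Real.log (2 * Real.pi) : ℂ) = 2 * Real.pi := by
    rw [← Complex.ofReal_exp, Real.exp_log (by positivity)]; push_cast; ring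
  have hexpL : Complex.exp L = -(2 * Real.pi * Complex.I * z) := by
    rw [hL, mellinParam, Complex.exp_add, Complex.exp_sub, Complex.exp_log hz, hexpI, hexp2,
      Complex.div_I]
    ring
  have hexpL' : Complex.exp L' = -(2 * Real.pi * Complex.I * (-1 / z)) := by
    rw [hL', Complex.exp_sub, Complex.exp_add, Complex.exp_log hz, hexpI, hexp2]
    ring
  have hLabs : |L.im| < Real.pi / 2 := by
    rw [hLim, abs_lt]; constructor <;> linarith
  have hLim1 : 0 ≤ L'.im := by rw [hLim']; linarith
  have hLim2 : L'.im < Real.pi / 2 := by rw [hLim']; linarith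
  have m1 := h.integral_eq_boundaryTerm_add hLabs
  have m2 : ∫ t : ℝ, mellinKernel (LSeries a) L ((5 / 4 : ℝ) + t * Complex.I) =
      2 * Real.pi * qSeries a z := by
    rw [← tsum_exp_eq_qSeries a hexpL, ← tsum_mul_left]
    exact (hasSum_integral_LSeries_mul_Gamma (by norm_num) h.summable_left hLabs).2.tsum_eq.symm
  have m3 := hU' L (by rw [hLim]; linarith) (by rw [hLim]; linarith)
  obtain ⟨i4, m4⟩ := h₁ L' hLim1 hLim2
  obtain ⟨i5, m5⟩ := h₂ L' hLim1 hLim2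
  rw [tsum_exp_eq_qSeries _ hexpL'] at m4
  rw [tsum_exp_eq_qSeries (fun n => b n / n) hexpL'] at m5
  have hzim : 0 < (-1 / z).im := by
    rw [neg_div, Complex.neg_im, one_div, Complex.inv_im, neg_div, neg_neg]
    exact div_pos hz2 (Complex.normSq_pos.2 hz)
  have m6 := h₃ (-1 / z) hzim
  set IX := ∫ t : ℝ in Set.Ioi T, mellinKernel (LSeries b) L' ((5 / 4 : ℝ) + t * Complex.I)
  set IY := ∫ t : ℝ in Set.Ioi T,
    mellinKernel (LSeries fun n => b n / n) L' ((1 / 4 : ℝ) + t * Complex.I)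
  set IU := ∫ t : ℝ in Set.Ioi T, mellinKernel F L ((-1 / 4 : ℝ) + t * Complex.I)
  set IL := ∫ t : ℝ in Set.Ioi T, mellinKernel F L ((-1 / 4 : ℝ) - t * Complex.I) with hIL
  have i7 := h.integrableOn_lower hLabs (x := -1 / 4) le_rfl (by norm_num)
  -- Points of the lower half of `Re s = -1/4` are `1 - p` with `p` on the upper half of `Re p =
  -- 5/4`. In the first quadrant `|exp ((p - 1) log z)| = ‖z‖^(1/4) exp (-t arg z)` is bounded, and
  -- the reflection error is integrable in `t`.
  have m7 : ‖IL - κ * z⁻¹ * (IX - c * Complex.exp (-L') * IY)‖ ≤ C * E * J := by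
    have e : IL - κ * z⁻¹ * (IX - c * Complex.exp (-L') * IY) =
        ∫ t : ℝ in Set.Ioi T, (mellinKernel F L ((-1 / 4 : ℝ) - t * Complex.I) -
          κ * z⁻¹ * (mellinKernel (LSeries b) L' ((5 / 4 : ℝ) + t * Complex.I) -
            c * Complex.exp (-L') *
            mellinKernel (LSeries fun n => b n / n) L' ((1 / 4 : ℝ) + t * Complex.I))) := by
      have i8 : IntegrableOn (fun t : ℝ =>
          mellinKernel (LSeries b) L' ((5 / 4 : ℝ) + t * Complex.I) - c * Complex.exp (-L') *
            mellinKernel (LSeries fun n => b n / n) L' ((1 / 4 : ℝ) + t * Complex.I)) (Set.Ioi T) :=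
        i4.sub (i5.const_mul _)
      rw [integral_sub i7 (i8.const_mul _), integral_const_mul,
        integral_sub i4 (i5.const_mul _), integral_const_mul]
    rw [e]
    refine (norm_integral_le_of_norm_le (g := fun t => C * E * t ^ (-(5 / 4) : ℝ))
      (hJi.const_mul _) ?_).trans_eq (integral_const_mul _ _)
    filter_upwards [ae_restrict_mem measurableSet_Ioi] with t ht
    have ht' : T < t := ht
    set p : ℂ := (5 / 4 : ℝ) + t * Complex.I with hp
    have e1 : ((-1 / 4 : ℝ) : ℂ) - t * Complex.I = 1 - p := by rw [hp]; push_cast; ring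
    have e2 : ((1 / 4 : ℝ) : ℂ) + t * Complex.I = p - 1 := by rw [hp]; push_cast; ring
    have hp1 : p ≠ 1 := by
      intro h
      have := congrArg Complex.im h
      simp [hp] at this
      linarith
    rw [e1, e2, mellinKernel_reflect hz p c hp1, norm_mul]
    have e3 : ‖Complex.exp ((p - 1) * Complex.log z)‖ ≤ E := by
      rw [Complex.norm_exp]
      refine Real.exp_le_exp.2 ?_
      rw [← e2, Complex.mul_re, hlogre]
      simp
      nlinarith
    calc _ ≤ C * t ^ (-(5 / 4) : ℝ) * E :=
          mul_le_mul (hr t p ht'.le hp) e3 (norm_nonneg _)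
            (mul_nonneg hC (Real.rpow_nonneg (by linarith) _))
      _ = _ := by ring
  have n1 : ‖z⁻¹‖ * Real.exp (-(5 / 4 * L'.re)) ≤ E := by
    rw [norm_inv, ← Real.exp_log hnz, ← Real.exp_neg, ← Real.exp_add, hLre']
    exact Real.exp_le_exp.2 (by linarith)
  have n2 : ‖z⁻¹ * Complex.exp (-L')‖ ≤ 1 := by
    rw [norm_mul, norm_inv, Complex.norm_exp, ← Real.exp_log hnz, ← Real.exp_neg, ← Real.exp_add,
      Complex.neg_re, hLre', Real.exp_le_one_iff]
    linarith
  have n3 : Real.exp (-(1 / 4 * L'.re)) ≤ E := by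
    rw [hLre']
    exact Real.exp_le_exp.2 (by linarith)
  have n4 : Real.exp (1 / 4 * L.re) ≤ E' := by
    rw [hLre]
    exact Real.exp_le_exp.2 (by linarith)
  set qa := qSeries a z
  set qb := qSeries b (-1 / z)
  set qg := qSeries (fun n => b n / n) (-1 / z)
  set y := (-1 / z).im ^ (-(1 / 4) : ℝ)
  have hy : 0 ≤ y := Real.rpow_nonneg hzim.le _
  rw [m2] at m1
  have hsum : 2 * Real.pi * qa - κ * z⁻¹ * (2 * Real.pi * qb) - boundaryTerm F T L =
      IU + (IL - κ * z⁻¹ * (IX - c * Complex.exp (-L') * IY)) +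
      κ * (z⁻¹ * (IX - 2 * Real.pi * qb)) -
      κ * c * ((z⁻¹ * Complex.exp (-L')) * (IY - 2 * Real.pi * qg)) -
      κ * c * ((z⁻¹ * Complex.exp (-L')) * (2 * Real.pi * qg)) := by
    rw [m1]; ring
  have t1 : ‖IU‖ ≤ U * E' := m3.trans (by gcongr)
  have t3 : ‖κ * (z⁻¹ * (IX - 2 * Real.pi * qb))‖ ≤ κ' * (K₁ * E) := by
    rw [norm_mul, norm_mul]
    refine mul_le_mul_of_nonneg_left ?_ (norm_nonneg _)
    calc ‖z⁻¹‖ * ‖IX - 2 * Real.pi * qb‖ ≤ ‖z⁻¹‖ * (K₁ * Real.exp (-(5 / 4 * L'.re))) := by gcongr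
      _ = K₁ * (‖z⁻¹‖ * Real.exp (-(5 / 4 * L'.re))) := by ring
      _ ≤ _ := by gcongr
  have t4 : ‖κ * c * ((z⁻¹ * Complex.exp (-L')) * (IY - 2 * Real.pi * qg))‖ ≤
      κ' * ‖c‖ * (K₂ * E) := by
    rw [norm_mul, norm_mul κ c, norm_mul (z⁻¹ * _)]
    refine mul_le_mul_of_nonneg_left ?_ (by positivity)
    calc _ ≤ 1 * (K₂ * Real.exp (-(1 / 4 * L'.re))) := by gcongr
      _ ≤ K₂ * E := by rw [one_mul]; gcongr
  have t5 : ‖κ * c * ((z⁻¹ * Complex.exp (-L')) * (2 * Real.pi * qg))‖ ≤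
      κ' * ‖c‖ * (2 * Real.pi * (K₃ * y)) := by
    rw [norm_mul, norm_mul κ c, norm_mul (z⁻¹ * _)]
    refine mul_le_mul_of_nonneg_left ?_ (by positivity)
    have : ‖(2 * Real.pi : ℂ)‖ = 2 * Real.pi := by
      rw [norm_mul, Complex.norm_real, Real.norm_of_nonneg Real.pi_pos.le, Complex.norm_ofNat]
    rw [norm_mul _ qg, this]
    calc _ ≤ 1 * (2 * Real.pi * (K₃ * y)) := by gcongr
      _ = _ := one_mul _
  rw [hsum]
  have tri := norm_sub_le (IU + (IL - κ * z⁻¹ * (IX - c * Complex.exp (-L') * IY)) +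
      κ * (z⁻¹ * (IX - 2 * Real.pi * qb)) -
      κ * c * ((z⁻¹ * Complex.exp (-L')) * (IY - 2 * Real.pi * qg)))
      (κ * c * ((z⁻¹ * Complex.exp (-L')) * (2 * Real.pi * qg)))
  have tri2 := norm_sub_le (IU + (IL - κ * z⁻¹ * (IX - c * Complex.exp (-L') * IY)) +
      κ * (z⁻¹ * (IX - 2 * Real.pi * qb)))
      (κ * c * ((z⁻¹ * Complex.exp (-L')) * (IY - 2 * Real.pi * qg)))
  have tri3 := norm_add₃_le (a := IU) (b := IL - κ * z⁻¹ * (IX - c * Complex.exp (-L') * IY))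
      (c := κ * (z⁻¹ * (IX - 2 * Real.pi * qb)))
  have f1 : 0 ≤ U * E' + C * E * J + κ' * (K₁ * E) + κ' * ‖c‖ * (K₂ * E) := by positivity
  have f2 : 0 ≤ κ' * ‖c‖ * (2 * Real.pi * K₃) := by positivity
  have f3 : κ' * ‖c‖ * (2 * Real.pi * (K₃ * y)) = κ' * ‖c‖ * (2 * Real.pi * K₃) * y := by ring
  rw [f3] at t5
  refine (tri.trans (add_le_add (tri2.trans (add_le_add (tri3.trans (add_le_add
    (add_le_add t1 m7) t3)) t4)) t5)).trans ?_
  generalize U * E' + C * E * J + κ' * (K₁ * E) + κ' * ‖c‖ * (K₂ * E) = S at f1 ⊢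
  generalize κ' * ‖c‖ * (2 * Real.pi * K₃) = R at f2 ⊢
  nlinarith [mul_nonneg f1 hy]

end HasReflection

/-! ### The dual data -/

/-- The gamma factor `conj (γ (conj s))`. -/
def GammaFactor.dual (γ : GammaFactor) : GammaFactor where
  r := γ.r
  Q := γ.Q
  lam := γ.lam
  mu := fun j => conj (γ.mu j)
  Q_pos := γ.Q_pos
  lam_pos := γ.lam_pos
  mu_re_nonneg := fun j => by simpa using γ.mu_re_nonneg j

namespace GammaFactor

variable (γ : GammaFactor)

lemma dual_degree : γ.dual.degree = γ.degree := rfl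

lemma dual_xi : γ.dual.xi = conj γ.xi := by
  simp only [xi, dual, map_mul, map_sum, map_sub, map_div₀, map_one, Complex.conj_ofNat]
  rfl

lemma dual_theta : γ.dual.theta = -γ.theta := by
  rw [theta, theta, dual_xi, dual_degree, Complex.conj_im, neg_div]

lemma dual_eval (s : ℂ) : γ.dual.eval s = conj (γ.eval (conj s)) := by
  have h := γ.conj_eval (1 - s)
  rw [sub_sub_cancel] at h
  rw [h]
  rfl

lemma dual_regularAt (s : ℂ) : γ.dual.RegularAt s ↔ γ.RegularAt (conj s) := by
  refine forall_congr' fun j => forall_congr' fun k => not_congr ?_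
  rw [← (starRingEnd ℂ).injective.eq_iff]
  simp [dual]

lemma kappa_ne_zero {ω : ℂ} (hω : ω ≠ 0) (ε : ℝ) : γ.kappa ω ε ≠ 0 := by
  refine mul_ne_zero (mul_ne_zero (mul_ne_zero hω (Finset.prod_ne_zero_iff.2 fun j _ => ?_))
    Complex.I_ne_zero) (Complex.exp_ne_zero _)
  rw [Ne, Complex.cpow_eq_zero_iff]
  exact fun h => (γ.lam_pos j).ne' (by exact_mod_cast h.1)

end GammaFactor

lemma norm_conj_eq (z : ℂ) : ‖conj z‖ = ‖z‖ := RCLike.norm_conj z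

lemma differentiable_conj_conj {f : ℂ → ℂ} (hf : Differentiable ℂ f) :
    Differentiable ℂ fun s => conj (f (conj s)) := fun s => by
  have := (hf (conj s)).conj_conj
  rwa [Complex.conj_conj] at this

namespace IsExtendedSelberg

variable {F : ℂ → ℂ} {a : ℕ → ℂ} {γ : GammaFactor} {ω : ℂ}

theorem dual (hF : IsExtendedSelberg F a γ ω) :
    IsExtendedSelberg (fun s => conj (F (conj s))) (fun n => conj (a n)) γ.dual (conj ω) where
  nonzero := by
    obtain ⟨n, hn, h⟩ := hF.nonzero
    exact ⟨n, hn, by simpa using h⟩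
  summable := fun s hs => lseriesSummable_conj (hF.summable s hs)
  eq_LSeries := fun s hs => hF.conj_eq_LSeries hs
  continuation := by
    obtain ⟨m, hm, ρ, C, h⟩ := hF.continuation
    have e : ∀ s : ℂ, conj ((conj s - 1) ^ m * F (conj s)) = (s - 1) ^ m * conj (F (conj s)) := by
      intro s; simp
    refine ⟨m, ?_, ρ, C, fun s => ?_⟩
    · simpa only [e] using differentiable_conj_conj hm
    · rw [← e, norm_conj_eq]
      simpa using h (conj s)
  norm_omega := by rw [norm_conj_eq, hF.norm_omega]
  functional_equation := fun s h0 h1 hr hr' => by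
    rw [γ.dual_regularAt] at hr hr'
    have := congrArg conj (hF.functional_equation (conj s) (by simpa using h0)
      (fun h => h1 (by rw [← Complex.conj_conj s, h, map_one])) hr (by simpa using hr'))
    simp only [map_mul, map_sub, map_one, Complex.conj_conj] at this ⊢
    rw [γ.dual_eval, γ.dual_eval, this]
    simp

/-- At `s = 1 - p` the imaginary part is negative, hence `ε = 1`. Replacing `feQuotient` by `1 +
c/s` costs `O(t⁻²)`, while the kernel at `p` is `O(t^(3/4))` because its exponentials cancel. The
product `t^(-5/4)` is integrable. Without the term `c/s` the bound would only be `t^(-1/4)`. -/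
theorem exists_hasReflection (hF : IsExtendedSelberg F a γ ω)
    (hdeg : γ.degree = 2) (hcond : γ.conductor = 1) (hθ : γ.theta = 0) :
    ∃ T : ℝ, HasReflection F a (fun n => conj (a n)) (γ.kappa ω 1) T := by
  have h54 : 1 < (((5 / 4 : ℝ) : ℂ)).re := by rw [Complex.ofReal_re]; norm_num
  obtain ⟨C₁, N, hC₁, hgr⟩ := hF.exists_norm_le_strip hdeg hcond hθ
  obtain ⟨T₁, hT₁, h₁⟩ := hF.exists_asymptotic_functional_equation hdeg hcond hθ (-1 / 4) (-1 / 4)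
  obtain ⟨G, T₂, hG, hT₂, h₂⟩ := exists_norm_Gamma_le (-1 / 4) (5 / 4)
  obtain ⟨c, hc⟩ := γ.hasJet_feQuotient (-1 / 4) (-1 / 4)
  obtain ⟨M, hM, hcb⟩ := IsBigO.exists_pos hc
  obtain ⟨T₃, h₃⟩ := eventually_stripAtInf.1 hcb.bound
  obtain ⟨D, hD, hD'⟩ := norm_LSeries_le (lseriesSummable_conj (hF.summable _ h54))
  have hTb : 1 ≤ max T₁ (max T₂ T₃) := hT₁.trans (le_max_left _ _)
  refine ⟨max T₁ (max T₂ T₃), hTb, hF.summable _ h54, lseriesSummable_conj (hF.summable _ h54),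
    fun s hs => hF.differentiableAt hs, fun t => hF.eq_LSeries _ ?_,
    ⟨C₁ * G, N + 1, by positivity, fun s hs hs1 hs2 => ?_⟩,
    ⟨c, ‖γ.kappa ω 1‖ * M * D * G, by positivity, fun t p ht hp => ?_⟩⟩
  · simp; norm_num
  · have him : 1 ≤ |s.im| := hTb.trans hs
    have h4 := h₂ s (((le_max_left _ _).trans (le_max_right _ _)).trans hs) hs1 hs2
    have h5 : |s.im| ^ (s.re - 1 / 2) ≤ |s.im| := by
      calc |s.im| ^ (s.re - 1 / 2) ≤ |s.im| ^ (1 : ℝ) :=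
            Real.rpow_le_rpow_of_exponent_le him (by linarith)
        _ = _ := Real.rpow_one _
    rw [norm_mul]
    calc _ ≤ (C₁ * |s.im| ^ N) * (G * |s.im| * Real.exp (-(Real.pi / 2 * |s.im|))) := by
          refine mul_le_mul (hgr s him hs1 hs2) (h4.trans ?_) (norm_nonneg _) (by positivity)
          gcongr
      _ = _ := by ring
  · have ht0 : 0 < t := by linarith
    have hpre : p.re = 5 / 4 := by rw [hp]; simp
    have hpim : p.im = t := by rw [hp]; simp
    have hs1 : (1 - p).re = -1 / 4 := by rw [Complex.sub_re, hpre, Complex.one_re]; norm_num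
    have hs2 : (1 - p).im = -t := by rw [Complex.sub_im, hpim, Complex.one_im]; ring
    have hs3 : |(1 - p).im| = t := by rw [hs2, abs_neg, abs_of_pos ht0]
    have hp0 : p - 1 ≠ 0 := by
      intro h
      have := congrArg Complex.im h
      simp [hpim] at this
      linarith
    have hp0' : 1 - p ≠ 0 := by rw [← neg_sub]; exact neg_ne_zero.2 hp0
    have hfe := h₁ 1 (1 - p) (by rw [hs3]; exact (le_max_left _ _).trans ht) hs1.ge hs1.le
      (log_neg_of_im_neg (by rw [hs2]; linarith))
    rw [sub_sub_cancel, hF.conj_eq_LSeries (by rw [hpre]; norm_num)] at hfe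
    have e : mellinKernel F (Real.log (2 * Real.pi) - Complex.I * (Real.pi / 2)) (1 - p) -
      γ.kappa ω 1 * (1 - c / (p - 1)) * mellinKernel (LSeries fun n => conj (a n))
        (Real.log (2 * Real.pi) + Complex.I * (Real.pi / 2)) p =
      γ.kappa ω 1 * (γ.feQuotient (1 - p) - (1 + c * (1 - p)⁻¹)) *
        mellinKernel (LSeries fun n => conj (a n))
        (Real.log (2 * Real.pi) + Complex.I * (Real.pi / 2)) p := by
      have : c / (p - 1) = -(c * (1 - p)⁻¹) := by
        rw [← neg_sub, div_neg, div_eq_mul_inv]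
      rw [mellinKernel, hfe, mellinKernel, this]
      ring
    have b1 := h₃ (1 - p) (by rw [hs3]; exact ((le_max_right _ _).trans (le_max_right _ _)).trans ht)
      hs1.ge hs1.le
    have b2 : ‖(1 - p)⁻¹ ^ 2‖ ≤ t ^ (-2 : ℝ) := by
      rw [norm_pow, norm_inv, Real.rpow_neg ht0.le, inv_pow, Real.rpow_two]
      gcongr
      rw [← hs3]
      exact Complex.abs_im_le_norm _
    have b3 := h₂ p (by rw [hpim, abs_of_pos ht0]; exact ((le_max_left _ _).trans (le_max_right _ _)).trans ht)
      (by rw [hpre]; norm_num) hpre.le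
    rw [hpim, hpre, abs_of_pos ht0] at b3
    have b4 : ‖Complex.exp (-p * (Real.log (2 * Real.pi) + Complex.I * (Real.pi / 2)))‖ ≤
        Real.exp (Real.pi / 2 * t) := by
      have eP : (Real.log (2 * Real.pi) + Complex.I * (Real.pi / 2) : ℂ) =
        (Real.log (2 * Real.pi) : ℂ) + ((Real.pi / 2 : ℝ) : ℂ) * Complex.I := by push_cast; ring
      rw [norm_exp_neg_mul, hpre, hpim, eP]
      refine Real.exp_le_exp.2 ?_
      have hlog2 : 0 ≤ Real.log (2 * Real.pi) := Real.log_nonneg (by linarith [Real.pi_gt_three])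
      rw [Complex.add_re, Complex.add_im, Complex.re_ofReal_mul, Complex.im_ofReal_mul,
        Complex.ofReal_re, Complex.ofReal_im, Complex.I_re, Complex.I_im]
      linarith
    have b5 : ‖LSeries (fun n => conj (a n)) p‖ ≤ D := hD' p (by rw [hpre])
    have hexp : Real.exp (-(Real.pi / 2 * t)) * Real.exp (Real.pi / 2 * t) = 1 := by
      rw [← Real.exp_add]; simp
    have hpow : t ^ (-(5 / 4) : ℝ) = t ^ (-2 : ℝ) * t ^ (5 / 4 - 1 / 2 : ℝ) := by
      rw [← Real.rpow_add ht0]; norm_num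
    rw [e, norm_mul, norm_mul, mellinKernel, norm_mul, norm_mul]
    calc _ ≤ ‖γ.kappa ω 1‖ * (M * t ^ (-2 : ℝ)) * (D * (G * t ^ (5 / 4 - 1 / 2 : ℝ) *
          Real.exp (-(Real.pi / 2 * t)) * Real.exp (Real.pi / 2 * t))) := by
          gcongr
          exact b1.trans (by gcongr)
      _ = ‖γ.kappa ω 1‖ * M * D * G * (t ^ (-2 : ℝ) * t ^ (5 / 4 - 1 / 2 : ℝ)) *
          (Real.exp (-(Real.pi / 2 * t)) * Real.exp (Real.pi / 2 * t)) := by ring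
      _ = _ := by rw [hexp, mul_one, hpow]

end IsExtendedSelberg

/-! ### The boundary term near a cusp -/

/-- Multiplied by `exp L`, the integrand involves `exp ((1 - σ) L)`. As `Re σ ≤ 5/4` and `Re L ≤ 0`,
its modulus is at most a constant times `exp (-Re L / 4)`. Passing from `L` to `L'` multiplies it by
`exp ((1 - σ)(L' - L))`, which differs from 1 by `O(‖L - L'‖)`. -/
lemma exists_path_bounds {f σ : ℝ → ℂ} {α β : ℝ} (hαβ : α ≤ β) (hf : ContinuousOn f (Set.Icc α β))
    (hσ : Continuous σ) (hre : ∀ t ∈ Set.Icc α β, (σ t).re ≤ 5 / 4) :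
    ∃ K M : ℝ, 0 ≤ K ∧ 0 ≤ M ∧
      (∀ L : ℂ, ‖∫ t in α..β, f t * Complex.exp (-σ t * L)‖ ≤ K * Real.exp (M * ‖L‖)) ∧
      ∀ L L' : ℂ, L.re ≤ 0 → |L.im| ≤ Real.pi → M * ‖L - L'‖ ≤ 1 →
        ‖Complex.exp L * (∫ t in α..β, f t * Complex.exp (-σ t * L)) -
          Complex.exp L' * (∫ t in α..β, f t * Complex.exp (-σ t * L'))‖ ≤
        K * Real.exp (-(1 / 4 * L.re)) * ‖L - L'‖ := by
  obtain ⟨P, hP⟩ := (isCompact_Icc (a := α) (b := β)).exists_bound_of_continuousOn hf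
  obtain ⟨M, hM⟩ := (isCompact_Icc (a := α) (b := β)).exists_bound_of_continuousOn hσ.continuousOn
  have hα : α ∈ Set.Icc α β := ⟨le_rfl, hαβ⟩
  have hP0 : 0 ≤ P := (norm_nonneg _).trans (hP α hα)
  have hM0 : 0 ≤ M := (norm_nonneg _).trans (hM α hα)
  have hβα : 0 ≤ β - α := sub_nonneg.2 hαβ
  refine ⟨P * (β - α) + P * Real.exp ((M + 1) * Real.pi) * (2 * (M + 1)) * (β - α), M + 1,
    by positivity, by positivity, fun L => ?_, fun L L' h1 h2 h3 => ?_⟩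
  · have := intervalIntegral.norm_integral_le_of_norm_le_const (a := α) (b := β)
      (f := fun t => f t * Complex.exp (-σ t * L)) (C := P * Real.exp ((M + 1) * ‖L‖))
      (fun t ht => by
        rw [Set.uIoc_of_le hαβ] at ht
        have ht' : t ∈ Set.Icc α β := ⟨ht.1.le, ht.2⟩
        rw [norm_mul]
        refine mul_le_mul (hP t ht') ((Complex.norm_exp_le_exp_norm _).trans ?_) (norm_nonneg _) hP0
        rw [norm_mul, norm_neg]
        gcongr
        linarith [hM t ht'])
    rw [abs_of_nonneg hβα] at this
    refine this.trans ?_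
    have h0 : 0 ≤ P * Real.exp ((M + 1) * Real.pi) * (2 * (M + 1)) * (β - α) *
      Real.exp ((M + 1) * ‖L‖) := by positivity
    linarith
  · have hint : ∀ L : ℂ, IntervalIntegrable (fun t => f t * Complex.exp (-σ t * L)) volume α β :=
      fun L => ContinuousOn.intervalIntegrable (by
        rw [Set.uIcc_of_le hαβ]
        exact hf.mul (by fun_prop))
    rw [← intervalIntegral.integral_const_mul, ← intervalIntegral.integral_const_mul,
      ← intervalIntegral.integral_sub ((hint L).const_mul _) ((hint L').const_mul _)]
    have := intervalIntegral.norm_integral_le_of_norm_le_const (a := α) (b := β)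
      (f := fun t => Complex.exp L * (f t * Complex.exp (-σ t * L)) -
        Complex.exp L' * (f t * Complex.exp (-σ t * L')))
      (C := P * Real.exp ((M + 1) * Real.pi) * (2 * (M + 1)) * Real.exp (-(1 / 4 * L.re)) * ‖L - L'‖)
      (fun t ht => by
        rw [Set.uIoc_of_le hαβ] at ht
        have ht' : t ∈ Set.Icc α β := ⟨ht.1.le, ht.2⟩
        have e : Complex.exp L * (f t * Complex.exp (-σ t * L)) -
            Complex.exp L' * (f t * Complex.exp (-σ t * L')) =
            -(f t * Complex.exp ((1 - σ t) * L) * (Complex.exp ((1 - σ t) * (L' - L)) - 1)) := by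
          have e1 : Complex.exp L * Complex.exp (-σ t * L) = Complex.exp ((1 - σ t) * L) := by
            rw [← Complex.exp_add]; ring_nf
          have e2 : Complex.exp L' * Complex.exp (-σ t * L') =
              Complex.exp ((1 - σ t) * L) * Complex.exp ((1 - σ t) * (L' - L)) := by
            rw [← Complex.exp_add, ← Complex.exp_add]; ring_nf
          linear_combination f t * e1 - f t * e2
        have hσn : ‖1 - σ t‖ ≤ M + 1 := by
          refine (norm_sub_le _ _).trans ?_
          rw [norm_one]; linarith [hM t ht']
        have hw : ‖(1 - σ t) * (L' - L)‖ ≤ (M + 1) * ‖L - L'‖ := by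
          rw [norm_mul, norm_sub_rev L' L]; gcongr
        have b1 : ‖Complex.exp ((1 - σ t) * (L' - L)) - 1‖ ≤ 2 * ((M + 1) * ‖L - L'‖) :=
          (Complex.norm_exp_sub_one_le (hw.trans h3)).trans (by gcongr)
        have b2 : ‖Complex.exp ((1 - σ t) * L)‖ ≤
            Real.exp (-(1 / 4 * L.re)) * Real.exp ((M + 1) * Real.pi) := by
          rw [Complex.norm_exp, ← Real.exp_add]
          refine Real.exp_le_exp.2 ?_
          have c1 : (1 - (σ t).re) * L.re ≤ -(1 / 4 * L.re) := by nlinarith [hre t ht']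
          have c2 : (σ t).im * L.im ≤ (M + 1) * Real.pi := by
            refine (le_abs_self _).trans ?_
            rw [abs_mul]
            exact mul_le_mul (by linarith [hM t ht', Complex.abs_im_le_norm (σ t)]) h2
              (abs_nonneg _) (by positivity)
          simp only [Complex.mul_re, Complex.sub_re, Complex.one_re, Complex.sub_im, Complex.one_im]
          linarith
        rw [e, norm_neg, norm_mul, norm_mul]
        calc _ ≤ P * (Real.exp (-(1 / 4 * L.re)) * Real.exp ((M + 1) * Real.pi)) *
              (2 * ((M + 1) * ‖L - L'‖)) := by
              gcongr
              exact hP t ht'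
          _ = _ := by ring)
    rw [abs_of_nonneg hβα] at this
    refine this.trans ?_
    have h0 : 0 ≤ P * (β - α) * Real.exp (-(1 / 4 * L.re)) * ‖L - L'‖ := by positivity
    linarith

lemma HasReflection.exists_boundaryTerm_bounds {F : ℂ → ℂ} {a b : ℕ → ℂ} {κ : ℂ} {T : ℝ}
    (h : HasReflection F a b κ T) : ∃ K M : ℝ, 0 ≤ K ∧ 0 ≤ M ∧
      (∀ L : ℂ, ‖boundaryTerm F T L‖ ≤ K * Real.exp (M * ‖L‖)) ∧
      ∀ L L' : ℂ, L.re ≤ 0 → |L.im| ≤ Real.pi → M * ‖L - L'‖ ≤ 1 →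
        ‖Complex.exp L * boundaryTerm F T L - Complex.exp L' * boundaryTerm F T L'‖ ≤
        K * Real.exp (-(1 / 4 * L.re)) * ‖L - L'‖ := by
  have hT := h.one_le
  set f : ℂ → ℂ := fun s => F s * Complex.Gamma s with hf
  have hfc : ∀ s : ℂ, s.im ≠ 0 → ContinuousAt f s := fun s hs => by
    have h1 : s ≠ 1 := by rintro rfl; simp at hs
    have h2 : ∀ m : ℕ, s ≠ -m := by rintro m rfl; simp at hs
    exact ((h.differentiableAt s h1).mul (Complex.differentiableAt_Gamma s h2)).continuousAt
  have hfr : ∀ s : ℂ, 1 < s.re → ContinuousAt f s := fun s hs => by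
    have h1 : s ≠ 1 := by rintro rfl; simp at hs
    have h2 : ∀ m : ℕ, s ≠ -m := by
      rintro m rfl
      simp at hs
      linarith [(Nat.cast_nonneg m : (0 : ℝ) ≤ m)]
    exact ((h.differentiableAt s h1).mul (Complex.differentiableAt_Gamma s h2)).continuousAt
  have hker : ∀ L s, mellinKernel F L s = f s * Complex.exp (-s * L) := fun L s => by
    rw [mellinKernel, hf, mul_assoc]
  obtain ⟨K₁, M₁, hK₁, hM₁, p₁, q₁⟩ := exists_path_bounds (α := -1 / 4) (β := 5 / 4) (by norm_num)
    (f := fun x : ℝ => f (x + T * Complex.I)) (σ := fun x : ℝ => x + T * Complex.I)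
    (fun x hx => (ContinuousAt.comp (f := fun x : ℝ => (x + T * Complex.I : ℂ))
      (hfc _ (by simp; linarith)) (by fun_prop)).continuousWithinAt) (by fun_prop)
    (fun t ht => by simpa using ht.2)
  obtain ⟨K₂, M₂, hK₂, hM₂, p₂, q₂⟩ := exists_path_bounds (α := -T) (β := T) (by linarith)
    (f := fun t : ℝ => f ((5 / 4 : ℝ) + t * Complex.I))
    (σ := fun t : ℝ => (5 / 4 : ℝ) + t * Complex.I)
    (fun x hx => (ContinuousAt.comp (f := fun t : ℝ => ((5 / 4 : ℝ) + t * Complex.I : ℂ))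
      (hfr _ (by simp; norm_num)) (by fun_prop)).continuousWithinAt) (by fun_prop)
    (fun t ht => by simp)
  obtain ⟨K₃, M₃, hK₃, hM₃, p₃, q₃⟩ := exists_path_bounds (α := -1 / 4) (β := 5 / 4) (by norm_num)
    (f := fun x : ℝ => f (x - T * Complex.I)) (σ := fun x : ℝ => x - T * Complex.I)
    (fun x hx => (ContinuousAt.comp (f := fun x : ℝ => (x - T * Complex.I : ℂ))
      (hfc _ (by simp; linarith)) (by fun_prop)).continuousWithinAt) (by fun_prop)
    (fun t ht => by simpa using ht.2)
  refine ⟨K₁ + K₂ + K₃, M₁ + M₂ + M₃, by positivity, by positivity, fun L => ?_,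
    fun L L' h1 h2 h3 => ?_⟩
  · simp only [boundaryTerm, hker]
    refine (norm_sub_le _ _).trans ((add_le_add_left (norm_add_le _ _) _).trans ?_)
    rw [norm_mul, norm_mul, Complex.norm_I, one_mul, one_mul, add_mul, add_mul]
    refine add_le_add (add_le_add ((p₁ L).trans ?_) ((p₂ L).trans ?_)) ((p₃ L).trans ?_)
    all_goals gcongr; linarith
  · have hn := norm_nonneg (L - L')
    have u₁ := q₁ L L' h1 h2 (le_trans (by gcongr; linarith) h3)
    have u₂ := q₂ L L' h1 h2 (le_trans (by gcongr; linarith) h3)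
    have u₃ := q₃ L L' h1 h2 (le_trans (by gcongr; linarith) h3)
    have e : Complex.exp L * boundaryTerm F T L - Complex.exp L' * boundaryTerm F T L' =
      Complex.I * (Complex.exp L * (∫ x : ℝ in (-1 / 4)..(5 / 4), f (x + T * Complex.I) *
          Complex.exp (-(x + T * Complex.I) * L)) -
        Complex.exp L' * (∫ x : ℝ in (-1 / 4)..(5 / 4), f (x + T * Complex.I) *
          Complex.exp (-(x + T * Complex.I) * L'))) +
      (Complex.exp L * (∫ t : ℝ in (-T)..T, f ((5 / 4 : ℝ) + t * Complex.I) *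
          Complex.exp (-((5 / 4 : ℝ) + t * Complex.I) * L)) -
        Complex.exp L' * (∫ t : ℝ in (-T)..T, f ((5 / 4 : ℝ) + t * Complex.I) *
          Complex.exp (-((5 / 4 : ℝ) + t * Complex.I) * L'))) -
      Complex.I * (Complex.exp L * (∫ x : ℝ in (-1 / 4)..(5 / 4), f (x - T * Complex.I) *
          Complex.exp (-(x - T * Complex.I) * L)) -
        Complex.exp L' * (∫ x : ℝ in (-1 / 4)..(5 / 4), f (x - T * Complex.I) *
          Complex.exp (-(x - T * Complex.I) * L'))) := by
      simp only [boundaryTerm, hker]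
      ring
    rw [e]
    refine (norm_sub_le _ _).trans ((add_le_add_left (norm_add_le _ _) _).trans ?_)
    rw [norm_mul, norm_mul, Complex.norm_I, one_mul, one_mul]
    refine (add_le_add (add_le_add u₁ u₂) u₃).trans_eq ?_
    ring

/-! ### Points tending to a cusp -/

/-- The image of `w - n` under `z ↦ -1 / z`. -/
noncomputable def cuspPoint (w : ℂ) (n : ℕ) : ℂ := -1 / (w - n)

lemma cuspPoint_eq_inv (w : ℂ) (n : ℕ) : cuspPoint w n = ((n : ℂ) - w)⁻¹ := by
  rw [cuspPoint, ← neg_sub, neg_div_neg_eq, one_div]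

lemma sub_natCast_ne_zero {w : ℂ} (hw : 0 < w.im) (n : ℕ) : w - n ≠ 0 := by
  intro h
  have := congrArg Complex.im h
  simp at this
  exact hw.ne' this

lemma cuspPoint_ne_zero {w : ℂ} (hw : 0 < w.im) (n : ℕ) : cuspPoint w n ≠ 0 :=
  div_ne_zero (by simp) (sub_natCast_ne_zero hw n)

lemma cuspPoint_im {w : ℂ} (n : ℕ) : (cuspPoint w n).im = w.im / ‖w - n‖ ^ 2 := by
  rw [cuspPoint, neg_div, Complex.neg_im, one_div, Complex.inv_im, neg_div, neg_neg,
    Complex.sq_norm]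
  simp

lemma cuspPoint_im_pos {w : ℂ} (hw : 0 < w.im) (n : ℕ) : 0 < (cuspPoint w n).im := by
  rw [cuspPoint_im]
  have := norm_pos_iff.2 (sub_natCast_ne_zero hw n)
  positivity

lemma cuspPoint_re_pos {w : ℂ} {n : ℕ} (hn : w.re < n) : 0 < (cuspPoint w n).re := by
  rw [cuspPoint_eq_inv, Complex.inv_re]
  have h : 0 < ((n : ℂ) - w).re := by simpa using hn
  exact div_pos h (Complex.normSq_pos.2 fun h0 => by simp [h0] at h)

lemma neg_one_div_cuspPoint {w : ℂ} (hw : 0 < w.im) (n : ℕ) : -1 / cuspPoint w n = w - n := by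
  have := sub_natCast_ne_zero hw n
  rw [cuspPoint]; field_simp

lemma half_le_norm_sub {w : ℂ} {n : ℕ} (hn : 2 * ‖w‖ ≤ n) : (n : ℝ) / 2 ≤ ‖w - n‖ := by
  have := norm_sub_norm_le (n : ℂ) w
  rw [norm_sub_rev, Complex.norm_natCast] at this
  linarith

lemma norm_cuspPoint_le {w : ℂ} {n : ℕ} (hn : 2 * ‖w‖ ≤ n) (hn0 : 0 < n) :
    ‖cuspPoint w n‖ ≤ 2 / n := by
  have h1 := half_le_norm_sub hn
  have h2 : (0 : ℝ) < n := by exact_mod_cast hn0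
  rw [cuspPoint, norm_div, norm_neg, norm_one, div_le_div_iff₀ (by linarith) h2]
  linarith

lemma tendsto_cuspPoint (w : ℂ) : Tendsto (cuspPoint w) atTop (𝓝 0) := by
  refine squeeze_zero_norm' (a := fun n : ℕ => 2 / (n : ℝ)) ?_
    (tendsto_const_div_atTop_nhds_zero_nat 2)
  filter_upwards [tendsto_natCast_atTop_atTop.eventually_ge_atTop (2 * ‖w‖), eventually_gt_atTop 0]
    with n h1 h2
  exact norm_cuspPoint_le h1 h2

/-- The point is `1/(n - w) = n⁻¹ (1 - w/n)⁻¹`, so its logarithm depends on `w` only to order `1/n`.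
-/
lemma norm_log_cuspPoint_le {w : ℂ} {n : ℕ} (hn : 2 * ‖w‖ ≤ n) (hn0 : 0 < n) :
    ‖Complex.log (cuspPoint w n) + Real.log n‖ ≤ 3 / 2 * (‖w‖ / n) := by
  have h2 : (0 : ℝ) < n := by exact_mod_cast hn0
  have h2' : (n : ℂ) ≠ 0 := by exact_mod_cast hn0.ne'
  have h3 : ‖-w / n‖ ≤ 1 / 2 := by
    rw [norm_div, norm_neg, Complex.norm_natCast, div_le_iff₀ h2]; linarith
  have h4 : (n : ℂ) - w = ((n : ℝ) : ℂ) * (1 + -w / n) := by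
    push_cast; field_simp; ring
  have h5 : 0 < (1 + -w / n).re := by
    have := (abs_le.1 ((Complex.abs_re_le_norm (-w / n)).trans h3)).1
    rw [Complex.add_re, Complex.one_re]; linarith
  have h6 : 1 + -w / n ≠ 0 := fun h => by simp [h] at h5
  have h7 : ((n : ℂ) - w).arg ≠ Real.pi := by
    rw [h4, Complex.arg_real_mul _ h2]
    have := (abs_lt.1 (Complex.abs_arg_lt_pi_div_two_iff.2 (Or.inl h5))).2
    linarith [Real.pi_pos]
  rw [cuspPoint_eq_inv, Complex.log_inv _ h7, h4, Complex.log_ofReal_mul h2 h6]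
  have e : -((Real.log n : ℂ) + Complex.log (1 + -w / n)) + Real.log n =
    -Complex.log (1 + -w / n) := by ring
  rw [e, norm_neg]
  refine (Complex.norm_log_one_add_half_le_self h3).trans_eq ?_
  rw [norm_div, norm_neg, Complex.norm_natCast]

lemma exp_mellinParam {z : ℂ} (hz : z ≠ 0) :
    Complex.exp (mellinParam z) = -(2 * Real.pi * Complex.I) * z := by
  rw [mellinParam, Complex.exp_add, Complex.exp_sub, Complex.exp_log hz,
    ← Complex.ofReal_exp, Real.exp_log (by positivity), mul_comm Complex.I,
    Complex.exp_pi_div_two_mul_I, Complex.div_I]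
  push_cast; ring

lemma mellinParam_re (z : ℂ) : (mellinParam z).re = Real.log (2 * Real.pi) + (Complex.log z).re := by
  have eP : Complex.I * ((Real.pi : ℂ) / 2) = ((Real.pi / 2 : ℝ) : ℂ) * Complex.I := by
    push_cast; ring
  rw [mellinParam, eP, Complex.add_re, Complex.sub_re, Complex.re_ofReal_mul]
  simp

lemma mellinParam_im (z : ℂ) : (mellinParam z).im = Complex.arg z - Real.pi / 2 := by
  have eP : Complex.I * ((Real.pi : ℂ) / 2) = ((Real.pi / 2 : ℝ) : ℂ) * Complex.I := by
    push_cast; ring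
  rw [mellinParam, eP, Complex.add_im, Complex.sub_im, Complex.im_ofReal_mul, Complex.log_im,
    Complex.ofReal_im, Complex.I_im]
  ring

/-- The boundary term need not be small near the cusp, but it hardly depends on `w`: the two
parameters differ by `O(1/n)` and the weight is `O(n^(1/4))`, which gives `O(n^(-3/4))`. The factor
`cuspPoint` is `exp (mellinParam _)` up to the constant `-2πi`. -/
lemma HasReflection.tendsto_boundaryTerm_sub {F : ℂ → ℂ} {a b : ℕ → ℂ} {κ : ℂ} {T : ℝ}
    (h : HasReflection F a b κ T) {w w' : ℂ} (hw : 0 < w.im) (hw' : 0 < w'.im) :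
    Tendsto (fun n => cuspPoint w n * boundaryTerm F T (mellinParam (cuspPoint w n)) -
      cuspPoint w' n * boundaryTerm F T (mellinParam (cuspPoint w' n))) atTop (𝓝 0) := by
  obtain ⟨K, M, hK, hM, -, hB⟩ := h.exists_boundaryTerm_bounds
  set c := 3 / 2 * (‖w‖ + ‖w'‖) with hc
  have hlim : Tendsto (fun n : ℕ => K * Real.exp 1 * c * (n : ℝ) ^ (-(3 / 4) : ℝ)) atTop (𝓝 0) := by
    rw [← mul_zero (K * Real.exp 1 * c)]
    exact ((tendsto_rpow_neg_atTop (by norm_num)).comp tendsto_natCast_atTop_atTop).const_mul _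
  refine squeeze_zero_norm' ?_ hlim
  filter_upwards [tendsto_natCast_atTop_atTop.eventually_ge_atTop (2 * ‖w‖),
    tendsto_natCast_atTop_atTop.eventually_ge_atTop (2 * ‖w'‖),
    tendsto_natCast_atTop_atTop.eventually_ge_atTop (M * c),
    (Real.tendsto_log_atTop.comp tendsto_natCast_atTop_atTop).eventually_ge_atTop
      (Real.log (2 * Real.pi) + 1), eventually_gt_atTop 0] with n h1 h2 h3 h4 h5
  have hn : (0 : ℝ) < n := by exact_mod_cast h5
  set v := cuspPoint w n
  set v' := cuspPoint w' n
  have l1 := norm_log_cuspPoint_le h1 h5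
  have l2 := norm_log_cuspPoint_le h2 h5
  have hd : ‖mellinParam v - mellinParam v'‖ ≤ c / n := by
    have e : mellinParam v - mellinParam v' =
      (Complex.log v + Real.log n) - (Complex.log v' + Real.log n) := by
      simp only [mellinParam]; ring
    rw [e]
    refine (norm_sub_le _ _).trans ((add_le_add l1 l2).trans_eq ?_)
    rw [hc]; ring
  have l3 : |(Complex.log v).re + Real.log n| ≤ 3 / 4 := by
    have := (Complex.abs_re_le_norm _).trans l1
    rw [Complex.add_re, Complex.ofReal_re] at this
    refine this.trans ?_
    have : ‖w‖ / n ≤ 1 / 2 := by rw [div_le_iff₀ hn]; linarith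
    linarith
  have hlog2 : 0 ≤ Real.log (2 * Real.pi) := Real.log_nonneg (by linarith [Real.pi_gt_three])
  simp only [Function.comp] at h4
  have hre : (mellinParam v).re ≤ 0 := by
    rw [mellinParam_re]; linarith [(abs_le.1 l3).2]
  have him : |(mellinParam v).im| ≤ Real.pi := by
    rw [mellinParam_im]
    have h0 := Complex.arg_nonneg_iff.2 (cuspPoint_im_pos hw n).le
    have h1 := Complex.arg_le_pi v
    exact abs_le.2 ⟨by linarith [Real.pi_pos], by linarith [Real.pi_pos]⟩
  have hB' := hB (mellinParam v) (mellinParam v') hre him (by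
    calc M * ‖mellinParam v - mellinParam v'‖ ≤ M * (c / n) := by gcongr
      _ = M * c / n := by ring
      _ ≤ 1 := by rw [div_le_one hn]; exact h3)
  rw [exp_mellinParam (cuspPoint_ne_zero hw n), exp_mellinParam (cuspPoint_ne_zero hw' n),
    mul_assoc (-(2 * Real.pi * Complex.I) : ℂ) (cuspPoint w n),
    mul_assoc (-(2 * Real.pi * Complex.I) : ℂ) (cuspPoint w' n), ← mul_sub, norm_mul] at hB'
  have hnI : 1 ≤ ‖(-(2 * Real.pi * Complex.I) : ℂ)‖ := by
    rw [norm_neg, norm_mul, norm_mul, Complex.norm_I, Complex.norm_real, Complex.norm_ofNat,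
      Real.norm_of_nonneg Real.pi_pos.le]
    linarith [Real.pi_gt_three]
  refine (le_mul_of_one_le_left (norm_nonneg _) hnI).trans (hB'.trans ?_)
  have hexp : Real.exp (-(1 / 4 * (mellinParam v).re)) ≤ Real.exp 1 * (n : ℝ) ^ (1 / 4 : ℝ) := by
    rw [Real.rpow_def_of_pos hn, ← Real.exp_add, mellinParam_re]
    refine Real.exp_le_exp.2 ?_
    linarith [(abs_le.1 l3).1]
  have hpow : (n : ℝ) ^ (-(3 / 4) : ℝ) = (n : ℝ) ^ (1 / 4 : ℝ) / n := by
    rw [show (-(3 / 4) : ℝ) = 1 / 4 - 1 by norm_num, Real.rpow_sub_one hn.ne']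
  have hc0 : 0 ≤ c := by positivity
  calc _ ≤ K * (Real.exp 1 * (n : ℝ) ^ (1 / 4 : ℝ)) * (c / n) := by gcongr
    _ = _ := by rw [hpow]; ring

/-! ### Comparing the two expansions at a cusp -/

lemma qSeries_sub_natCast (a : ℕ → ℂ) (z : ℂ) (k : ℕ) : qSeries a (z - k) = qSeries a z := by
  refine tsum_congr fun n => ?_
  congr 1
  rw [Complex.exp_eq_exp_iff_exists_int]
  refine ⟨-((n + 1 : ℕ) * k : ℤ), ?_⟩
  push_cast; ring

lemma qSeries_one_add (a : ℕ → ℂ) (z : ℂ) : qSeries a (1 + z) = qSeries a z := by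
  have := qSeries_sub_natCast a (1 + z) 1
  rw [Nat.cast_one, add_sub_cancel_left] at this
  exact this.symm

namespace HasReflection

variable {F : ℂ → ℂ} {a b : ℕ → ℂ} {κ : ℂ} {T : ℝ}

/-- The reflection at `v = -1/(w - n)` evaluates the dual series at `w - n`, hence at `w` by
periodicity. The error is then bounded in `n`, and the factor `v` makes it tend to 0. -/
lemma tendsto_cuspPoint_mul (h : HasReflection F a b κ T) {w : ℂ} (hw : 0 < w.im) :
    Tendsto (fun n => cuspPoint w n * (2 * Real.pi * qSeries a (cuspPoint w n)) -
      κ * (2 * Real.pi * qSeries b w) -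
      cuspPoint w n * boundaryTerm F T (mellinParam (cuspPoint w n))) atTop (𝓝 0) := by
  obtain ⟨K, hK, hq⟩ := h.exists_norm_qSeries_sub_le
  have hlim : Tendsto (fun n => ‖cuspPoint w n‖ * (K * (1 + w.im ^ (-(1 / 4) : ℝ)))) atTop (𝓝 0) := by
    simpa using ((tendsto_cuspPoint w).norm).mul_const (K * (1 + w.im ^ (-(1 / 4) : ℝ)))
  refine squeeze_zero_norm' ?_ hlim
  filter_upwards [tendsto_natCast_atTop_atTop.eventually_gt_atTop w.re,
    ((tendsto_cuspPoint w).norm).eventually_le_const (u := 2) (by simp)] with n h1 h2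
  have h3 := hq (cuspPoint w n) (cuspPoint_re_pos h1) (cuspPoint_im_pos hw n) h2
  have hv := cuspPoint_ne_zero hw n
  rw [neg_one_div_cuspPoint hw, qSeries_sub_natCast, Complex.sub_im, Complex.natCast_im,
    sub_zero] at h3
  have e : cuspPoint w n * (2 * Real.pi * qSeries a (cuspPoint w n)) -
      κ * (2 * Real.pi * qSeries b w) -
      cuspPoint w n * boundaryTerm F T (mellinParam (cuspPoint w n)) =
      cuspPoint w n * (2 * Real.pi * qSeries a (cuspPoint w n) -
        κ * (cuspPoint w n)⁻¹ * (2 * Real.pi * qSeries b w) -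
        boundaryTerm F T (mellinParam (cuspPoint w n))) := by
    field_simp
  rw [e, norm_mul]
  gcongr

/-- By periodicity the reflection may be taken at `1 + v` instead of `v`. With `u = v / (1 + v)`,
the next cusp point, `-1/(1 + v) = u - 1`, so the dual series appears at `u`. The boundary term
stays bounded here because `1 + v` tends to 1. -/
lemma tendsto_cuspPoint_mul_sub (h : HasReflection F a b κ T) {w : ℂ} (hw : 0 < w.im) :
    Tendsto (fun n => cuspPoint w n * (2 * Real.pi * qSeries a (cuspPoint w n)) -
      κ * (cuspPoint w (n + 1) * (2 * Real.pi * qSeries b (cuspPoint w (n + 1))))) atTop (𝓝 0) := by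
  obtain ⟨K, hK, hq⟩ := h.exists_norm_qSeries_sub_le
  obtain ⟨K', M, hK', hM, hB, -⟩ := h.exists_boundaryTerm_bounds
  have hv0 := tendsto_cuspPoint w
  have hlim1 : Tendsto (fun n => ‖cuspPoint w n‖ * (K' * Real.exp (M *
      ‖mellinParam (1 + cuspPoint w n)‖))) atTop (𝓝 0) := by
    have hc : ContinuousAt (fun v : ℂ => K' * Real.exp (M * ‖mellinParam (1 + v)‖)) 0 := by
      have : ContinuousAt (fun v : ℂ => mellinParam (1 + v)) 0 := by
        unfold mellinParam
        refine continuousAt_const.add (ContinuousAt.clog (by fun_prop) (by simp))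
      fun_prop
    simpa using hv0.norm.mul (hc.tendsto.comp hv0)
  -- `Im u` has order `n⁻²`, so the error of the reflection has order `n^(1/2)`, against `‖v‖ =
  -- O(1/n)`.
  have hlim2 : Tendsto (fun n => ‖cuspPoint w n‖ * (cuspPoint w (n + 1)).im ^ (-(1 / 4) : ℝ))
      atTop (𝓝 0) := by
    have hl : Tendsto (fun n : ℕ => 2 * 2 ^ (1 / 2 : ℝ) * w.im ^ (-(1 / 4) : ℝ) *
        (n : ℝ) ^ (-(1 / 2) : ℝ)) atTop (𝓝 0) := by
      rw [← mul_zero (2 * 2 ^ (1 / 2 : ℝ) * w.im ^ (-(1 / 4) : ℝ))]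
      exact ((tendsto_rpow_neg_atTop (by norm_num)).comp tendsto_natCast_atTop_atTop).const_mul _
    refine squeeze_zero' (Eventually.of_forall fun n => mul_nonneg (norm_nonneg _)
      (Real.rpow_nonneg (cuspPoint_im_pos hw _).le _)) ?_ hl
    filter_upwards [tendsto_natCast_atTop_atTop.eventually_ge_atTop (2 * ‖w‖),
      eventually_gt_atTop 1] with n h1 h2
    have hn : (1 : ℝ) < n := by exact_mod_cast h2
    have hr0 := norm_pos_iff.2 (sub_natCast_ne_zero hw (n + 1))
    have hr : ‖w - (n + 1 : ℕ)‖ ≤ 2 * n := by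
      refine (norm_sub_le _ _).trans ?_
      rw [Complex.norm_natCast]
      push_cast
      have : ‖w‖ ≤ n / 2 := by linarith
      have h3 : (2 : ℝ) ≤ n := by exact_mod_cast h2
      linarith
    have e1 : (cuspPoint w (n + 1)).im ^ (-(1 / 4) : ℝ) =
        w.im ^ (-(1 / 4) : ℝ) * ‖w - (n + 1 : ℕ)‖ ^ (1 / 2 : ℝ) := by
      rw [cuspPoint_im, Real.div_rpow hw.le (by positivity), ← Real.rpow_natCast,
        ← Real.rpow_mul hr0.le, div_eq_mul_inv, ← Real.rpow_neg hr0.le]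
      norm_num
    rw [e1]
    calc _ ≤ 2 / n * (w.im ^ (-(1 / 4) : ℝ) * (2 * n) ^ (1 / 2 : ℝ)) := by
          gcongr
          exact norm_cuspPoint_le h1 (by omega)
      _ = _ := by
          rw [Real.mul_rpow two_pos.le (by linarith), show (-(1 / 2) : ℝ) = 1 / 2 - 1 by norm_num,
            Real.rpow_sub_one (by linarith : (n : ℝ) ≠ 0)]
          ring
  have hlim : Tendsto (fun n => ‖cuspPoint w n‖ * K +
      K * (‖cuspPoint w n‖ * (cuspPoint w (n + 1)).im ^ (-(1 / 4) : ℝ)) +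
      ‖cuspPoint w n‖ * (K' * Real.exp (M * ‖mellinParam (1 + cuspPoint w n)‖))) atTop (𝓝 0) := by
    simpa using ((hv0.norm.mul_const K).add (hlim2.const_mul K)).add hlim1
  refine squeeze_zero_norm' ?_ hlim
  filter_upwards [(hv0.norm).eventually_le_const (u := 1 / 2) (by simp)] with n h1
  have hx := sub_natCast_ne_zero hw n
  have hx1 := sub_natCast_ne_zero hw (n + 1)
  have hv : (cuspPoint w n) * (w - n) = -1 := by rw [cuspPoint]; field_simp
  have hu : (cuspPoint w (n + 1)) * (w - (n + 1 : ℕ)) = -1 := by rw [cuspPoint]; field_simp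
  have him := cuspPoint_im_pos hw n
  set v := cuspPoint w n
  set u := cuspPoint w (n + 1)
  have hzim : (1 + v).im = v.im := by simp
  have hz : 1 + v ≠ 0 := fun h0 => by rw [h0] at hzim; simp at hzim; linarith
  have hzre : 0 < (1 + v).re := by
    rw [Complex.add_re, Complex.one_re]
    linarith [(abs_le.1 ((Complex.abs_re_le_norm v).trans h1)).1]
  have hvu : v * (1 + v)⁻¹ = u := by
    rw [← div_eq_mul_inv, div_eq_iff hz]
    refine mul_right_cancel₀ hx1 (mul_right_cancel₀ hx ?_)
    push_cast at hu ⊢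
    linear_combination (w - (n + 1)) * hv - (w - n) * hu - u * (w - (n + 1)) * hv + hu
  have hz1 : -1 / (1 + v) = u - 1 := by
    rw [← hvu]; field_simp; ring
  have h3 := hq (1 + v) hzre (by rw [hzim]; exact him) ((norm_add_le _ _).trans (by
    rw [norm_one]; linarith))
  have hu1 := qSeries_sub_natCast b u 1
  rw [Nat.cast_one] at hu1
  rw [hz1, qSeries_one_add, hu1, Complex.sub_im, Complex.one_im, sub_zero] at h3
  have e : v * (2 * Real.pi * qSeries a v) - κ * (u * (2 * Real.pi * qSeries b u)) =
      v * (2 * Real.pi * qSeries a v - κ * (1 + v)⁻¹ * (2 * Real.pi * qSeries b u) -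
        boundaryTerm F T (mellinParam (1 + v))) + v * boundaryTerm F T (mellinParam (1 + v)) := by
    rw [← hvu]; ring
  rw [e]
  refine (norm_add_le _ _).trans ?_
  rw [norm_mul, norm_mul]
  refine (add_le_add (mul_le_mul_of_nonneg_left h3 (norm_nonneg _))
    (mul_le_mul_of_nonneg_left (hB _) (norm_nonneg _))).trans_eq ?_
  ring

end HasReflection

/-- Direct reflection expresses `v f(v)` through `κ g(w)`. Reflection at `1 + v`, followed by the
dual reflection at the next cusp point, expresses it through `κ κ' f(w)`. The difference is balanced
by boundary terms alone, and these cancel in the limit when two points `w` and `w'` are compared. -/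
theorem qSeries_sub_eq {F G : ℂ → ℂ} {a b : ℕ → ℂ} {κ κ' : ℂ} {T T' : ℝ} (hκ : κ ≠ 0)
    (h : HasReflection F a b κ T) (h' : HasReflection G b a κ' T') {w w' : ℂ} (hw : 0 < w.im)
    (hw' : 0 < w'.im) :
    qSeries b w - κ' * qSeries a w = qSeries b w' - κ' * qSeries a w' := by
  have main : ∀ w : ℂ, 0 < w.im → Tendsto (fun n =>
      κ * (2 * Real.pi) * (qSeries b w - κ' * qSeries a w) +
      (cuspPoint w n * boundaryTerm F T (mellinParam (cuspPoint w n)) -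
      κ * (cuspPoint w (n + 1) * boundaryTerm G T' (mellinParam (cuspPoint w (n + 1))))))
      atTop (𝓝 0) := by
    intro w hw
    have t1 := h.tendsto_cuspPoint_mul hw
    have t2 := h.tendsto_cuspPoint_mul_sub hw
    have t3 := (h'.tendsto_cuspPoint_mul hw).comp (tendsto_add_atTop_nat 1)
    have := (t2.sub t1).add (t3.const_mul κ)
    rw [sub_zero, mul_zero, add_zero] at this
    refine this.congr fun n => ?_
    simp only [Function.comp]
    ring
  have t4 := h.tendsto_boundaryTerm_sub hw hw'
  have t5 := (h'.tendsto_boundaryTerm_sub hw hw').comp (tendsto_add_atTop_nat 1)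
  have t6 := ((main w hw).sub (main w' hw')).sub (t4.sub (t5.const_mul κ))
  have t7 : Tendsto (fun _ : ℕ => κ * (2 * Real.pi) * ((qSeries b w - κ' * qSeries a w) -
      (qSeries b w' - κ' * qSeries a w'))) atTop (𝓝 0) := by
    simp only [sub_zero, mul_zero] at t6
    refine t6.congr fun n => ?_
    simp only [Function.comp]
    ring
  have t8 := tendsto_nhds_unique tendsto_const_nhds t7
  have hne : κ * (2 * Real.pi) ≠ 0 := mul_ne_zero hκ (by exact_mod_cast Real.two_pi_pos.ne')
  exact sub_eq_zero.1 ((mul_eq_zero.1 t8).resolve_left hne)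

lemma summable_qSeries {a : ℕ → ℂ} (ha : LSeriesSummable a ((5 / 4 : ℝ) : ℂ)) {z : ℂ}
    (hz : 0 < z.im) :
    Summable fun n : ℕ => a (n + 1) * Complex.exp (2 * Real.pi * Complex.I * (n + 1 : ℕ) * z) := by
  have hz0 : z ≠ 0 := fun h => by simp [h] at hz
  have h1 : |(mellinParam z).im| < Real.pi / 2 := by
    rw [mellinParam_im]
    have h0 := Complex.arg_nonneg_iff.2 hz.le
    have h1 := (Complex.arg_le_pi z)
    have h2 : z.arg ≠ 0 := fun h => hz.ne' (Complex.arg_eq_zero_iff.1 h).2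
    have h3 : z.arg ≠ Real.pi := fun h => hz.ne' (Complex.arg_eq_pi_iff.1 h).2
    have h4 := lt_of_le_of_ne h0 h2.symm
    have h5 := lt_of_le_of_ne h1 h3
    exact abs_lt.2 ⟨by linarith, by linarith⟩
  have h2 := (hasSum_integral_LSeries_mul_Gamma (by norm_num) ha h1).2.summable
  rw [summable_mul_left_iff (by exact_mod_cast Real.two_pi_pos.ne')] at h2
  refine h2.congr fun n => ?_
  rw [exp_mellinParam hz0]
  congr 2
  ring

/-! ### Uniqueness of Fourier coefficients -/

lemma exists_norm_le_mul_sq {c : ℕ → ℂ} (hc : LSeriesSummable c ((5 / 4 : ℝ) : ℂ)) :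
    ∃ C : ℝ, 0 ≤ C ∧ ∀ n : ℕ, 1 ≤ n → ‖c n‖ ≤ C * (n : ℝ) ^ 2 := by
  obtain ⟨C, hC⟩ := (hc.tendsto_atTop_zero.norm.isBoundedUnder_le).bddAbove_range
  refine ⟨max C 0, le_max_right _ _, fun n hn => ?_⟩
  have h1 : ‖LSeries.term c ((5 / 4 : ℝ) : ℂ) n‖ ≤ C := hC ⟨n, rfl⟩
  have hn' : (1 : ℝ) ≤ n := by exact_mod_cast hn
  rw [LSeries.norm_term_eq, if_neg (by omega), Complex.ofReal_re, div_le_iff₀ (by positivity)] at h1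
  calc ‖c n‖ ≤ C * (n : ℝ) ^ (5 / 4 : ℝ) := h1
    _ ≤ max C 0 * (n : ℝ) ^ (2 : ℝ) := by
      gcongr
      · exact le_max_left _ _
      · norm_num
    _ = _ := by rw [Real.rpow_two]

/-- In the variable `q = exp (2πiz)` the hypothesis is the vanishing of a power series on a
punctured disc, with `-k` as constant coefficient. Every coefficient is therefore 0. -/
theorem eq_zero_of_qSeries_eq_const {c : ℕ → ℂ} (hc : LSeriesSummable c ((5 / 4 : ℝ) : ℂ)) {k : ℂ}
    (h : ∀ w : ℂ, 0 < w.im → qSeries c w = k) {n : ℕ} (hn : 1 ≤ n) : c n = 0 := by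
  obtain ⟨C, hC, hb⟩ := exists_norm_le_mul_sq hc
  set e : ℕ → ℂ := fun n => if n = 0 then -k else c n with he
  set p := FormalMultilinearSeries.ofScalars ℂ e with hp
  -- The coefficients are `O(n²)` and `n² / 4^n ≤ 1`, so `1/4` is a safe radius.
  have hrad : ((1 / 4 : NNReal) : ENNReal) ≤ p.radius := by
    refine p.le_radius_of_bound (max C ‖k‖) fun n => ?_
    have h1 : ‖p n‖ = ‖e n‖ := FormalMultilinearSeries.ofScalars_norm ℂ e (n := n)
    rw [h1, he]
    rcases Nat.eq_zero_or_pos n with rfl | hn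
    · simp
    · simp only [hn.ne', if_false]
      have h2 : ((n : ℝ) / 2 ^ n) ^ 2 ≤ 1 := by
        refine pow_le_one₀ (by positivity) ?_
        rw [div_le_one (by positivity)]
        exact_mod_cast (Nat.lt_two_pow_self).le
      calc ‖c n‖ * ((1 / 4 : NNReal) : ℝ) ^ n ≤ C * (n : ℝ) ^ 2 * (1 / 4) ^ n := by
            have : ((1 / 4 : NNReal) : ℝ) = 1 / 4 := by norm_num
            rw [this]
            gcongr
            exact hb n hn
        _ = C * ((n : ℝ) / 2 ^ n) ^ 2 := by
            have : (4 : ℝ) ^ n = (2 ^ n) ^ 2 := by rw [← pow_mul, mul_comm, pow_mul]; norm_num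
            rw [div_pow, div_pow, one_pow, this]
            ring
        _ ≤ C * 1 := by gcongr
        _ ≤ _ := by rw [mul_one]; exact le_max_left _ _
  have hpos : 0 < p.radius := lt_of_lt_of_le (by simp) hrad
  have hball := p.hasFPowerSeriesOnBall hpos
  have hat := hball.hasFPowerSeriesAt
  have hz : ∀ᶠ q in 𝓝[≠] (0 : ℂ), p.sum q = 0 := by
    have h4 : Metric.ball (0 : ℂ) (1 / 4) ∈ 𝓝 (0 : ℂ) := Metric.ball_mem_nhds _ (by norm_num)
    filter_upwards [self_mem_nhdsWithin, mem_nhdsWithin_of_mem_nhds h4] with q hq0 hq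
    have hq0' : q ≠ 0 := hq0
    have hqn : ‖q‖ < 1 / 4 := by simpa using hq
    have hqb : q ∈ Metric.eball (0 : ℂ) p.radius := by
      refine Metric.eball_subset_eball hrad ?_
      rw [Metric.mem_eball, edist_zero_right, ← ofReal_norm, ENNReal.ofReal_lt_coe_iff] <;>
        [simpa using hqn; positivity]
    have hs := hball.hasSum hqb
    rw [zero_add] at hs
    simp only [hp, FormalMultilinearSeries.ofScalars_apply_eq] at hs
    set w : ℂ := Complex.log q / (2 * Real.pi * Complex.I)
    have h2pi : (2 * Real.pi * Complex.I : ℂ) ≠ 0 := Complex.two_pi_I_ne_zero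
    have hw : 0 < w.im := by
      have : w = -(Complex.I * Complex.log q) * ((1 / (2 * Real.pi) : ℝ) : ℂ) := by
        have : (Real.pi : ℂ) ≠ 0 := by exact_mod_cast Real.pi_pos.ne'
        simp only [w]
        push_cast
        field_simp
        rw [Complex.I_sq]
        ring
      rw [this, Complex.im_mul_ofReal, Complex.neg_im, Complex.I_mul_im, Complex.log_re]
      have := Real.log_neg (norm_pos_iff.2 hq0') (by linarith)
      exact mul_pos (by linarith) (by positivity)
    have hexp : ∀ n : ℕ, Complex.exp (2 * Real.pi * Complex.I * (n + 1 : ℕ) * w) = q ^ (n + 1) := by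
      intro n
      have : 2 * Real.pi * Complex.I * (n + 1 : ℕ) * w = (n + 1 : ℕ) * Complex.log q := by
        simp only [w]; field_simp
      rw [this, Complex.exp_nat_mul, Complex.exp_log hq0']
    have h5 := h w hw
    rw [qSeries] at h5
    simp only [hexp] at h5
    have h6 := hs.tsum_eq
    rw [hs.summable.tsum_eq_zero_add] at h6
    rw [← h6]
    simp [he, h5, smul_eq_mul]
  have hz' : ∀ᶠ q in 𝓝 (0 : ℂ), p.sum q = 0 :=
    (hat.analyticAt.frequently_zero_iff_eventually_zero).1 hz.frequently
  have hp0 := (hat.congr hz').eq_zero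
  have hen : e n = 0 := by
    have := FormalMultilinearSeries.ofScalars_norm ℂ e (n := n)
    rw [← hp, hp0] at this
    simpa using this.symm
  simpa [he, show n ≠ 0 by omega] using hen

namespace IsExtendedSelberg

/-- The Dirichlet coefficients are proportional to their conjugates. -/
theorem exists_conj_eq_mul {F : ℂ → ℂ} {a : ℕ → ℂ} {γ : GammaFactor} {ω : ℂ}
    (hF : IsExtendedSelberg F a γ ω)
    (hdeg : γ.degree = 2) (hcond : γ.conductor = 1) (hθ : γ.theta = 0) :
    ∃ k : ℂ, ∀ n : ℕ, 1 ≤ n → conj (a n) = k * a n := by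
  have hω : ω ≠ 0 := norm_ne_zero_iff.1 (by rw [hF.norm_omega]; exact one_ne_zero)
  obtain ⟨T, h⟩ := hF.exists_hasReflection hdeg hcond hθ
  obtain ⟨T', h'⟩ := hF.dual.exists_hasReflection hdeg hcond
    (by rw [γ.dual_theta, hθ, neg_zero])
  -- The dual of the dual series is the original one, so the second reflection leads back from `conj
  -- a` to `a`.
  simp only [Complex.conj_conj] at h'
  set k := γ.dual.kappa (conj ω) 1
  refine ⟨k, fun n hn => sub_eq_zero.1 ?_⟩
  have hs : LSeriesSummable (fun n => conj (a n) - k * a n) ((5 / 4 : ℝ) : ℂ) :=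
    h.summable_right.sub (h.summable_left.smul k)
  refine eq_zero_of_qSeries_eq_const hs (k := qSeries (fun n => conj (a n)) Complex.I -
    k * qSeries a Complex.I) (fun w hw => ?_) hn
  rw [← qSeries_sub_eq (γ.kappa_ne_zero hω 1) h h' hw (by simp), qSeries, qSeries, qSeries,
    ← tsum_mul_left, ← (summable_qSeries h.summable_right hw).tsum_sub
      ((summable_qSeries h.summable_left hw).mul_left k)]
  exact tsum_congr fun n => by ring

/-- The coefficients of a normalized function are real. -/
theorem conj_coeff_eq {F : ℂ → ℂ} {a : ℕ → ℂ} {γ : GammaFactor} {ω : ℂ}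
    (hF : IsExtendedSelberg F a γ ω)
    (hdeg : γ.degree = 2) (hcond : γ.conductor = 1) (hnorm : IsNormalized a γ) {n : ℕ}
    (hn : 1 ≤ n) : conj (a n) = a n := by
  obtain ⟨k, hk⟩ := hF.exists_conj_eq_mul hdeg hcond hnorm.1
  obtain ⟨m, hm, h1, -⟩ := hnorm.2
  have := hk m hm
  rw [h1, map_one, mul_one] at this
  rw [hk n hn, ← this, one_mul]

end IsExtendedSelberg

/-! ### The gamma factor and its dual -/

namespace GammaFactor

variable (γ : GammaFactor)

/-- The quotient of the Stirling corrections of `γ` and of its dual. -/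
noncomputable def dualQuotient (w : ℂ) : ℂ :=
  (∏ j, stirlingQuotient (γ.mu j) (γ.lam j * w)) *
    (∏ j, stirlingQuotient (conj (γ.mu j)) (γ.lam j * w))⁻¹

/-- The coefficient is `∑ (B_2(μ_j) - B_2(conj μ_j)) / (2λ_j) = (H(2) - conj H(2)) / 4`. -/
lemma hasJet_dualQuotient {δ : ℝ} (hδ : 0 < δ) :
    HasJet (sectorAtInf δ) γ.dualQuotient (Complex.I / 2 * (γ.H 2).im) := by
  have hl := tendsto_inv_sectorAtInf δ
  have h1 := fun j => (hasJet_stirlingQuotient (γ.mu j) hδ).comp_mul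
    (tendsto_mul_sectorAtInf (γ.lam_pos j) δ)
  have h2 := fun j => (hasJet_stirlingQuotient (conj (γ.mu j)) hδ).comp_mul
    (tendsto_mul_sectorAtInf (γ.lam_pos j) δ)
  have h := (HasJet.prod hl Finset.univ fun j _ => h1 j).mul hl
    ((HasJet.prod hl Finset.univ fun j _ => h2 j).inv hl)
  have e : conj (γ.H 2) = 2 * ∑ j, (conj (γ.mu j) ^ 2 - conj (γ.mu j) + 1 / 6) / γ.lam j := by
    rw [γ.H_two, map_mul, map_sum]
    simp only [map_div₀, map_add, map_sub, map_pow, map_one, Complex.conj_ofNat,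
      Complex.conj_ofReal]
  have e2 : Complex.I / 2 * ((γ.H 2).im : ℂ) = (γ.H 2 - conj (γ.H 2)) / 4 := by
    rw [Complex.sub_conj]; push_cast; ring
  have e3 : Complex.I / 2 * ((γ.H 2).im : ℂ) =
      (∑ j, (γ.mu j ^ 2 - γ.mu j + 1 / 6) / 2 / γ.lam j) +
        -∑ j, (conj (γ.mu j) ^ 2 - conj (γ.mu j) + 1 / 6) / 2 / γ.lam j := by
    rw [e2, e, γ.H_two, ← sub_eq_add_neg, ← Finset.sum_sub_distrib, ← mul_sub,
      ← Finset.sum_sub_distrib, Finset.mul_sum, Finset.sum_div]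
    exact Finset.sum_congr rfl fun j _ => by ring
  rw [e3]
  exact h

/-- The limit of `γ / γ.dual`. -/
noncomputable def dualLimit : ℂ :=
  Complex.exp (∑ j, (γ.mu j - conj (γ.mu j)) * Real.log (γ.lam j))

/-- The main terms of `γ` and its dual differ by `exp ((μ_j - conj μ_j)(log λ_j + log w))`. The `log
w` parts cancel in the product over `j` because `θ = 0`, which leaves the constant `dualLimit`. -/
lemma eval_eq_dualQuotient (hdeg : γ.degree = 2) (hθ : γ.theta = 0) {w : ℂ} (hw : w ≠ 0)
    (hne : (∏ j, stirlingQuotient (conj (γ.mu j)) (γ.lam j * w)) ≠ 0) :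
    γ.eval w = γ.dualLimit * γ.dualQuotient w * γ.dual.eval w := by
  have hmu : ∑ j, (γ.mu j - conj (γ.mu j)) = 0 := by
    have : ∀ j, γ.mu j - conj (γ.mu j) = ((γ.mu j).im : ℂ) * (2 * Complex.I) := fun j => by
      rw [Complex.sub_conj]; push_cast; ring
    rw [Finset.sum_congr rfl fun j _ => this j, ← Finset.sum_mul]
    have h0 : ∑ j, ((γ.mu j).im : ℂ) = 0 := by exact_mod_cast γ.sum_mu_im hdeg hθ
    rw [h0, zero_mul]
  have hj : ∀ j, Complex.Gamma (γ.lam j * w + γ.mu j) *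
      stirlingQuotient (conj (γ.mu j)) (γ.lam j * w) =
      Complex.exp ((γ.mu j - conj (γ.mu j)) * Real.log (γ.lam j) +
        (γ.mu j - conj (γ.mu j)) * Complex.log w) *
      Complex.Gamma (γ.lam j * w + conj (γ.mu j)) * stirlingQuotient (γ.mu j) (γ.lam j * w) := by
    intro j
    rw [Gamma_eq_stirlingQuotient, Gamma_eq_stirlingQuotient, γ.log_lam_mul j hw]
    have e : Complex.exp ((γ.lam j * w + γ.mu j - 1 / 2) * (Real.log (γ.lam j) + Complex.log w) -
        γ.lam j * w) = Complex.exp ((γ.mu j - conj (γ.mu j)) * Real.log (γ.lam j) +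
        (γ.mu j - conj (γ.mu j)) * Complex.log w) *
        Complex.exp ((γ.lam j * w + conj (γ.mu j) - 1 / 2) *
          (Real.log (γ.lam j) + Complex.log w) - γ.lam j * w) := by
      rw [← Complex.exp_add]; ring_nf
    rw [e]; ring
  have hprod := Finset.prod_congr rfl fun j (_ : j ∈ Finset.univ) => hj j
  simp only [Finset.prod_mul_distrib, ← Complex.exp_sum, Finset.sum_add_distrib,
    ← Finset.sum_mul, hmu, zero_mul, add_zero] at hprod
  rw [dualQuotient, dualLimit, eval, eval]
  have hd : ∏ j, Complex.Gamma (γ.dual.lam j * w + γ.dual.mu j) =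
    ∏ j, Complex.Gamma (γ.lam j * w + conj (γ.mu j)) := rfl
  have hQ : γ.dual.Q = γ.Q := rfl
  rw [hQ]
  erw [hd]
  refine mul_right_cancel₀ hne ?_
  have hinv := inv_mul_cancel₀ hne
  generalize (∏ j, stirlingQuotient (conj (γ.mu j)) (γ.lam j * w)) = N' at hprod hinv ⊢
  generalize (∏ j, stirlingQuotient (γ.mu j) (γ.lam j * w)) = N at hprod hinv ⊢
  linear_combination (γ.Q : ℂ) ^ w * hprod - (γ.Q : ℂ) ^ w * N * Complex.exp (∑ j,
    (γ.mu j - conj (γ.mu j)) * Real.log (γ.lam j)) *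
    (∏ j, Complex.Gamma (γ.lam j * w + conj (γ.mu j))) * hinv

lemma differentiable_inv_eval : Differentiable ℂ fun s => (γ.eval s)⁻¹ := by
  have e : (fun s => (γ.eval s)⁻¹) = fun s => ((γ.Q : ℂ) ^ s)⁻¹ *
      ∏ j, (Complex.Gamma (γ.lam j * s + γ.mu j))⁻¹ := by
    funext s
    rw [eval, mul_inv, Finset.prod_inv_distrib]
  have hQ : (γ.Q : ℂ) ≠ 0 := by exact_mod_cast γ.Q_pos.ne'
  rw [e]
  refine Differentiable.mul ?_ ?_
  · refine Differentiable.inv (fun s => ?_) fun s => ?_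
    · exact (differentiableAt_id).const_cpow (Or.inl hQ)
    · rw [Ne, Complex.cpow_eq_zero_iff]; exact fun h => hQ h.1
  · refine Differentiable.fun_finsetProd fun j _ => ?_
    exact Complex.differentiable_one_div_Gamma.comp (by fun_prop : Differentiable ℂ
      fun s : ℂ => (γ.lam j : ℂ) * s + γ.mu j)

lemma regularAt_of_re_pos {s : ℂ} (hs : 0 < s.re) : γ.RegularAt s := by
  intro j k h
  have h1 : γ.lam j * s.re + (γ.mu j).re = -k := by simpa using congrArg Complex.re h
  have := mul_pos (γ.lam_pos j) hs
  have := γ.mu_re_nonneg j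
  have : (0 : ℝ) ≤ k := k.cast_nonneg
  linarith

/-- If `γ(s) γ(1 - s)` agrees up to a constant with its dual, then `Im H(2) = 0`. -/
theorem H_two_im_eq_zero (hdeg : γ.degree = 2) (hθ : γ.theta = 0) {k : ℂ} (hk : k ≠ 0)
    (h : ∀ s : ℂ, (γ.dual.eval s)⁻¹ * (γ.dual.eval (1 - s))⁻¹ =
      k * ((γ.eval s)⁻¹ * (γ.eval (1 - s))⁻¹)) : (γ.H 2).im = 0 := by
  have hπ : 0 < Real.pi / 4 := by positivity
  have hl := tendsto_inv_sectorAtInf (Real.pi / 4)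
  have hu : γ.dualLimit ≠ 0 := Complex.exp_ne_zero _
  have hjet := γ.hasJet_dualQuotient hπ
  have hev0 : ∀ s : ℂ, 0 < s.re → γ.eval s ≠ 0 := fun s hs =>
    γ.eval_ne_zero (γ.regularAt_of_re_pos hs)
  have hev0' : ∀ s : ℂ, 0 < s.re → γ.dual.eval s ≠ 0 := fun s hs =>
    γ.dual.eval_ne_zero (γ.dual.regularAt_of_re_pos hs)
  set D : ℂ → ℂ := fun s => (γ.eval s)⁻¹ with hD
  set D' : ℂ → ℂ := fun s => (γ.dual.eval s)⁻¹ with hD'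
  have hDd : Differentiable ℂ D := γ.differentiable_inv_eval
  have hDd' : Differentiable ℂ D' := γ.dual.differentiable_inv_eval
  have hD0 : ∀ s : ℂ, 0 < s.re → D s ≠ 0 := fun s hs => inv_ne_zero (hev0 s hs)
  have hD0' : ∀ s : ℂ, 0 < s.re → D' s ≠ 0 := fun s hs => inv_ne_zero (hev0' s hs)
  -- `R` is `γ` divided by its dual, glued from two formulas that agree on `0 < Re s < 1` by the
  -- hypothesis. Each has a nonvanishing denominator in its own half plane, since `γ` and its dual
  -- have neither zeros nor poles for `Re s > 0`. Hence `R` is entire.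
  set R : ℂ → ℂ := fun s => if 0 < s.re then D' s / D s else k * (D (1 - s) / D' (1 - s)) with hR
  have hR1 : ∀ s : ℂ, 0 < s.re → R s = D' s / D s := fun s hs => if_pos hs
  have hR2 : ∀ s : ℂ, s.re < 1 → R s = k * (D (1 - s) / D' (1 - s)) := by
    intro s hs
    rcases lt_or_ge 0 s.re with h0 | h0
    · have h1 : 0 < (1 - s).re := by rw [Complex.sub_re, Complex.one_re]; linarith
      rw [hR1 s h0, mul_div, div_eq_div_iff (hD0 s h0) (hD0' _ h1)]
      have := h s
      simp only [hD, hD']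
      linear_combination this
    · exact if_neg h0.not_gt
  have hRd : Differentiable ℂ R := by
    intro s
    rcases lt_or_ge 0 s.re with h0 | h0
    · have : DifferentiableAt ℂ (fun s => D' s / D s) s := (hDd' s).div (hDd s) (hD0 s h0)
      refine this.congr_of_eventuallyEq ?_
      filter_upwards [(isOpen_lt continuous_const Complex.continuous_re).mem_nhds h0] with w hw
      exact hR1 w hw
    · have h1 : s.re < 1 := by linarith
      have h2 : 0 < (1 - s).re := by rw [Complex.sub_re, Complex.one_re]; linarith
      have h3 : Differentiable ℂ fun s : ℂ => 1 - s := by fun_prop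
      have : DifferentiableAt ℂ (fun s => k * (D (1 - s) / D' (1 - s))) s :=
        (((hDd.comp h3) s).div ((hDd'.comp h3) s) (hD0' _ h2)).const_mul k
      refine this.congr_of_eventuallyEq ?_
      filter_upwards [(isOpen_lt Complex.continuous_re continuous_const).mem_nhds h1] with w hw
      exact hR2 w hw
  have hquot : ∀ᶠ w in sectorAtInf (Real.pi / 4), ‖γ.dualQuotient w‖ ≤ 2 ∧
      1 / 2 ≤ ‖γ.dualQuotient w‖ ∧
      (∏ j, stirlingQuotient (conj (γ.mu j)) (γ.lam j * w)) ≠ 0 := by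
    have ht := (hjet.tendsto hl).norm
    rw [norm_one] at ht
    have h2 := (HasJet.prod hl Finset.univ fun j _ =>
      (hasJet_stirlingQuotient (conj (γ.mu j)) hπ).comp_mul
        (tendsto_mul_sectorAtInf (γ.lam_pos j) _)).tendsto hl
    exact (ht.eventually_le_const (by norm_num)).and
      ((ht.eventually_const_le (by norm_num)).and (h2.eventually_ne one_ne_zero))
  obtain ⟨r₀, hr₀⟩ := eventually_sectorAtInf.1 hquot
  have hlarge : ∀ w : ℂ, max r₀ 1 ≤ ‖w‖ → 0 < w.re →
      D' w / D w = γ.dualLimit * γ.dualQuotient w ∧ ‖γ.dualQuotient w‖ ≤ 2 ∧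
      1 / 2 ≤ ‖γ.dualQuotient w‖ := by
    intro w hw hre
    obtain ⟨h1, h2, h3⟩ := hr₀ w ((le_max_left _ _).trans hw)
      ((Complex.abs_arg_le_pi_div_two_iff.2 hre.le).trans (by linarith [Real.pi_pos]))
    have hw0 : w ≠ 0 := by rintro rfl; simp at hre
    have h4 := γ.eval_eq_dualQuotient hdeg hθ hw0 h3
    refine ⟨?_, h1, h2⟩
    simp only [hD, hD', div_inv_eq_mul]
    rw [h4]
    field_simp [hev0' w hre]
  -- Compactness bounds both quotients near 0 and Stirling's formula elsewhere. The reflected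
  -- formula transfers the bound to `Re s ≤ 1/2`.
  obtain ⟨K, hK⟩ : ∃ K : ℝ, ∀ w : ℂ, 1 / 2 ≤ w.re → ‖D' w / D w‖ ≤ K ∧ ‖D w / D' w‖ ≤ K := by
    have hcomp : IsCompact (Metric.closedBall (0 : ℂ) (max r₀ 1) ∩ {w : ℂ | 1 / 2 ≤ w.re}) :=
      (isCompact_closedBall _ _).inter_right (isClosed_le continuous_const Complex.continuous_re)
    have hpos : ∀ w : ℂ, 1 / 2 ≤ w.re → 0 < w.re := fun w hw => by linarith
    obtain ⟨K₁, h₁⟩ := hcomp.exists_bound_of_continuousOn (f := fun w => D' w / D w)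
      (hDd'.continuous.continuousOn.div hDd.continuous.continuousOn fun w hw => hD0 w (hpos w hw.2))
    obtain ⟨K₂, h₂⟩ := hcomp.exists_bound_of_continuousOn (f := fun w => D w / D' w)
      (hDd.continuous.continuousOn.div hDd'.continuous.continuousOn fun w hw => hD0' w (hpos w hw.2))
    refine ⟨max (max K₁ K₂) (max (‖γ.dualLimit‖ * 2) (‖γ.dualLimit‖⁻¹ * 2)), fun w hw => ?_⟩
    rcases le_total ‖w‖ (max r₀ 1) with hle | hge
    · have hmem : w ∈ Metric.closedBall (0 : ℂ) (max r₀ 1) ∩ {w : ℂ | 1 / 2 ≤ w.re} :=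
        ⟨by simpa using hle, hw⟩
      exact ⟨(h₁ w hmem).trans ((le_max_left _ _).trans (le_max_left _ _)),
        (h₂ w hmem).trans ((le_max_right _ _).trans (le_max_left _ _))⟩
    · obtain ⟨e, h3, h4⟩ := hlarge w hge (hpos w hw)
      refine ⟨?_, ?_⟩
      · rw [e, norm_mul]
        refine le_trans ?_ ((le_max_left _ _).trans (le_max_right _ _))
        gcongr
      · rw [← inv_div, e, norm_inv, norm_mul, mul_inv]
        refine le_trans ?_ ((le_max_right _ _).trans (le_max_right _ _))
        gcongr
        rw [inv_le_comm₀ (by linarith) two_pos]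
        linarith
  have hRb : Bornology.IsBounded (Set.range R) := by
    refine isBounded_iff_forall_norm_le.2 ⟨max K (‖k‖ * K), ?_⟩
    rintro _ ⟨s, rfl⟩
    rcases le_total (1 / 2) s.re with h0 | h0
    · rw [hR1 s (by linarith)]
      exact (hK s h0).1.trans (le_max_left _ _)
    · rw [hR2 s (by linarith), norm_mul]
      refine le_trans ?_ (le_max_right _ _)
      gcongr
      exact (hK (1 - s) (by rw [Complex.sub_re, Complex.one_re]; linarith)).2
  -- Liouville's theorem. The constant must be the limit `dualLimit`, so `dualQuotient` equals 1 at
  -- all large real points and its `1/w` coefficient vanishes.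
  have hconst := hRd.apply_eq_apply_of_bounded hRb
  have hπ' : Real.pi / 4 ≤ Real.pi := by linarith [Real.pi_pos]
  have htr := tendsto_ofReal_sectorAtInf hπ'
  have hval : ∀ᶠ x : ℝ in atTop, γ.dualLimit * γ.dualQuotient x = R 1 := by
    filter_upwards [eventually_ge_atTop (max r₀ 1)] with x hx
    have hx0 : 0 < x := lt_of_lt_of_le one_pos ((le_max_right _ _).trans hx)
    have := (hlarge x (by rwa [Complex.norm_real, Real.norm_of_nonneg hx0.le]) (by simpa)).1
    rw [← this, ← hR1 x (by simpa)]
    exact hconst _ _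
  have hlim : Tendsto (fun x : ℝ => γ.dualLimit * γ.dualQuotient x) atTop (𝓝 γ.dualLimit) := by
    simpa using ((hjet.tendsto hl).comp htr).const_mul γ.dualLimit
  have hR1' : R 1 = γ.dualLimit :=
    tendsto_nhds_unique (tendsto_const_nhds.congr' (hval.mono fun x hx => hx.symm)) hlim
  have hone : ∀ᶠ x : ℝ in atTop, γ.dualQuotient x = 1 := by
    filter_upwards [hval] with x hx
    rw [hR1'] at hx
    exact mul_left_cancel₀ hu (by rw [hx, mul_one])
  set c : ℂ := Complex.I / 2 * (γ.H 2).im with hc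
  have hO : (fun x : ℝ => c) =O[atTop] fun x : ℝ => ((x : ℂ))⁻¹ := by
    have h1 := hjet.comp_tendsto htr
    obtain ⟨C, hC⟩ := h1.bound
    refine IsBigO.of_bound C ?_
    filter_upwards [hC, hone, eventually_gt_atTop 0] with x hx h1 h0
    simp only [Function.comp, h1] at hx
    have hx0 : (x : ℂ) ≠ 0 := by exact_mod_cast h0.ne'
    rw [sub_add_cancel_left, norm_neg, norm_mul, norm_pow, sq, ← mul_assoc] at hx
    exact le_of_mul_le_mul_right hx (norm_pos_iff.2 (inv_ne_zero hx0))
  have hz : Tendsto (fun x : ℝ => ((x : ℂ))⁻¹) atTop (𝓝 0) := hl.comp htr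
  have hc0 : c = 0 := tendsto_nhds_unique tendsto_const_nhds (hO.trans_tendsto hz)
  rw [hc] at hc0
  have : ((γ.H 2).im : ℂ) = 0 :=
    (mul_eq_zero.1 hc0).resolve_left (div_ne_zero Complex.I_ne_zero two_ne_zero)
  exact_mod_cast this

end GammaFactor

/-! ### From real coefficients to the symmetry of the gamma factor -/

namespace IsExtendedSelberg

variable {F : ℂ → ℂ} {a : ℕ → ℂ} {γ : GammaFactor} {ω : ℂ}

/-- The two Dirichlet series agree for `Re s > 1`, and the identity theorem extends this after
multiplication by `(s - 1)^m`. -/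
lemma conj_apply_conj (hF : IsExtendedSelberg F a γ ω) (ha : ∀ n : ℕ, 1 ≤ n → conj (a n) = a n)
    {s : ℂ} (hs : s ≠ 1) : conj (F (conj s)) = F s := by
  obtain ⟨m, hm, -⟩ := hF.continuation
  have h1 := differentiable_conj_conj hm
  have e : ∀ s : ℂ, conj ((conj s - 1) ^ m * F (conj s)) = (s - 1) ^ m * conj (F (conj s)) := by
    intro s; simp
  simp only [e] at h1
  have h2 := AnalyticOnNhd.eq_of_eventuallyEq (z₀ := 2)
    ((Complex.analyticOnNhd_univ_iff_differentiable).2 h1)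
    ((Complex.analyticOnNhd_univ_iff_differentiable).2 hm) (by
      have : {s : ℂ | 1 < s.re} ∈ 𝓝 (2 : ℂ) :=
        (isOpen_lt continuous_const Complex.continuous_re).mem_nhds (by simp)
      filter_upwards [this] with s hs
      rw [hF.conj_eq_LSeries hs, hF.eq_LSeries s hs]
      congr 1
      exact LSeries_congr (fun {n} hn => ha n (Nat.one_le_iff_ne_zero.2 hn)) s)
  exact mul_left_cancel₀ (pow_ne_zero m (sub_ne_zero.2 hs)) (congrFun h2 s)

/-- Multiplying the functional equations at `s` and `1 - s` gives the identity times `F(s) F(1 -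
s)`. That factor is cancelled globally, since a product of entire functions vanishes only if one of
them does. Reciprocals are used because they are entire. -/
theorem inv_eval_dual_eq (hF : IsExtendedSelberg F a γ ω)
    (ha : ∀ n : ℕ, 1 ≤ n → conj (a n) = a n) (s : ℂ) :
    (γ.dual.eval s)⁻¹ * (γ.dual.eval (1 - s))⁻¹ =
      ω ^ 2 * ((γ.eval s)⁻¹ * (γ.eval (1 - s))⁻¹) := by
  obtain ⟨m, hm, -⟩ := hF.continuation
  obtain ⟨T, hT⟩ := γ.exists_regularAt
  obtain ⟨T', hT'⟩ := γ.dual.exists_regularAt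
  set E : ℂ → ℂ := fun s => (s - 1) ^ m * F s with hE
  set B : ℂ → ℂ := fun s => (γ.dual.eval s)⁻¹ * (γ.dual.eval (1 - s))⁻¹ -
      ω ^ 2 * ((γ.eval s)⁻¹ * (γ.eval (1 - s))⁻¹) with hB
  have h3 : Differentiable ℂ fun s : ℂ => 1 - s := by fun_prop
  have hBd : Differentiable ℂ B :=
    (γ.dual.differentiable_inv_eval.mul (γ.dual.differentiable_inv_eval.comp h3)).sub
      ((γ.differentiable_inv_eval.mul (γ.differentiable_inv_eval.comp h3)).const_mul _)
  have hEd : Differentiable ℂ fun s => E s * E (1 - s) := hm.mul (hm.comp h3)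
  have hzero : ∀ s : ℂ, max (max T T') 1 < s.im → E s * E (1 - s) * B s = 0 := by
    intro s hs
    have h1 : 1 < s.im := (le_max_right _ _).trans_lt hs
    have hle := ((le_max_left (max T T') 1).trans_lt hs).le.trans (le_abs_self _)
    have hTs := (le_max_left T T').trans hle
    have hTs' := (le_max_right T T').trans hle
    have him : (1 - s).im = -s.im := by simp
    have habs : |(1 - s).im| = |s.im| := by rw [him, abs_neg]
    have hs0 : s ≠ 0 := by rintro rfl; simp at h1; linarith
    have hs1 : s ≠ 1 := by rintro rfl; simp at h1; linarith
    have ht0 : 1 - s ≠ 0 := sub_ne_zero.2 hs1.symm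
    have ht1 : 1 - s ≠ 1 := fun h => hs0 (by linear_combination -h)
    have f1 := hF.functional_equation s hs0 hs1 (hT s hTs) (hT _ (by simpa using hTs))
    have f2 := hF.functional_equation (1 - s) ht0 ht1 (hT _ (by rw [habs]; exact hTs))
      (hT _ (by simpa using hTs))
    rw [hF.conj_apply_conj ha ht1, ← γ.dual_eval] at f1
    rw [sub_sub_cancel, hF.conj_apply_conj ha hs1, ← γ.dual_eval] at f2
    have n1 := γ.eval_ne_zero (hT s hTs)
    have n2 := γ.eval_ne_zero (hT (1 - s) (by rw [habs]; exact hTs))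
    have n3 := γ.dual.eval_ne_zero (hT' s hTs')
    have n4 := γ.dual.eval_ne_zero (hT' (1 - s) (by rw [habs]; exact hTs'))
    have key : F s * F (1 - s) * (γ.eval s * γ.eval (1 - s)) =
        F s * F (1 - s) * (ω ^ 2 * (γ.dual.eval s * γ.dual.eval (1 - s))) := by
      linear_combination F (1 - s) * γ.eval (1 - s) * f1 + ω * γ.dual.eval (1 - s) * F (1 - s) * f2
    have hFB : F s * F (1 - s) * B s = 0 := by
      simp only [hB]
      field_simp
      linear_combination key
    simp only [hE]
    linear_combination (s - 1) ^ m * (1 - s - 1) ^ m * hFB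
  have hall : (fun s => E s * E (1 - s) * B s) = fun _ => 0 := by
    refine AnalyticOnNhd.eq_of_eventuallyEq (z₀ := ((max (max T T') 1 + 1 : ℝ) : ℂ) * Complex.I)
      ((Complex.analyticOnNhd_univ_iff_differentiable).2 (hEd.mul hBd))
      ((Complex.analyticOnNhd_univ_iff_differentiable).2 (by fun_prop)) ?_
    have : {s : ℂ | max (max T T') 1 < s.im} ∈
        𝓝 (((max (max T T') 1 + 1 : ℝ) : ℂ) * Complex.I) :=
      (isOpen_lt continuous_const Complex.continuous_im).mem_nhds (by
        rw [Set.mem_ofPred_eq, Complex.im_ofReal_mul, Complex.I_im]; linarith)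
    filter_upwards [this] with s hs using hzero s hs
  -- A Dirichlet series that vanishes for all large real `s` and converges absolutely somewhere has
  -- zero coefficients.
  have hEne : ¬ ∀ s : ℂ, E s = 0 := by
    intro h0
    obtain ⟨n, hn, hne⟩ := hF.nonzero
    have h1 : (fun x : ℝ => LSeries a x) =ᶠ[atTop] 0 := by
      filter_upwards [eventually_gt_atTop 1] with x hx
      have hx1 : (x : ℂ) - 1 ≠ 0 := sub_ne_zero.2 (by exact_mod_cast hx.ne')
      rw [← hF.eq_LSeries x (by simpa using hx)]
      exact (mul_eq_zero.1 (h0 x)).resolve_left (pow_ne_zero _ hx1)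
    rcases LSeries_eventually_eq_zero_iff'.1 h1 with h2 | h2
    · exact hne (h2 n (by omega))
    · have := (hF.summable 2 (by simp)).abscissaOfAbsConv_le
      rw [h2] at this
      simp at this
  have huniv : ∀ {f : ℂ → ℂ}, Differentiable ℂ f → AnalyticOnNhd ℂ f Set.univ := fun hf =>
    (Complex.analyticOnNhd_univ_iff_differentiable).2 hf
  rcases AnalyticOnNhd.eq_zero_or_eq_zero_of_mul_eq_zero (huniv hEd) (huniv hBd)
    (fun z _ => congrFun hall z) isPreconnected_univ with h4 | h4
  · exfalso
    rcases AnalyticOnNhd.eq_zero_or_eq_zero_of_mul_eq_zero (huniv hm) (huniv (hm.comp h3))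
      (fun z hz => h4 z hz) isPreconnected_univ with h5 | h5
    · exact hEne fun s => h5 s trivial
    · refine hEne fun s => ?_
      have := h5 (1 - s) trivial
      simpa using this
  · exact sub_eq_zero.1 (h4 s trivial)

end IsExtendedSelberg

end SelbergClass
theorem lemma4p3 (F : ℂ → ℂ) (a : ℕ → ℂ) (γ : SelbergClass.GammaFactor) (ω : ℂ)
    (hF : SelbergClass.IsExtendedSelberg F a γ ω)
    (hdeg : γ.degree = 2) (hcond : γ.conductor = 1)
    (hnorm : SelbergClass.IsNormalized a γ) :
    ∃ d : ℕ → ℂ, γ.IsStructuralInvariants ω d ∧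
      (∀ d' : ℕ → ℂ, γ.IsStructuralInvariants ω d' → d' = d) ∧
      d 1 = γ.chi - 1 / 8 := by
  have hω : ω ≠ 0 := norm_ne_zero_iff.1 (by rw [hF.norm_omega]; exact one_ne_zero)
  have hH : (γ.H 2).im = 0 := γ.H_two_im_eq_zero hdeg hnorm.1 (pow_ne_zero 2 hω)
    (hF.inv_eval_dual_eq fun n hn => hF.conj_coeff_eq hdeg hcond hnorm hn)
  obtain ⟨d, hd, hd1⟩ := γ.exists_isStructuralInvariants hdeg hcond hnorm.1 ω
  exact ⟨d, hd, fun d' hd' => γ.isStructuralInvariants_unique hdeg hcond hnorm.1 hω hd' hd,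
    hd1.trans (γ.jet_eq_chi hdeg hnorm.1 hH)⟩
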